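/- Let $n\ge 3$ and let $M\subset\mathbb R^n$ be $\mathbb R^n$, an open ball $\{|x|<\nu\}$, or an open annulus $\{\nu_2<|x|<\nu_1\}$ with $0\le\nu_2<\nu_1\le\infty$. Let $F(x,y)=|y|\,\phi(r,s)$, with $r=|x|$, $s=\langle x,y\rangle/|y|$ (and $F(x,0)=0$), be a spherically symmetric Finsler metric on $M$. Assume that $F$ is a Douglas metric (its Douglas curvature vanishes) and that it has constant flag curvature $K\neq 0$. Put $$Q=\frac1{2r}\,\frac{r\phi_{ss}-\phi_r+s\phi_{rs}}{\phi-s\phi_s+(r^2-s^2)\phi_{ss}},\qquad P=\frac{r\phi_s+s\phi_r}{2r\phi}-\frac{Q}{\phi}\left[s\phi+(r^2-s^2)\phi_s\right],$$ so that the geodesic coefficients of $F$ are $G^i=|y|P\,y^i+|y|^2Q\,x^i$. Let $I$ be the set of positive values of $|x|$, $x\in M$. Then: 1. For all $r\in I$ and $|s|<r$ (and also for $|s|=r$ if $\phi$ is smooth in a neighbourhood of $(r,s)$), $$K\phi^2=R_1:=P^2-\frac1r\left(sP_r+rP_s\right)+2Q\left[1+sP+(r^2-s^2)P_s\right],$$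 and so $\phi=\sqrt{R_1/K}$. 2. There is a smooth function $g$ on $I$, with $2r^2g(r)\ne1$ except at one radius $r\in I$ at most, such that $$Q(r,s)=g(r)+\frac{g'(r)+2rg(r)^2}{r-2r^3g(r)}\,s^2\qquad (r\in I,\ 2r^2g(r)\neq1,\ |s|<r).$$ Moreover, for suitable choices of the antiderivatives $$T(r)=\frac{e^{-\int\frac{4rg}{1-2r^2g}\,dr}}{(1-2r^2g)^2},\qquad \overline T(r)=4\int\frac{g'+2rg^2}{1-2r^2g}\,T\,dr,$$ which extend continuously to the exceptional radius, if there is one, and with $$\varphi(r,s)=\frac{r^2-s^2}{(r^2-s^2)\overline T(r)-T(r)},$$ one has, on each of the two parts $0<s<r$ and $-r<s<0$ of the region $r\in I$, $0<|s|<r$, $$P(r,s)=s\left(h(r)-\int\frac{\eta(\varphi(r,s))}{s^2\sqrt{r^2-s^2}}\,ds\right),$$ where the antiderivative in $s$ is normalised to vanish at $s=\pm r/2$, respectively, $h$ is a smooth function on $I$, and $\eta$ is a real function that is smooth at all values $\varphi(r,s)$ taken at points of that part at which the denominator of $\varphi$ does not vanish. The functions $h,\eta$ may depend on the sign of $s$,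 but if $0\in M$ then the same $\eta$ serves for both signs. -/

import Mathlib

open Set Metric
open scoped ContDiff

noncomputable section

namespace SphFinsler

/-- Euclidean space `ℝⁿ`. -/
abbrev Rn (n : ℕ) : Type := EuclideanSpace ℝ (Fin n)

/-! Finsler geometry on an open subset of `ℝⁿ`, in the standard coordinates `(x, y)` of the tangent
bundle.  A function on (a part of) the tangent bundle is a function `Rn n → Rn n → ℝ`. -/

section Finsler

variable {n : ℕ}

/-- The partial derivative `∂f/∂xⁱ`. -/
def dx (i : Fin n) (f : Rn n → Rn n → ℝ) : Rn n → Rn n → ℝ :=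
  fun x y => fderiv ℝ (fun x' => f x' y) x (EuclideanSpace.single i 1)

/-- The partial derivative `∂f/∂yⁱ`. -/
def dy (i : Fin n) (f : Rn n → Rn n → ℝ) : Rn n → Rn n → ℝ :=
  fun x y => fderiv ℝ (fun y' => f x y') y (EuclideanSpace.single i 1)

/-- The function `F²`. -/
def sq (F : Rn n → Rn n → ℝ) : Rn n → Rn n → ℝ := fun x y => F x y ^ 2

/-- The fundamental tensor `g_{ij}(x, y) = ½ ∂²(F²)/∂yⁱ∂yʲ`, as a matrix. -/
def fundamental (F : Rn n → Rn n → ℝ) (x y : Rn n) : Matrix (Fin n) (Fin n) ℝ :=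
  Matrix.of fun i j => 1 / 2 * dy j (dy i (sq F)) x y

/-- The inner product `g_y(u, v) = ∑ g_{ij}(x, y) uⁱ vʲ`. -/
def gInner (F : Rn n → Rn n → ℝ) (x y u v : Rn n) : ℝ :=
  ∑ i, ∑ j, fundamental F x y i j * u i * v j

/-- `F` is a Finsler metric on `M`: smooth off the zero section, and a Minkowski norm on every
tangent space. -/
structure IsFinslerMetric (M : Set (Rn n)) (F : Rn n → Rn n → ℝ) : Prop where
  smooth : ContDiffOn ℝ ∞ (Function.uncurry F) (M ×ˢ {0}ᶜ)
  zero : ∀ x ∈ M, F x 0 = 0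
  pos : ∀ x ∈ M, ∀ y, y ≠ 0 → 0 < F x y
  homogeneous : ∀ x ∈ M, ∀ y, ∀ t : ℝ, 0 < t → F x (t • y) = t * F x y
  posDef : ∀ x ∈ M, ∀ y, y ≠ 0 → ∀ u, u ≠ 0 → 0 < gInner F x y u u

/-- The geodesic coefficients
`Gⁱ = ¼ ∑ₗ gⁱˡ (∑ₖ yᵏ ∂²(F²)/∂xᵏ∂yˡ - ∂(F²)/∂xˡ)`. -/
def spray (F : Rn n → Rn n → ℝ) (i : Fin n) : Rn n → Rn n → ℝ := fun x y =>
  1 / 4 * ∑ l, (fundamental F x y)⁻¹ i l *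
    ((∑ k, y k * dy l (dx k (sq F)) x y) - dx l (sq F) x y)

/-- The Riemann curvature
`Rⁱₖ = 2 ∂Gⁱ/∂xᵏ - yʲ ∂²Gⁱ/∂xʲ∂yᵏ + 2 Gʲ ∂²Gⁱ/∂yʲ∂yᵏ - ∂Gⁱ/∂yʲ ∂Gʲ/∂yᵏ` (sum over `j`). -/
def riemann (F : Rn n → Rn n → ℝ) (i k : Fin n) : Rn n → Rn n → ℝ := fun x y =>
  2 * dx k (spray F i) x y
    - (∑ j, y j * dy k (dx j (spray F i)) x y)
    + 2 * (∑ j, spray F j x y * dy k (dy j (spray F i)) x y)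
    - ∑ j, dy j (spray F i) x y * dy k (spray F j) x y

/-- The vector `R_y(u)`, with components `∑ₖ Rⁱₖ uᵏ`. -/
def riemannMap (F : Rn n → Rn n → ℝ) (x y u : Rn n) : Rn n :=
  WithLp.toLp 2 fun i => ∑ k, riemann F i k x y * u k

/-- The flag curvature of the flag spanned by `y` and `u`, with flagpole `y`. -/
def flagCurvature (F : Rn n → Rn n → ℝ) (x y u : Rn n) : ℝ :=
  gInner F x y (riemannMap F x y u) u /
    (gInner F x y y y * gInner F x y u u - gInner F x y y u ^ 2)

/-- All flag curvatures of `F` over `M` are equal to `K`. -/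
def HasConstantFlagCurvature (M : Set (Rn n)) (F : Rn n → Rn n → ℝ) (K : ℝ) : Prop :=
  ∀ x ∈ M, ∀ y u, LinearIndependent ℝ ![y, u] → flagCurvature F x y u = K

/-- The Douglas curvature
`D_jⁱ_kl = ∂³/∂yʲ∂yᵏ∂yˡ (Gⁱ - (n+1)⁻¹ (∑ₘ ∂Gᵐ/∂yᵐ) yⁱ)`. -/
def douglas (F : Rn n → Rn n → ℝ) (i j k l : Fin n) : Rn n → Rn n → ℝ :=
  dy j (dy k (dy l fun x y =>
    spray F i x y - 1 / ((n : ℝ) + 1) * (∑ m, dy m (spray F m) x y) * y i))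

/-- `F` is a Douglas metric on `M`: its Douglas curvature vanishes off the zero section. -/
def IsDouglas (M : Set (Rn n)) (F : Rn n → Rn n → ℝ) : Prop :=
  ∀ x ∈ M, ∀ y, y ≠ 0 → ∀ i j k l, douglas F i j k l x y = 0

end Finsler

/-! Spherically symmetric metrics. -/

/-- `M` is a symmetric domain of `ℝⁿ` centred at the origin: the whole space, an open ball, or an
open annulus `ν₂ < |x| < ν₁` with `0 ≤ ν₂ < ν₁ ≤ ∞`. -/
def IsSymmetricDomain {n : ℕ} (M : Set (Rn n)) : Prop :=
  M = univ ∨ (∃ ν : ℝ, 0 < ν ∧ M = ball 0 ν) ∨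
    (∃ ν₂ ν₁ : ℝ, 0 ≤ ν₂ ∧ ν₂ < ν₁ ∧ M = ball 0 ν₁ \ closedBall 0 ν₂) ∨
    (∃ ν₂ : ℝ, 0 ≤ ν₂ ∧ M = (closedBall 0 ν₂)ᶜ)

/-- The positive values `r = |x|` for `x ∈ M`. -/
def radii {n : ℕ} (M : Set (Rn n)) : Set ℝ := {r | 0 < r ∧ ∃ x ∈ M, ‖x‖ = r}

/-- The function `F(x, y) = |y| φ(|x|, ⟨x, y⟩ / |y|)`, with `F(x, 0) = 0`. -/
def sphMetric {n : ℕ} (φ : ℝ → ℝ → ℝ) (x y : Rn n) : ℝ :=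
  ‖y‖ * φ ‖x‖ (inner ℝ x y / ‖y‖)

/-- The partial derivative `f_r` of a function `f(r, s)`. -/
def pr (f : ℝ → ℝ → ℝ) : ℝ → ℝ → ℝ := fun r s => deriv (fun r' => f r' s) r

/-- The partial derivative `f_s` of a function `f(r, s)`. -/
def ps (f : ℝ → ℝ → ℝ) : ℝ → ℝ → ℝ := fun r s => deriv (fun s' => f r s') s

/-- The function `Q(r, s)` of the metric `|y| φ(r, s)`. -/
def Q (φ : ℝ → ℝ → ℝ) : ℝ → ℝ → ℝ := fun r s =>
  1 / (2 * r) * ((r * ps (ps φ) r s - pr φ r s + s * ps (pr φ) r s) /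
    (φ r s - s * ps φ r s + (r ^ 2 - s ^ 2) * ps (ps φ) r s))

/-- The function `P(r, s)` of the metric `|y| φ(r, s)`. -/
def P (φ : ℝ → ℝ → ℝ) : ℝ → ℝ → ℝ := fun r s =>
  (r * ps φ r s + s * pr φ r s) / (2 * r * φ r s)
    - Q φ r s / φ r s * (s * φ r s + (r ^ 2 - s ^ 2) * ps φ r s)

/-- `R₁ = P² - (s P_r + r P_s) / r + 2 Q [1 + s P + (r² - s²) P_s]`. -/
def R₁ (φ : ℝ → ℝ → ℝ) : ℝ → ℝ → ℝ := fun r s =>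
  P φ r s ^ 2 - 1 / r * (s * pr (P φ) r s + r * ps (P φ) r s)
    + 2 * Q φ r s * (1 + s * P φ r s + (r ^ 2 - s ^ 2) * ps (P φ) r s)

/-- On `I`, `T(r) = exp (-∫ 4 r g / (1 - 2 r² g) dr) / (1 - 2 r² g)²`, for some antiderivative `A`
of the integrand; at a radius where `2 r² g(r) = 1`, `T` is defined by continuity. -/
def IsT (I : Set ℝ) (g T : ℝ → ℝ) : Prop :=
  ContinuousOn T I ∧ ∃ A : ℝ → ℝ, ∀ r ∈ I, 2 * r ^ 2 * g r ≠ 1 →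
    HasDerivAt A (4 * r * g r / (1 - 2 * r ^ 2 * g r)) r ∧
    T r = Real.exp (-A r) / (1 - 2 * r ^ 2 * g r) ^ 2

/-- On `I`, `T̄(r) = 4 ∫ (g' + 2 r g²) / (1 - 2 r² g) T dr` is an antiderivative, continuous also at
a radius where `2 r² g(r) = 1`. -/
def IsTbar (I : Set ℝ) (g T Tbar : ℝ → ℝ) : Prop :=
  ContinuousOn Tbar I ∧ ∀ r ∈ I, 2 * r ^ 2 * g r ≠ 1 →
    HasDerivAt Tbar (4 * ((deriv g r + 2 * r * g r ^ 2) / (1 - 2 * r ^ 2 * g r) * T r)) r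

/-- The denominator `(r² - s²) T̄(r) - T(r)`. -/
def den (T Tbar : ℝ → ℝ) (r s : ℝ) : ℝ := (r ^ 2 - s ^ 2) * Tbar r - T r

/-- `φ(r, s) = (r² - s²) / ((r² - s²) T̄(r) - T(r))`, the argument of `η`. -/
def vphi (T Tbar : ℝ → ℝ) (r s : ℝ) : ℝ := (r ^ 2 - s ^ 2) / den T Tbar r s

/-- On the part `0 < |s| < r`, `r ∈ I`, where `s` has the sign `σ = ±1`:
`p(r, s) = s (h(r) - ∫ η(vphi(r, t)) / (t² √(r² - t²)) dt)`, with smooth functions `h` and `η`.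
The antiderivative is the one that vanishes at `s = σ r / 2`; any other choice changes `h` only. -/
def HasIntegralForm (I : Set ℝ) (T Tbar : ℝ → ℝ) (σ : ℝ) (p : ℝ → ℝ → ℝ) (h η : ℝ → ℝ) : Prop :=
  ContDiffOn ℝ ∞ h I ∧
  (∀ r ∈ I, ∀ s, |s| < r → 0 < σ * s → den T Tbar r s ≠ 0 → ContDiffAt ℝ ∞ η (vphi T Tbar r s)) ∧
  (∀ r ∈ I, ∀ s, |s| < r → 0 < σ * s →
    IntervalIntegrable (fun t => η (vphi T Tbar r t) / (t ^ 2 * √(r ^ 2 - t ^ 2)))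
      MeasureTheory.volume (σ * r / 2) s ∧
    p r s = s * (h r - ∫ t in (σ * r / 2)..s,
      η (vphi T Tbar r t) / (t ^ 2 * √(r ^ 2 - t ^ 2))))

end SphFinsler

end

/-! By symmetry the geodesic coefficients are `|y| P yⁱ + |y|² Q xⁱ` (`spray_eq`). Modulo multiples
of `yⁱ`, the Riemann curvature is then `|y|² R₁ δⁱₖ` plus `|y| curvRadial (|y| xₖ - s yₖ) xⁱ`
(`IsSphSpray.riemann_eq`). Flags whose edge is orthogonal to `x` and `y`, which exist since `n ≥ 3`,
give `R₁ = K φ²`; flags in the plane of `x` and `y` then give `curvRadial = 0`. One component of the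
Douglas curvature, in a direction orthogonal to `x` and `y`, gives `Q_s = s Q_ss`. Hence `Q = g + c
s²`, and `curvRadial = 0` at `s = 0` becomes `c r (1 - 2 r² g) = g' + 2 r g²`.

The definitions of `P` and `Q` yield two first order linear equations for `φ`. Their compatibility,
with `K` eliminated between `K φ² = R₁` and its `s`-derivative, is a linear equation for `W = P - s
P_s` (`P_pde`, `CharEq`). Along its characteristics `T / (r² - s²) - T̄` and `√(r² - s²) W` are
constant (`hasDerivAt_alongLevel`). The first of these is `-1 / vphi`, so `√(r² - s²) W = η(vphi)`,
and integrating `(P / s)_s = -W / s²` gives the formula for `P` (`hasIntegralForm`).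

For `η` to be a function, each level curve of the first integral must be connected within each sign
of `s`. The curve of value `C` lies over the radii with `C + T̄ - T / r² > 0`. The derivative of `T̄
- T / r²` has the sign of `1 - 2 r² g`, and `√T (1 - 2 r² g) / r` is strictly decreasing
(`strictAntiOn`). So `T̄ - T / r²` first rises and then falls, and these radii form an interval
(`ordConnected_superlevel`). The same monotonicity allows at most one exceptional radius. If `0 ∈
M`, then `T̄ - T / r²` tends to `-∞` at the centre, so every level curve starts on `s = 0`; there
the branches for the two signs meet, and `η` is common to both (`levelValue_neg`). -/

noncomputable section

namespace SphFinsler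

/-! Smooth functions of two real variables. -/

section TwoVariables

variable {Ω : Set (ℝ × ℝ)} {f : ℝ → ℝ → ℝ} {r s : ℝ}

/-- `f(r, s)` is smooth on `Ω`. -/
def SmoothOn (Ω : Set (ℝ × ℝ)) (f : ℝ → ℝ → ℝ) : Prop :=
  ContDiffOn ℝ ∞ (Function.uncurry f) Ω

theorem hasDerivAt_fst_of_differentiableAt (h : DifferentiableAt ℝ (Function.uncurry f) (r, s)) :
    HasDerivAt (fun r' => f r' s) (fderiv ℝ (Function.uncurry f) (r, s) (1, 0)) r := by
  have := h.hasFDerivAt.comp_hasDerivAt r ((hasDerivAt_id r).prodMk (hasDerivAt_const r s))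
  exact this

theorem hasDerivAt_snd_of_differentiableAt (h : DifferentiableAt ℝ (Function.uncurry f) (r, s)) :
    HasDerivAt (fun s' => f r s') (fderiv ℝ (Function.uncurry f) (r, s) (0, 1)) s := by
  have := h.hasFDerivAt.comp_hasDerivAt s ((hasDerivAt_const s r).prodMk (hasDerivAt_id s))
  exact this

theorem pr_eq_fderiv (h : DifferentiableAt ℝ (Function.uncurry f) (r, s)) :
    pr f r s = fderiv ℝ (Function.uncurry f) (r, s) (1, 0) :=
  (hasDerivAt_fst_of_differentiableAt h).deriv

theorem ps_eq_fderiv (h : DifferentiableAt ℝ (Function.uncurry f) (r, s)) :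
    ps f r s = fderiv ℝ (Function.uncurry f) (r, s) (0, 1) :=
  (hasDerivAt_snd_of_differentiableAt h).deriv

theorem eventually_differentiableAt_uncurry
    (h : ContDiffAt ℝ ∞ (Function.uncurry f) (r, s)) :
    ∀ᶠ z in nhds (r, s), DifferentiableAt ℝ (Function.uncurry f) z := by
  have h1 : ContDiffAt ℝ 1 (Function.uncurry f) (r, s) := h.of_le (by exact_mod_cast le_top)
  filter_upwards [h1.eventually (by simp)] with z hz
  exact hz.differentiableAt (by simp)

theorem contDiffAt_pr (h : ContDiffAt ℝ ∞ (Function.uncurry f) (r, s)) :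
    ContDiffAt ℝ ∞ (Function.uncurry (pr f)) (r, s) := by
  have h2 : ContDiffAt ℝ ∞ (fun z => fderiv ℝ (Function.uncurry f) z (1, 0)) (r, s) :=
    (h.fderiv_right (m := ∞) (by simp)).clm_apply contDiffAt_const
  refine h2.congr_of_eventuallyEq ?_
  filter_upwards [eventually_differentiableAt_uncurry h] with z hz
  exact pr_eq_fderiv hz

theorem contDiffAt_ps (h : ContDiffAt ℝ ∞ (Function.uncurry f) (r, s)) :
    ContDiffAt ℝ ∞ (Function.uncurry (ps f)) (r, s) := by
  have h2 : ContDiffAt ℝ ∞ (fun z => fderiv ℝ (Function.uncurry f) z (0, 1)) (r, s) :=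
    (h.fderiv_right (m := ∞) (by simp)).clm_apply contDiffAt_const
  refine h2.congr_of_eventuallyEq ?_
  filter_upwards [eventually_differentiableAt_uncurry h] with z hz
  exact ps_eq_fderiv hz

namespace SmoothOn

theorem contDiffAt (h : SmoothOn Ω f) (hΩ : IsOpen Ω) (hz : (r, s) ∈ Ω) :
    ContDiffAt ℝ ∞ (Function.uncurry f) (r, s) :=
  ContDiffOn.contDiffAt h (hΩ.mem_nhds hz)

theorem differentiableAt (h : SmoothOn Ω f) (hΩ : IsOpen Ω) (hz : (r, s) ∈ Ω) :
    DifferentiableAt ℝ (Function.uncurry f) (r, s) :=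
  (h.contDiffAt hΩ hz).differentiableAt (by simp)

theorem smoothOn_pr (h : SmoothOn Ω f) (hΩ : IsOpen Ω) : SmoothOn Ω (pr f) :=
  fun _ hz => (contDiffAt_pr (h.contDiffAt hΩ hz)).contDiffWithinAt

theorem smoothOn_ps (h : SmoothOn Ω f) (hΩ : IsOpen Ω) : SmoothOn Ω (ps f) :=
  fun _ hz => (contDiffAt_ps (h.contDiffAt hΩ hz)).contDiffWithinAt

theorem hasDerivAt_fst (h : SmoothOn Ω f) (hΩ : IsOpen Ω) (hz : (r, s) ∈ Ω) :
    HasDerivAt (fun r' => f r' s) (pr f r s) r := by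
  rw [pr_eq_fderiv (h.differentiableAt hΩ hz)]
  exact hasDerivAt_fst_of_differentiableAt (h.differentiableAt hΩ hz)

theorem hasDerivAt_snd (h : SmoothOn Ω f) (hΩ : IsOpen Ω) (hz : (r, s) ∈ Ω) :
    HasDerivAt (fun s' => f r s') (ps f r s) s := by
  rw [ps_eq_fderiv (h.differentiableAt hΩ hz)]
  exact hasDerivAt_snd_of_differentiableAt (h.differentiableAt hΩ hz)

theorem hasFDerivAt (h : SmoothOn Ω f) (hΩ : IsOpen Ω) (hz : (r, s) ∈ Ω) :
    HasFDerivAt (Function.uncurry f)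
      (pr f r s • ContinuousLinearMap.fst ℝ ℝ ℝ + ps f r s • ContinuousLinearMap.snd ℝ ℝ ℝ)
      (r, s) := by
  have hd := h.differentiableAt hΩ hz
  convert hd.hasFDerivAt using 1
  rw [pr_eq_fderiv hd, ps_eq_fderiv hd]
  ext <;> simp

theorem pr_ps_comm (h : SmoothOn Ω f) (hΩ : IsOpen Ω) (hz : (r, s) ∈ Ω) :
    pr (ps f) r s = ps (pr f) r s := by
  have hc := h.contDiffAt hΩ hz
  have hsym : IsSymmSndFDerivAt ℝ (Function.uncurry f) (r, s) :=
    hc.isSymmSndFDerivAt (by simpa using ENat.LEInfty.out)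
  have hd : DifferentiableAt ℝ (fderiv ℝ (Function.uncurry f)) (r, s) :=
    (hc.fderiv_right (m := ∞) (by simp)).differentiableAt (by simp)
  have hev := eventually_differentiableAt_uncurry hc
  have key : ∀ v : ℝ × ℝ, HasFDerivAt (fun z => fderiv ℝ (Function.uncurry f) z v)
      ((ContinuousLinearMap.apply ℝ ℝ v).comp
        (fderiv ℝ (fderiv ℝ (Function.uncurry f)) (r, s))) (r, s) := fun v =>
    (ContinuousLinearMap.apply ℝ ℝ v).hasFDerivAt.comp (r, s) hd.hasFDerivAt
  have e1 : fderiv ℝ (Function.uncurry (ps f)) (r, s) = _ :=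
    ((key (0, 1)).congr_of_eventuallyEq (by
      filter_upwards [hev] with z hz using ps_eq_fderiv hz)).fderiv
  have e2 : fderiv ℝ (Function.uncurry (pr f)) (r, s) = _ :=
    ((key (1, 0)).congr_of_eventuallyEq (by
      filter_upwards [hev] with z hz using pr_eq_fderiv hz)).fderiv
  rw [pr_eq_fderiv ((h.smoothOn_ps hΩ).differentiableAt hΩ hz),
    ps_eq_fderiv ((h.smoothOn_pr hΩ).differentiableAt hΩ hz), e1, e2]
  exact hsym.eq (1, 0) (0, 1)

theorem comp_curve (h : SmoothOn Ω f) (hΩ : IsOpen Ω) {a b : ℝ → ℝ} {t a' b' : ℝ}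
    (ha : HasDerivAt a a' t) (hb : HasDerivAt b b' t) (hz : (a t, b t) ∈ Ω) :
    HasDerivAt (fun t => f (a t) (b t)) (pr f (a t) (b t) * a' + ps f (a t) (b t) * b') t := by
  have := (h.hasFDerivAt hΩ hz).comp_hasDerivAt t (ha.prodMk hb)
  exact this

end SmoothOn

theorem pr_congr {f₁ f₂ : ℝ → ℝ → ℝ} (hΩ : IsOpen Ω)
    (h : ∀ r s, (r, s) ∈ Ω → f₁ r s = f₂ r s) (hz : (r, s) ∈ Ω) : pr f₁ r s = pr f₂ r s := by
  refine Filter.EventuallyEq.deriv_eq ?_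
  have : ∀ᶠ r' in nhds r, (r', s) ∈ Ω :=
    (Continuous.prodMk_left s).continuousAt.eventually (hΩ.mem_nhds hz)
  filter_upwards [this] with r' hr' using h _ _ hr'

theorem ps_congr {f₁ f₂ : ℝ → ℝ → ℝ} (hΩ : IsOpen Ω)
    (h : ∀ r s, (r, s) ∈ Ω → f₁ r s = f₂ r s) (hz : (r, s) ∈ Ω) : ps f₁ r s = ps f₂ r s := by
  refine Filter.EventuallyEq.deriv_eq ?_
  have : ∀ᶠ s' in nhds s, (r, s') ∈ Ω :=
    (Continuous.prodMk_right r).continuousAt.eventually (hΩ.mem_nhds hz)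
  filter_upwards [this] with s' hs' using h _ _ hs'

end TwoVariables

/-! ### The equations for `φ` in terms of `P` and `Q`, and the resulting equation for `P`. -/

section PDE

variable {φ : ℝ → ℝ → ℝ} {r s : ℝ}

/-- The denominator `φ - s φ_s + (r² - s²) φ_ss` of `Q`. -/
def qDen (φ : ℝ → ℝ → ℝ) (r s : ℝ) : ℝ :=
  φ r s - s * ps φ r s + (r ^ 2 - s ^ 2) * ps (ps φ) r s

/-- The region `r ∈ I`, `|s| < r`. -/
def region (I : Set ℝ) : Set (ℝ × ℝ) := {z | z.1 ∈ I ∧ |z.2| < z.1}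

theorem isOpen_region {I : Set ℝ} (hI : IsOpen I) : IsOpen (region I) :=
  (hI.preimage continuous_fst).inter (isOpen_lt continuous_snd.abs continuous_fst)

theorem pos_of_mem_region {I : Set ℝ} (h : (r, s) ∈ region I) : 0 < r :=
  (abs_nonneg s).trans_lt h.2

theorem sq_lt_of_mem_region {I : Set ℝ} (h : (r, s) ∈ region I) : s ^ 2 < r ^ 2 :=
  sq_lt_sq.2 (h.2.trans_le (le_abs_self r))

theorem contDiffAt_Q (h : ContDiffAt ℝ ∞ (Function.uncurry φ) (r, s)) (hr : r ≠ 0)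
    (hd : qDen φ r s ≠ 0) : ContDiffAt ℝ ∞ (Function.uncurry (Q φ)) (r, s) := by
  have h1 := contDiffAt_ps h
  have h2 := contDiffAt_ps h1
  have h3 := contDiffAt_pr h
  have h4 := contDiffAt_ps h3
  have hf : ContDiffAt ℝ ∞ (fun z : ℝ × ℝ => z.1) (r, s) := contDiffAt_fst
  have hs : ContDiffAt ℝ ∞ (fun z : ℝ × ℝ => z.2) (r, s) := contDiffAt_snd
  exact (contDiffAt_const.div (contDiffAt_const.mul hf) (by simpa using hr)).mul
    ((((hf.mul h2).sub h3).add (hs.mul h4)).div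
      ((h.sub (hs.mul h1)).add (((hf.pow 2).sub (hs.pow 2)).mul h2)) hd)

theorem contDiffAt_P (h : ContDiffAt ℝ ∞ (Function.uncurry φ) (r, s)) (hr : r ≠ 0)
    (hφ : φ r s ≠ 0) (hd : qDen φ r s ≠ 0) :
    ContDiffAt ℝ ∞ (Function.uncurry (P φ)) (r, s) := by
  have h1 := contDiffAt_ps h
  have h3 := contDiffAt_pr h
  have hQ := contDiffAt_Q h hr hd
  have hf : ContDiffAt ℝ ∞ (fun z : ℝ × ℝ => z.1) (r, s) := contDiffAt_fst
  have hs : ContDiffAt ℝ ∞ (fun z : ℝ × ℝ => z.2) (r, s) := contDiffAt_snd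
  exact (((hf.mul h1).add (hs.mul h3)).div ((contDiffAt_const.mul hf).mul h)
    (mul_ne_zero (mul_ne_zero two_ne_zero hr) hφ)).sub
    ((hQ.div h hφ).mul ((hs.mul h).add (((hf.pow 2).sub (hs.pow 2)).mul h1)))

theorem contDiffAt_R₁ (h : ContDiffAt ℝ ∞ (Function.uncurry φ) (r, s)) (hr : r ≠ 0)
    (hφ : φ r s ≠ 0) (hd : qDen φ r s ≠ 0) :
    ContDiffAt ℝ ∞ (Function.uncurry (R₁ φ)) (r, s) := by
  have hQ := contDiffAt_Q h hr hd
  have hP := contDiffAt_P h hr hφ hd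
  have h1 := contDiffAt_ps hP
  have h3 := contDiffAt_pr hP
  have hf : ContDiffAt ℝ ∞ (fun z : ℝ × ℝ => z.1) (r, s) := contDiffAt_fst
  have hs : ContDiffAt ℝ ∞ (fun z : ℝ × ℝ => z.2) (r, s) := contDiffAt_snd
  exact ((hP.pow 2).sub ((contDiffAt_const.div hf hr).mul ((hs.mul h3).add (hf.mul h1)))).add
    ((contDiffAt_const.mul hQ).mul ((contDiffAt_const.add (hs.mul hP)).add
      (((hf.pow 2).sub (hs.pow 2)).mul h1)))

theorem Q_spec (hr : r ≠ 0) (hd : qDen φ r s ≠ 0) :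
    2 * r * Q φ r s * qDen φ r s = r * ps (ps φ) r s - pr φ r s + s * ps (pr φ) r s := by
  have : Q φ r s = 1 / (2 * r) *
    ((r * ps (ps φ) r s - pr φ r s + s * ps (pr φ) r s) / qDen φ r s) := rfl
  rw [this]
  field_simp

theorem P_spec (hr : r ≠ 0) (hφ : φ r s ≠ 0) :
    r * ps φ r s + s * pr φ r s = 2 * r * φ r s * P φ r s +
      2 * r * Q φ r s * (s * φ r s + (r ^ 2 - s ^ 2) * ps φ r s) := by
  unfold P
  field_simp
  ring

/-- The functions `P` and `Q` of a smooth function `φ` with `φ, qDen φ ≠ 0` determine `φ_r` as a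
combination of `φ` and `φ_s`. -/
theorem pr_eq_of_P_Q {Ω : Set (ℝ × ℝ)} (hΩ : IsOpen Ω) (hφ : SmoothOn Ω φ)
    (hr : ∀ r s, (r, s) ∈ Ω → r ≠ 0) (h0 : ∀ r s, (r, s) ∈ Ω → φ r s ≠ 0)
    (hd : ∀ r s, (r, s) ∈ Ω → qDen φ r s ≠ 0) (hz : (r, s) ∈ Ω) :
    pr φ r s = r * (ps φ r s * P φ r s + φ r s * ps (P φ) r s) +
      r * ps (Q φ) r s * (s * φ r s + (r ^ 2 - s ^ 2) * ps φ r s) := by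
  have hP : SmoothOn Ω (P φ) := fun z hz => (contDiffAt_P (hφ.contDiffAt hΩ hz) (hr _ _ hz)
    (h0 _ _ hz) (hd _ _ hz)).contDiffWithinAt
  have hQ : SmoothOn Ω (Q φ) := fun z hz => (contDiffAt_Q (hφ.contDiffAt hΩ hz) (hr _ _ hz)
    (hd _ _ hz)).contDiffWithinAt
  have d0 := hφ.hasDerivAt_snd hΩ hz
  have d1 := (hφ.smoothOn_ps hΩ).hasDerivAt_snd hΩ hz
  have d2 := (hφ.smoothOn_pr hΩ).hasDerivAt_snd hΩ hz
  have dP := hP.hasDerivAt_snd hΩ hz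
  have dQ := hQ.hasDerivAt_snd hΩ hz
  have di := hasDerivAt_id s
  have e1 := ((d1.const_mul r).add (di.mul d2))
  have e2 := ((d0.const_mul (2 * r)).mul dP).add ((dQ.const_mul (2 * r)).mul
    ((di.mul d0).add (((di.pow 2).const_sub (r ^ 2)).mul d1)))
  have hev : ∀ᶠ s' in nhds s, (r, s') ∈ Ω :=
    (Continuous.prodMk_right r).continuousAt.eventually (hΩ.mem_nhds hz)
  have e3 := e1.congr_of_eventuallyEq (f₁ := _) (by
    filter_upwards [hev] with s' hs'
    exact (P_spec (hr _ _ hs') (h0 _ _ hs')).symm)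
  have e4 := e3.unique e2
  -- The `s`-derivative of `s φ + (r² - s²) φ_s` is exactly `qDen`, so `Q_spec` cancels every second
  -- derivative in `e4`.
  have e5 := Q_spec (hr _ _ hz) (hd _ _ hz)
  simp only [id, Pi.mul_apply, Pi.add_apply, qDen, Nat.cast_ofNat, Pi.pow_apply] at e4 e5
  linear_combination (1/2) * e4 + (1/2) * e5

/-- The equation satisfied by `P`, a consequence of the integrability conditions for `φ`. -/
theorem P_pde {I : Set ℝ} (hI : IsOpen I) (hφ : SmoothOn (region I) φ)
    (h0 : ∀ r s, (r, s) ∈ region I → 0 < φ r s)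
    (hd : ∀ r s, (r, s) ∈ region I → qDen φ r s ≠ 0)
    {g c g' c' : ℝ → ℝ} (hg : ∀ r ∈ I, HasDerivAt g (g' r) r)
    (hc : ∀ r ∈ I, HasDerivAt c (c' r) r)
    (hQ : ∀ r s, (r, s) ∈ region I → Q φ r s = g r + c r * s ^ 2)
    (hgc : ∀ r ∈ I, c r * (r * (1 - 2 * r ^ 2 * g r)) = g' r + 2 * r * g r ^ 2)
    {K : ℝ} (hK : ∀ r s, (r, s) ∈ region I → K * φ r s ^ 2 = R₁ φ r s)
    (hz : (r, s) ∈ region I) :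
    s * (pr (P φ) r s - s * pr (ps (P φ)) r s) +
      r * (1 - 2 * (r ^ 2 - s ^ 2) * (g r + c r * s ^ 2)) * (- s * ps (ps (P φ)) r s) +
      2 * r * s * (g r + c r * s ^ 2) * (P φ r s - s * ps (P φ) r s) = 0 := by
  have hΩ := isOpen_region hI
  have hr : ∀ r s, (r, s) ∈ region I → r ≠ 0 := fun r s h => (pos_of_mem_region h).ne'
  have h0' : ∀ r s, (r, s) ∈ region I → φ r s ≠ 0 := fun r s h => (h0 r s h).ne'
  have hP : SmoothOn (region I) (P φ) := fun z hz => (contDiffAt_P (hφ.contDiffAt hΩ hz)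
    (hr _ _ hz) (h0' _ _ hz) (hd _ _ hz)).contDiffWithinAt
  have hevs : ∀ᶠ s' in nhds s, (r, s') ∈ region I :=
    (Continuous.prodMk_right r).continuousAt.eventually (hΩ.mem_nhds hz)
  have hevr : ∀ᶠ r' in nhds r, (r', s) ∈ region I :=
    (Continuous.prodMk_left s).continuousAt.eventually (hΩ.mem_nhds hz)
  have hrI : r ∈ I := hz.1
  have hr0 : r ≠ 0 := hr _ _ hz
  -- the derivative of `Q` in `s`
  have hQs : ∀ r s, (r, s) ∈ region I → ps (Q φ) r s = 2 * c r * s := by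
    intro r s h
    have h1 : ps (Q φ) r s = ps (fun r s => g r + c r * s ^ 2) r s := ps_congr hΩ hQ h
    rw [h1]
    have : HasDerivAt (fun s => g r + c r * s ^ 2) (c r * (2 * s)) s := by
      simpa using ((hasDerivAt_id s).pow 2).const_mul (c r) |>.const_add (g r)
    rw [ps, this.deriv]; ring
  -- the two first order equations for `φ`
  have hC : ∀ r s, (r, s) ∈ region I → pr φ r s =
      (r * P φ r s + 2 * r * c r * s * (r ^ 2 - s ^ 2)) * ps φ r s +
        (r * ps (P φ) r s + 2 * r * c r * s ^ 2) * φ r s := by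
    intro r s h
    have := pr_eq_of_P_Q hΩ hφ hr h0' hd h
    rw [hQs _ _ h] at this
    linear_combination this
  -- Eliminating `φ_r` from `P_spec` by `hC`; the terms with `c` cancel.
  have hS : ∀ r s, (r, s) ∈ region I →
      (1 + s * P φ r s - 2 * g r * (r ^ 2 - s ^ 2)) * ps φ r s =
        (2 * P φ r s - s * ps (P φ) r s + 2 * s * g r) * φ r s := by
    intro r s h
    have h1 := P_spec (hr _ _ h) (h0' _ _ h)
    have h2 := hC r s h
    rw [hQ _ _ h] at h1
    apply mul_left_cancel₀ (hr _ _ h)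
    linear_combination h1 - s * h2
  -- their derivatives
  have dφs := hφ.hasDerivAt_snd hΩ hz
  have dφr := hφ.hasDerivAt_fst hΩ hz
  have dφss := (hφ.smoothOn_ps hΩ).hasDerivAt_snd hΩ hz
  have dφsr := (hφ.smoothOn_ps hΩ).hasDerivAt_fst hΩ hz
  have dφrs := (hφ.smoothOn_pr hΩ).hasDerivAt_snd hΩ hz
  have dPs := hP.hasDerivAt_snd hΩ hz
  have dPr := hP.hasDerivAt_fst hΩ hz
  have dPss := (hP.smoothOn_ps hΩ).hasDerivAt_snd hΩ hz
  have dPsr := (hP.smoothOn_ps hΩ).hasDerivAt_fst hΩ hz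
  have dPrs := (hP.smoothOn_pr hΩ).hasDerivAt_snd hΩ hz
  have dg := hg r hrI
  have dc := hc r hrI
  have ds := hasDerivAt_id' s
  have dr := hasDerivAt_id' r
  have eφ := hφ.pr_ps_comm hΩ hz
  have eP := hP.pr_ps_comm hΩ hz
  have dw := (ds.pow 2).const_sub (r ^ 2)
  have dw' := (dr.pow 2).sub_const (s ^ 2)
  have E1 := (((dPs.const_mul r).add ((ds.const_mul (2 * r * c r)).mul dw)).mul dφss).add
    (((dPss.const_mul r).add ((ds.pow 2).const_mul (2 * r * c r))).mul dφs) |>.congr_of_eventuallyEq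
      (f₁ := fun s => pr φ r s) (by filter_upwards [hevs] with s' hs' using hC _ _ hs')
      |>.unique dφrs
  have E2 := HasDerivAt.unique ((((ds.mul dPs).const_add 1).sub (dw.const_mul (2 * g r))).mul dφss)
    ((((dPs.const_mul 2).sub (ds.mul dPss)).add ((ds.const_mul 2).mul_const (g r))).mul dφs
      |>.congr_of_eventuallyEq (by filter_upwards [hevs] with s' hs' using hS _ _ hs'))
  have E3 := HasDerivAt.unique
    ((((dPr.const_mul s).const_add 1).sub ((dg.const_mul 2).mul dw')).mul dφsr)
    ((((dPr.const_mul 2).sub (dPsr.const_mul s)).add (dg.const_mul (2 * s))).mul dφr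
      |>.congr_of_eventuallyEq (by filter_upwards [hevr] with r' hr' using hS _ _ hr'))
  have E4 := HasDerivAt.unique ((dφs.pow 2).const_mul K)
    (((dPs.pow 2).sub (((ds.mul dPrs).add (dPss.const_mul r)).const_mul (1 / r))).add
      (((((ds.pow 2).const_mul (c r)).const_add (g r)).const_mul 2).mul
        (((ds.mul dPs).const_add 1).add (dw.mul dPss))) |>.congr_of_eventuallyEq (by
        filter_upwards [hevs] with s' hs'
        refine (hK _ _ hs').trans ?_
        unfold R₁
        rw [hQ _ _ hs']
        rfl))
  have h1 := hC _ _ hz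
  have h2 := hS _ _ hz
  have h3 := hK _ _ hz
  have h4 := hgc r hrI
  have h5 := h0' _ _ hz
  unfold R₁ at h3
  rw [hQ _ _ hz] at h3
  simp only [Pi.mul_apply, Pi.add_apply, Pi.sub_apply, Pi.pow_apply, eφ, eP] at E1 E2 E3 E4 h3
  rw [eP]
  generalize φ r s = f at *
  generalize ps φ r s = fs at *
  generalize pr φ r s = fr at *
  generalize ps (ps φ) r s = fss at *
  generalize ps (pr φ) r s = frs at *
  generalize P φ r s = p at *
  generalize ps (P φ) r s = p_s at *
  generalize pr (P φ) r s = p_r at *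
  generalize ps (ps (P φ)) r s = pss at *
  generalize ps (pr (P φ)) r s = prs at *
  generalize g r = G at *
  generalize c r = c at *
  generalize g' r = G' at *
  have hi : r * (1 / r) = 1 := by field_simp
  generalize 1 / r = i at *
  apply mul_left_cancel₀ h5
  -- `E3` with the multiples of `E1` and `E2` is the compatibility `φ_sr = φ_rs`, freed of second
  -- derivatives of `φ`; `h1` and `h2` reduce the first derivatives. Pairing `φ_s · h3` with `(φ /
  -- 2) · E4` removes `K`, and `h4` removes `g'`.
  linear_combination (-2/3) * s * (E3 +
    (1 + s * p - 2 * G * (r ^ 2 - s ^ 2)) * E1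
    - (r * p + 2 * r * c * s * (r ^ 2 - s ^ 2)) * E2
    + (2 * p - s * p_s + 2 * s * G) * h1
    - (r * p_s + 2 * r * c * s ^ 2) * h2
    - r * fs * h3
    + (r / 2) * f * E4
    + 2 * r * (G + c * s ^ 2) * h2
    - 2 * (r ^ 2 - s ^ 2) * fs * h4
    - 2 * s * f * h4
    + ((s * p_r + r * p_s) * fs) * hi - (f / 2 * (p_r + s * prs + r * pss)) * hi)

end PDE

/-! ### Characteristics of the equation for `W`, and the shape of the level curves of the first
integral. -/

section Characteristics

theorem exists_primitive {I : Set ℝ} (hI : IsOpen I) (hc : I.OrdConnected) {f : ℝ → ℝ}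
    (hf : ContinuousOn f I) : ∃ F : ℝ → ℝ, ∀ r ∈ I, HasDerivAt F (f r) r := by
  rcases I.eq_empty_or_nonempty with rfl | ⟨a, ha⟩
  · exact ⟨0, fun r hr => hr.elim⟩
  refine ⟨fun r => ∫ t in a..r, f t, fun r hr => ?_⟩
  have hsub : uIcc a r ⊆ I := hc.uIcc_subset ha hr
  exact intervalIntegral.integral_hasDerivAt_right (hf.mono hsub).intervalIntegrable
    (hf.stronglyMeasurableAtFilter hI r hr) (hf.continuousAt (hI.mem_nhds hr))

/-- Functions `g`, `c`, `τ`, `B` of the radius `r ∈ I`, where `Q = g + c s²`, `T = τ²`, `T̄ = B`. -/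
structure CharData (I : Set ℝ) (g g' c τ B : ℝ → ℝ) : Prop where
  isOpen : IsOpen I
  ordConnected : I.OrdConnected
  pos : ∀ r ∈ I, 0 < r
  hg : ∀ r ∈ I, HasDerivAt g (g' r) r
  hgc : ∀ r ∈ I, c r * (r * (1 - 2 * r ^ 2 * g r)) = g' r + 2 * r * g r ^ 2
  τ_pos : ∀ r ∈ I, 0 < τ r
  hτ : ∀ r ∈ I, HasDerivAt τ (2 * r * (g r + c r * r ^ 2) * τ r) r
  hB : ∀ r ∈ I, HasDerivAt B (4 * r * c r * τ r ^ 2) r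

/-- Working with `c` instead of the quotient `(g' + 2 r g²) / (r - 2 r³ g)` keeps both integrands
continuous across a radius where `2 r² g = 1`. So `τ` and `B` are defined on all of `I` with a
single choice of constants. -/
theorem exists_charData {I : Set ℝ} (hI : IsOpen I) (hc : I.OrdConnected)
    (hpos : ∀ r ∈ I, 0 < r) {g g' c : ℝ → ℝ} (hg : ∀ r ∈ I, HasDerivAt g (g' r) r)
    (hcc : ContinuousOn c I)
    (hgc : ∀ r ∈ I, c r * (r * (1 - 2 * r ^ 2 * g r)) = g' r + 2 * r * g r ^ 2) :
    ∃ τ B : ℝ → ℝ, CharData I g g' c τ B := by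
  have hgcont : ContinuousOn g I := fun r hr => (hg r hr).continuousAt.continuousWithinAt
  obtain ⟨A, hA⟩ := exists_primitive hI hc (f := fun r => 2 * r * (g r + c r * r ^ 2))
    (by fun_prop)
  have hAc : ContinuousOn A I := fun r hr => (hA r hr).continuousAt.continuousWithinAt
  obtain ⟨B, hB⟩ := exists_primitive hI hc (f := fun r => 4 * r * c r * Real.exp (A r) ^ 2)
    (by fun_prop)
  refine ⟨fun r => Real.exp (A r), B, hI, hc, hpos, hg, hgc, fun r _ => Real.exp_pos _,
    fun r hr => ?_, hB⟩
  simpa [mul_comm] using (hA r hr).exp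

namespace CharData

variable {I : Set ℝ} {g g' c τ B : ℝ → ℝ}

theorem hasDerivAt_one_sub (h : CharData I g g' c τ B) {r : ℝ} (hr : r ∈ I) :
    HasDerivAt (fun r => 1 - 2 * r ^ 2 * g r) (-(4 * r * g r + 2 * r ^ 2 * g' r)) r := by
  have h1 := ((((hasDerivAt_id' r).pow 2).const_mul 2).mul (h.hg r hr)).const_sub 1
  refine h1.congr_deriv ?_
  simp only [Pi.pow_apply]
  push_cast
  ring

/-- By `hgc` the derivative is simply `-τ / r²`. Consequently `1 - 2 r² g` changes sign at most
once, from positive to negative. -/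
theorem strictAntiOn (h : CharData I g g' c τ B) :
    StrictAntiOn (fun r => τ r * (1 - 2 * r ^ 2 * g r) / r) I := by
  have hd : ∀ r ∈ I, HasDerivAt (fun r => τ r * (1 - 2 * r ^ 2 * g r) / r) (-τ r / r ^ 2) r := by
    intro r hr
    have hr0 := (h.pos r hr).ne'
    have h1 := ((h.hτ r hr).mul (h.hasDerivAt_one_sub hr)).div (hasDerivAt_id' r) hr0
    refine h1.congr_deriv ?_
    have h2 := h.hgc r hr
    simp only [Pi.mul_apply]
    field_simp
    linear_combination (2 * r ^ 3 * τ r) * h2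
  refine strictAntiOn_of_deriv_neg h.ordConnected.convex
    (fun r hr => (hd r hr).continuousAt.continuousWithinAt) fun r hr => ?_
  have hr := interior_subset hr
  rw [(hd r hr).deriv]
  have := h.pos r hr
  have := h.τ_pos r hr
  rw [neg_div]
  exact neg_neg_of_pos (by positivity)

theorem subsingleton (h : CharData I g g' c τ B) :
    {r ∈ I | 2 * r ^ 2 * g r = 1}.Subsingleton := by
  rintro a ⟨ha, ha'⟩ b ⟨hb, hb'⟩
  refine h.strictAntiOn.injOn ha hb ?_
  simp [ha', hb']

/-- If `1 - 2 r² g` is nonnegative at `b`, it is so at all smaller radii. -/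
theorem nonneg_of_le (h : CharData I g g' c τ B) {a b : ℝ} (ha : a ∈ I) (hb : b ∈ I)
    (hab : a ≤ b) (hk : 0 ≤ 1 - 2 * b ^ 2 * g b) : 0 ≤ 1 - 2 * a ^ 2 * g a := by
  have h1 := h.strictAntiOn.antitoneOn ha hb hab
  have := h.pos a ha
  have := h.pos b hb
  have := h.τ_pos a ha
  have := h.τ_pos b hb
  have h2 : 0 ≤ τ a * (1 - 2 * a ^ 2 * g a) / a := le_trans (by positivity) h1
  by_contra hneg
  exact absurd h2 (not_le.2 (div_neg_of_neg_of_pos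
    (mul_neg_of_pos_of_neg (by assumption) (not_le.1 hneg)) (by assumption)))

/-- If `1 - 2 r² g` is nonpositive at `a`, it is so at all larger radii. -/
theorem nonpos_of_le (h : CharData I g g' c τ B) {a b : ℝ} (ha : a ∈ I) (hb : b ∈ I)
    (hab : a ≤ b) (hk : 1 - 2 * a ^ 2 * g a ≤ 0) : 1 - 2 * b ^ 2 * g b ≤ 0 := by
  rcases hab.eq_or_lt with rfl | hlt
  · exact hk
  have h1 := h.strictAntiOn ha hb hlt
  have := h.pos a ha
  have := h.pos b hb
  have := h.τ_pos a ha
  have := h.τ_pos b hb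
  by_contra! hpos
  have h2 : 0 < τ b * (1 - 2 * b ^ 2 * g b) / b := by positivity
  exact absurd (h2.trans h1) (not_lt.2 (div_nonpos_of_nonpos_of_nonneg
    (mul_nonpos_of_nonneg_of_nonpos (by positivity) hk) (by positivity)))

/-- The function `T̄ - T / r²`, whose negative bounds the first integral `T / (r² - s²) - T̄`. -/
def bound (τ B : ℝ → ℝ) (r : ℝ) : ℝ := B r - τ r ^ 2 / r ^ 2

/-- The contributions of `c` cancel, which leaves a derivative with the sign of `1 - 2 r² g`. -/
theorem hasDerivAt_bound (h : CharData I g g' c τ B) {r : ℝ} (hr : r ∈ I) :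
    HasDerivAt (bound τ B) (2 * τ r ^ 2 * (1 - 2 * r ^ 2 * g r) / r ^ 3) r := by
  have hr0 := (h.pos r hr).ne'
  have h1 := (h.hB r hr).sub
    (((h.hτ r hr).pow 2).div ((hasDerivAt_id' r).pow 2) (pow_ne_zero 2 hr0))
  refine h1.congr_deriv ?_
  simp only [Pi.pow_apply]
  field_simp
  push_cast
  ring

theorem continuousOn_bound (h : CharData I g g' c τ B) : ContinuousOn (bound τ B) I :=
  fun _ hr => (h.hasDerivAt_bound hr).continuousAt.continuousWithinAt

/-- The function `T̄ - T / r²` has convex superlevel sets. -/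
theorem ordConnected_superlevel (h : CharData I g g' c τ B) (C : ℝ) :
    {r ∈ I | 0 < C + bound τ B r}.OrdConnected := by
  refine ⟨fun a ha d hd b hb => ?_⟩
  have hbI : b ∈ I := h.ordConnected.out ha.1 hd.1 hb
  refine ⟨hbI, ?_⟩
  have hder : ∀ x ∈ I, deriv (bound τ B) x = 2 * τ x ^ 2 * (1 - 2 * x ^ 2 * g x) / x ^ 3 :=
    fun x hx => (h.hasDerivAt_bound hx).deriv
  -- In the first case `bound` increases on `[a, b]`, in the second it decreases on `[b, d]`; either
  -- way its value at `b` is at least that at one endpoint.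
  rcases le_total 0 (1 - 2 * b ^ 2 * g b) with hk | hk
  · have hsub : Icc a b ⊆ I := h.ordConnected.out ha.1 hbI
    have : MonotoneOn (bound τ B) (Icc a b) := by
      refine monotoneOn_of_deriv_nonneg (convex_Icc a b) (h.continuousOn_bound.mono hsub)
        (fun x hx => ((h.hasDerivAt_bound (hsub (interior_subset hx))).differentiableAt
          |>.differentiableWithinAt)) fun x hx => ?_
      have hxI := hsub (interior_subset hx)
      have h1 := h.nonneg_of_le hxI hbI (interior_subset hx).2 hk
      have := h.pos x hxI
      rw [hder x hxI]
      positivity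
    have := this (left_mem_Icc.2 hb.1) (right_mem_Icc.2 hb.1) hb.1
    linarith [ha.2]
  · have hsub : Icc b d ⊆ I := h.ordConnected.out hbI hd.1
    have : AntitoneOn (bound τ B) (Icc b d) := by
      refine antitoneOn_of_deriv_nonpos (convex_Icc b d) (h.continuousOn_bound.mono hsub)
        (fun x hx => ((h.hasDerivAt_bound (hsub (interior_subset hx))).differentiableAt
          |>.differentiableWithinAt)) fun x hx => ?_
      have hxI := hsub (interior_subset hx)
      have h1 := h.nonpos_of_le hbI hxI (interior_subset hx).1 hk
      have := h.pos x hxI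
      rw [hder x hxI]
      exact div_nonpos_of_nonpos_of_nonneg
        (mul_nonpos_of_nonneg_of_nonpos (by positivity) h1) (by positivity)
    have := this (left_mem_Icc.2 hb.2) (right_mem_Icc.2 hb.2) hb.2
    linarith [hd.2]

/-- The value of `r² - s²` on the level curve `T / (r² - s²) - T̄ = C`. -/
def level (τ B : ℝ → ℝ) (C r : ℝ) : ℝ := τ r ^ 2 / (C + B r)

/-- The function `√(r² - s²) W(r, s)` on the level curve `T / (r² - s²) - T̄ = C`, where `s` has
the sign `σ`. -/
def alongLevel (τ B : ℝ → ℝ) (W : ℝ → ℝ → ℝ) (σ C r : ℝ) : ℝ :=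
  √(level τ B C r) * W r (σ * √(r ^ 2 - level τ B C r))

theorem add_pos_of_bound (h : CharData I g g' c τ B) {C r : ℝ} (hr : r ∈ I)
    (hC : 0 ≤ C + bound τ B r) : 0 < C + B r := by
  have := h.pos r hr
  have := h.τ_pos r hr
  have h1 : 0 < τ r ^ 2 / r ^ 2 := by positivity
  unfold bound at hC
  linarith

theorem level_pos (h : CharData I g g' c τ B) {C r : ℝ} (hr : r ∈ I)
    (hC : 0 ≤ C + bound τ B r) : 0 < level τ B C r :=
  div_pos (pow_pos (h.τ_pos r hr) 2) (h.add_pos_of_bound hr hC)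

theorem level_lt (h : CharData I g g' c τ B) {C r : ℝ} (hr : r ∈ I)
    (hC : 0 < C + bound τ B r) : level τ B C r < r ^ 2 := by
  have h0 := h.pos r hr
  have h1 : τ r ^ 2 / r ^ 2 < C + B r := by unfold bound at hC; linarith
  rw [level, div_lt_iff₀ (h.add_pos_of_bound hr hC.le)]
  rw [div_lt_iff₀ (by positivity)] at h1
  linarith

theorem mem_region_level (h : CharData I g g' c τ B) {C r σ : ℝ} (hr : r ∈ I) (hσ : σ ^ 2 = 1)
    (hC : 0 ≤ C + bound τ B r) : (r, σ * √(r ^ 2 - level τ B C r)) ∈ region I := by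
  have h0 := h.pos r hr
  have h1 := h.level_pos hr hC
  refine ⟨hr, abs_lt_of_sq_lt_sq ?_ h0.le⟩
  rcases le_total 0 (r ^ 2 - level τ B C r) with h2 | h2
  · rw [mul_pow, hσ, Real.sq_sqrt h2]; linarith
  · rw [Real.sqrt_eq_zero_of_nonpos h2]; simp; positivity

/-- On the level curve `l = r² - s²` satisfies `l' = 4 r l Q`, hence `s s' = r (1 - 2 l Q)`: the
curve is a characteristic. Since also `(√l)' = 2 r Q √l`, the derivative of `√l W` is `√l / s` times
the left side of the equation. -/
theorem hasDerivAt_alongLevel (h : CharData I g g' c τ B) {W : ℝ → ℝ → ℝ}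
    (hW : SmoothOn (region I) W)
    (hpde : ∀ r s, (r, s) ∈ region I → s * pr W r s +
      r * (1 - 2 * (r ^ 2 - s ^ 2) * (g r + c r * s ^ 2)) * ps W r s +
      2 * r * s * (g r + c r * s ^ 2) * W r s = 0) {σ C r : ℝ} (hσ : σ ^ 2 = 1) (hr : r ∈ I)
    (hC : 0 < C + bound τ B r) : HasDerivAt (alongLevel τ B W σ C) 0 r := by
  have hΩ := isOpen_region h.isOpen
  have hz := h.mem_region_level hr hσ hC.le
  have hp := h.add_pos_of_bound hr hC.le
  have hl := h.level_pos hr hC.le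
  have hl' : 0 < r ^ 2 - level τ B C r := sub_pos.2 (h.level_lt hr hC)
  have d1 : HasDerivAt (level τ B C) (4 * r * level τ B C r *
      (g r + c r * (r ^ 2 - level τ B C r))) r := by
    have := ((h.hτ r hr).pow 2).div ((h.hB r hr).const_add C) hp.ne'
    refine this.congr_deriv ?_
    simp only [level, Pi.pow_apply]
    field_simp
    push_cast
    ring
  have d2 := (((((hasDerivAt_id' r).pow 2).sub d1).sqrt hl'.ne').const_mul σ)
  have d3 := hW.comp_curve hΩ (hasDerivAt_id' r) d2 hz
  have d4 := (d1.sqrt hl.ne').mul d3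
  refine d4.congr_deriv ?_
  have hp := hpde _ _ hz
  simp only [Pi.sub_apply, Pi.pow_apply]
  have hS := Real.sq_sqrt hl'.le
  have hR := Real.sq_sqrt hl.le
  have hS0 := (Real.sqrt_pos.2 hl').ne'
  have hR0 := (Real.sqrt_pos.2 hl).ne'
  have e1 : (σ * √(r ^ 2 - level τ B C r)) ^ 2 = r ^ 2 - level τ B C r := by
    rw [mul_pow, hσ, hS, one_mul]
  rw [e1] at hp
  set S := √(r ^ 2 - level τ B C r)
  set R := √(level τ B C r)
  have hσ0 : σ ≠ 0 := by rintro rfl; norm_num at hσ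
  generalize pr W r (σ * S) = Wr at *
  generalize ps W r (σ * S) = Ws at *
  generalize W r (σ * S) = w at *
  set l := level τ B C r
  have : l = R ^ 2 := hR.symm
  clear_value l
  subst this
  field_simp
  apply mul_left_cancel₀ hσ0
  push_cast
  linear_combination 2 * R * hp +
    R * Ws * (2 * r - 4 * r * R ^ 2 * (g r + c r * (r ^ 2 - R ^ 2))) * hσ

end CharData
end Characteristics

/-! ### The function `η`, the integral formula, and the comparison of the two signs of `s`. -/

namespace CharData

variable {I : Set ℝ} {g g' c τ B : ℝ → ℝ} {W : ℝ → ℝ → ℝ}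

/-- The equation `s W_r + r (1 - 2 (r² - s²) Q) W_s + 2 r s Q W = 0`, with `Q = g + c s²`. -/
def CharEq (I : Set ℝ) (g c : ℝ → ℝ) (W : ℝ → ℝ → ℝ) : Prop :=
  ∀ r s, (r, s) ∈ region I → s * pr W r s +
      r * (1 - 2 * (r ^ 2 - s ^ 2) * (g r + c r * s ^ 2)) * ps W r s +
      2 * r * s * (g r + c r * s ^ 2) * W r s = 0

theorem alongLevel_eq (h : CharData I g g' c τ B) (hW : SmoothOn (region I) W)
    (hpde : CharEq I g c W) {σ C a b : ℝ} (hσ : σ ^ 2 = 1)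
    (ha : a ∈ I) (hCa : 0 < C + bound τ B a) (hb : b ∈ I) (hCb : 0 < C + bound τ B b) :
    alongLevel τ B W σ C a = alongLevel τ B W σ C b := by
  have hoc := h.ordConnected_superlevel C
  have hsub : uIcc a b ⊆ _ := hoc.uIcc_subset ⟨ha, hCa⟩ ⟨hb, hCb⟩
  have hd : ∀ x ∈ uIcc a b, HasDerivAt (alongLevel τ B W σ C) 0 x := fun x hx =>
    h.hasDerivAt_alongLevel hW hpde hσ (hsub hx).1 (hsub hx).2
  have := (convex_uIcc a b).norm_image_sub_le_of_norm_hasDerivWithin_le (C := 0)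
    (fun x hx => (hd x hx).hasDerivWithinAt) (fun x _ => by simp) right_mem_uIcc left_mem_uIcc
  rw [zero_mul, norm_le_zero_iff, sub_eq_zero] at this
  exact this

open Classical in
/-- The value of `√(r² - s²) W(r, s)` on the level curve of value `C`, as a function of `C`. -/
def levelValue (I : Set ℝ) (τ B : ℝ → ℝ) (W : ℝ → ℝ → ℝ) (σ C : ℝ) : ℝ :=
  if h : ∃ r, r ∈ I ∧ 0 < C + bound τ B r then alongLevel τ B W σ C h.choose else 0

theorem levelValue_eq (h : CharData I g g' c τ B) (hW : SmoothOn (region I) W)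
    (hpde : CharEq I g c W) {σ C a : ℝ} (hσ : σ ^ 2 = 1)
    (ha : a ∈ I) (hCa : 0 < C + bound τ B a) :
    levelValue I τ B W σ C = alongLevel τ B W σ C a := by
  have hex : ∃ r, r ∈ I ∧ 0 < C + bound τ B r := ⟨a, ha, hCa⟩
  rw [levelValue, dif_pos hex]
  exact h.alongLevel_eq hW hpde hσ hex.choose_spec.1 hex.choose_spec.2 ha hCa

/-- The condition on the radius is open in `C`, so one fixed radius `a` serves for all nearby
values, and the value there depends smoothly on `C`. -/
theorem contDiffAt_levelValue (h : CharData I g g' c τ B) (hW : SmoothOn (region I) W)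
    (hpde : CharEq I g c W) {σ C a : ℝ} (hσ : σ ^ 2 = 1)
    (ha : a ∈ I) (hCa : 0 < C + bound τ B a) : ContDiffAt ℝ ∞ (levelValue I τ B W σ) C := by
  have hev : ∀ᶠ C' in nhds C, 0 < C' + bound τ B a :=
    (continuous_id.add continuous_const).continuousAt.eventually (lt_mem_nhds hCa)
  refine ContDiffAt.congr_of_eventuallyEq (f := fun C => alongLevel τ B W σ C a) ?_
    (by filter_upwards [hev] with C' hC' using h.levelValue_eq hW hpde hσ ha hC')
  have hp := h.add_pos_of_bound ha hCa.le
  have hl := h.level_pos ha hCa.le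
  have hl' : 0 < a ^ 2 - level τ B C a := sub_pos.2 (h.level_lt ha hCa)
  have d1 : ContDiffAt ℝ ∞ (fun C => level τ B C a) C :=
    contDiffAt_const.div (contDiffAt_id.add contDiffAt_const) hp.ne'
  have d2 : ContDiffAt ℝ ∞ (fun C => σ * √(a ^ 2 - level τ B C a)) C :=
    contDiffAt_const.mul ((contDiffAt_const.sub d1).sqrt hl'.ne')
  have d3 := hW.contDiffAt (isOpen_region h.isOpen) (h.mem_region_level ha hσ hCa.le)
  exact (d1.sqrt hl.ne').mul (ContDiffAt.comp (g := Function.uncurry W) C d3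
    (contDiffAt_const.prodMk d2))

theorem den_eq (r s : ℝ) : den (fun r => τ r ^ 2) B r s = (r ^ 2 - s ^ 2) * B r - τ r ^ 2 := rfl

/-- The value of the first integral `T / (r² - s²) - T̄` is admissible for `r`. -/
theorem bound_lt (h : CharData I g g' c τ B) {r s : ℝ} (hz : (r, s) ∈ region I) (hs : s ≠ 0) :
    0 < τ r ^ 2 / (r ^ 2 - s ^ 2) - B r + bound τ B r := by
  have h1 := sq_lt_of_mem_region hz
  have h2 : 0 < s ^ 2 := by positivity
  have h3 : r ^ 2 - s ^ 2 < r ^ 2 := by linarith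
  have := div_lt_div_of_pos_left (pow_pos (h.τ_pos r hz.1) 2) (sub_pos.2 h1) h3
  unfold bound
  linarith

/-- This links the argument of `η` to the first integral. It also holds where the denominator
vanishes: there `vphi` and its inverse take the default value `0`, and the first integral is `0` as
well. -/
theorem neg_inv_vphi {r s : ℝ} (hw : r ^ 2 - s ^ 2 ≠ 0) :
    -(vphi (fun r => τ r ^ 2) B r s)⁻¹ = τ r ^ 2 / (r ^ 2 - s ^ 2) - B r := by
  rw [vphi, den_eq, inv_div]
  field_simp
  ring

theorem level_first_integral (h : CharData I g g' c τ B) {r s : ℝ} (hz : (r, s) ∈ region I) :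
    level τ B (τ r ^ 2 / (r ^ 2 - s ^ 2) - B r) r = r ^ 2 - s ^ 2 := by
  have h1 := sub_pos.2 (sq_lt_of_mem_region hz)
  have h2 := h.τ_pos r hz.1
  rw [level, sub_add_cancel]
  field_simp

theorem levelValue_first_integral (h : CharData I g g' c τ B) (hW : SmoothOn (region I) W)
    (hpde : CharEq I g c W) {σ r s : ℝ} (hσ : σ ^ 2 = 1) (hz : (r, s) ∈ region I)
    (hs : 0 < σ * s) :
    levelValue I τ B W σ (τ r ^ 2 / (r ^ 2 - s ^ 2) - B r) = √(r ^ 2 - s ^ 2) * W r s := by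
  have hs0 : s ≠ 0 := by rintro rfl; simp at hs
  rw [h.levelValue_eq hW hpde hσ hz.1 (h.bound_lt hz hs0), alongLevel,
    h.level_first_integral hz]
  have e1 : r ^ 2 - (r ^ 2 - s ^ 2) = (σ * s) ^ 2 := by rw [mul_pow, hσ]; ring
  rw [e1, Real.sqrt_sq hs.le, ← mul_assoc, show σ * σ = 1 by rw [← hσ]; ring, one_mul]

/-- The function `η` with `√(r² - s²) W(r, s) = η(vphi(r, s))`. -/
def eta (I : Set ℝ) (τ B : ℝ → ℝ) (W : ℝ → ℝ → ℝ) (σ z : ℝ) : ℝ :=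
  levelValue I τ B W σ (-z⁻¹)

theorem contDiffAt_eta (h : CharData I g g' c τ B) (hW : SmoothOn (region I) W)
    (hpde : CharEq I g c W) {σ r s : ℝ} (hσ : σ ^ 2 = 1) (hz : (r, s) ∈ region I)
    (hs : s ≠ 0) (hd : den (fun r => τ r ^ 2) B r s ≠ 0) :
    ContDiffAt ℝ ∞ (eta I τ B W σ) (vphi (fun r => τ r ^ 2) B r s) := by
  have hw := (sub_pos.2 (sq_lt_of_mem_region hz)).ne'
  have h1 := h.contDiffAt_levelValue hW hpde hσ hz.1 (h.bound_lt hz hs)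
  rw [← neg_inv_vphi hw] at h1
  exact ContDiffAt.comp (g := levelValue I τ B W σ) _ h1
    (contDiffAt_inv ℝ (div_ne_zero hw hd)).neg

theorem eta_vphi (h : CharData I g g' c τ B) (hW : SmoothOn (region I) W)
    (hpde : CharEq I g c W) {σ r s : ℝ} (hσ : σ ^ 2 = 1) (hz : (r, s) ∈ region I)
    (hs : 0 < σ * s) :
    eta I τ B W σ (vphi (fun r => τ r ^ 2) B r s) = √(r ^ 2 - s ^ 2) * W r s := by
  have hw := (sub_pos.2 (sq_lt_of_mem_region hz)).ne'
  rw [eta, neg_inv_vphi hw, h.levelValue_first_integral hW hpde hσ hz hs]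

/-- With `W = p - s p_s`, the integrand `η / (t² √(r² - t²))` is `W / t²`, which is minus the
derivative of `p / t`. The fundamental theorem of calculus from `σ r / 2` then forces `h` to be `p /
t` at that point. -/
theorem hasIntegralForm (h : CharData I g g' c τ B) {p : ℝ → ℝ → ℝ}
    (hp : SmoothOn (region I) p) (hpde : CharEq I g c fun r s => p r s - s * ps p r s)
    {σ : ℝ} (hσ : σ = 1 ∨ σ = -1) :
    HasIntegralForm I (fun r => τ r ^ 2) B σ p (fun r => p r (σ * r / 2) / (σ * r / 2))
      (eta I τ B (fun r s => p r s - s * ps p r s) σ) := by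
  have hΩ := isOpen_region h.isOpen
  have hσ2 : σ ^ 2 = 1 := by rcases hσ with rfl | rfl <;> norm_num
  have hW : SmoothOn (region I) fun r s => p r s - s * ps p r s :=
    ContDiffOn.sub hp (contDiff_snd.contDiffOn.mul (hp.smoothOn_ps hΩ))
  have hhalf : ∀ r ∈ I, (r, σ * r / 2) ∈ region I := by
    intro r hr
    have := h.pos r hr
    refine ⟨hr, ?_⟩
    rcases hσ with rfl | rfl
    · rw [abs_of_pos (by linarith)]; simp only; linarith
    · rw [abs_of_neg (by linarith)]; simp only; linarith
  refine ⟨?_, ?_, ?_⟩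
  · have d : ContDiffOn ℝ ∞ (fun r : ℝ => σ * r / 2) I := by fun_prop
    refine ContDiffOn.div (ContDiffOn.comp (g := Function.uncurry p) hp
      (contDiffOn_id.prodMk d) hhalf) d fun r hr => ?_
    have := (h.pos r hr).ne'
    have : σ ≠ 0 := by rintro rfl; norm_num at hσ2
    positivity
  · intro r hr s hs hσs hd
    have hs0 : s ≠ 0 := by rintro rfl; simp at hσs
    exact h.contDiffAt_eta hW hpde hσ2 ⟨hr, hs⟩ hs0 hd
  · intro r hr s hs hσs
    have hr0 := h.pos r hr
    have hmem : ∀ t ∈ uIcc (σ * r / 2) s, (r, t) ∈ region I ∧ 0 < σ * t := by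
      intro t ht
      have hconv : Convex ℝ {t : ℝ | |t| < r ∧ 0 < σ * t} := by
        have : {t : ℝ | |t| < r ∧ 0 < σ * t} = Ioo (-r) r ∩ {t | 0 < σ * t} := by
          ext t; simp [abs_lt]
        rw [this]
        exact (convex_Ioo _ _).inter (convex_halfSpace_gt (IsLinearMap.isLinearMap_smul σ) 0)
      have h1 : 0 < σ * (σ * r / 2) := by
        have : σ * (σ * r / 2) = r / 2 := by linear_combination (r / 2) * hσ2
        rw [this]; positivity
      have := hconv.ordConnected.uIcc_subset ⟨(hhalf r hr).2, h1⟩ ⟨hs, hσs⟩ ht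
      exact ⟨⟨hr, this.1⟩, this.2⟩
    have heq : ∀ t ∈ uIcc (σ * r / 2) s,
        eta I τ B (fun r s => p r s - s * ps p r s) σ (vphi (fun r => τ r ^ 2) B r t) /
          (t ^ 2 * √(r ^ 2 - t ^ 2)) = -((ps p r t * t - p r t * 1) / t ^ 2) := by
      intro t ht
      obtain ⟨hz, ht0⟩ := hmem t ht
      rw [h.eta_vphi hW hpde hσ2 hz ht0]
      have := Real.sqrt_pos.2 (sub_pos.2 (sq_lt_of_mem_region hz))
      have : t ≠ 0 := by rintro rfl; simp at ht0
      field_simp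
      ring
    have hder : ∀ t ∈ uIcc (σ * r / 2) s,
        HasDerivAt (fun t => p r t / t) ((ps p r t * t - p r t * 1) / t ^ 2) t := by
      intro t ht
      obtain ⟨hz, ht0⟩ := hmem t ht
      have : t ≠ 0 := by rintro rfl; simp at ht0
      exact (hp.hasDerivAt_snd hΩ hz).div (hasDerivAt_id' t) this
    have hcont : ContinuousOn (fun t => (ps p r t * t - p r t * 1) / t ^ 2)
        (uIcc (σ * r / 2) s) := by
      intro t ht
      obtain ⟨hz, ht0⟩ := hmem t ht
      have : t ≠ 0 := by rintro rfl; simp at ht0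
      have c1 := (hp.hasDerivAt_snd hΩ hz).continuousAt
      have c2 := ((hp.smoothOn_ps hΩ).hasDerivAt_snd hΩ hz).continuousAt
      exact (((c2.mul continuousAt_id).sub (c1.mul continuousAt_const)).div
        (continuousAt_id.pow 2) (pow_ne_zero 2 this)).continuousWithinAt
    constructor
    · refine (hcont.neg.congr fun t ht => heq t ht).intervalIntegrable
    · have hs0 : s ≠ 0 := by rintro rfl; simp at hσs
      rw [intervalIntegral.integral_congr (g := fun t => -((ps p r t * t - p r t * 1) / t ^ 2))
        heq, intervalIntegral.integral_neg,
        intervalIntegral.integral_eq_sub_of_hasDerivAt hder hcont.intervalIntegrable]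
      field_simp
      ring

/-- If the level curves reach `s = 0` at their inner end, the values for the two signs agree. -/
theorem levelValue_neg (h : CharData I g g' c τ B) (hW : SmoothOn (region I) W)
    (hpde : CharEq I g c W)
    (hex : ∀ C, ∀ r ∈ I, 0 < C + bound τ B r → ∃ a ∈ I, a ≤ r ∧ C + bound τ B a ≤ 0) :
    levelValue I τ B W (-1) = levelValue I τ B W 1 := by
  funext C
  by_cases hC : ∃ r, r ∈ I ∧ 0 < C + bound τ B r
  swap
  · rw [levelValue, levelValue, dif_neg hC, dif_neg hC]
  obtain ⟨r, hr, hCr⟩ := hC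
  obtain ⟨a, ha, har, hCa⟩ := hex C r hr hCr
  have hsub : Icc a r ⊆ I := h.ordConnected.out ha hr
  have hbc : ContinuousOn (fun t => C + bound τ B t) (Icc a r) :=
    continuousOn_const.add (h.continuousOn_bound.mono hsub)
  -- the last zero of `C + bound`
  have hcl : IsClosed (Icc a r ∩ (fun t => C + bound τ B t) ⁻¹' Iic 0) :=
    hbc.preimage_isClosed_of_isClosed isClosed_Icc isClosed_Iic
  have hcpt : IsCompact (Icc a r ∩ (fun t => C + bound τ B t) ⁻¹' Iic 0) :=
    isCompact_Icc.of_isClosed_subset hcl inter_subset_left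
  obtain ⟨b, ⟨hb, hCb⟩, hmax⟩ := hcpt.exists_isGreatest ⟨a, ⟨le_rfl, har⟩, hCa⟩
  have hbI := hsub hb
  have hCb : C + bound τ B b ≤ 0 := hCb
  have hbr : b < r := hb.2.lt_of_ne (by rintro rfl; linarith)
  have hpos : ∀ t ∈ Ioc b r, 0 < C + bound τ B t := by
    intro t ht
    by_contra hneg
    exact absurd (hmax ⟨⟨hb.1.trans ht.1.le, ht.2⟩, not_lt.1 hneg⟩) (not_le.2 ht.1)
  have hCb0 : C + bound τ B b = 0 := by
    refine le_antisymm hCb ?_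
    have hcb := (h.continuousOn_bound.continuousAt (h.isOpen.mem_nhds hbI)).const_add C
    refine ge_of_tendsto (hcb.tendsto.mono_left (nhdsWithin_le_nhds (s := Ioi b))) ?_
    filter_upwards [Ioc_mem_nhdsGT hbr] with t ht using (hpos t ht).le
  -- So at the radius `b` the level curve meets `s = 0`. `alongLevel` is still continuous there,
  -- though the square root spoils differentiability.
  have hlev : level τ B C b = b ^ 2 := by
    have h0 := h.pos b hbI
    have h1 := h.τ_pos b hbI
    have : C + B b = τ b ^ 2 / b ^ 2 := by unfold bound at hCb0; linarith
    rw [level, this]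
    field_simp
  have hcont : ∀ σ : ℝ, σ ^ 2 = 1 → ContinuousAt (alongLevel τ B W σ C) b := by
    intro σ hσ
    have hp := h.add_pos_of_bound hbI hCb0.ge
    have c1 : ContinuousAt (level τ B C) b :=
      ((h.hτ b hbI).continuousAt.pow 2).div ((h.hB b hbI).continuousAt.const_add C) hp.ne'
    have c2 : ContinuousAt (fun t => (t, σ * √(t ^ 2 - level τ B C t))) b :=
      continuousAt_id.prodMk
        (((continuousAt_id.pow 2).sub c1).sqrt.const_mul σ)
    have c3 := (hW.contDiffAt (isOpen_region h.isOpen)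
      (h.mem_region_level hbI hσ hCb0.ge)).continuousAt
    exact c1.sqrt.mul (ContinuousAt.comp (g := Function.uncurry W)
      (f := fun t => (t, σ * √(t ^ 2 - level τ B C t))) c3 c2)
  have hlim : ∀ σ : ℝ, σ ^ 2 = 1 →
      alongLevel τ B W σ C b = levelValue I τ B W σ C := by
    intro σ hσ
    refine tendsto_nhds_unique
      ((hcont σ hσ).tendsto.mono_left (nhdsWithin_le_nhds (s := Ioi b))) ?_
    refine tendsto_const_nhds.congr' ?_
    filter_upwards [Ioc_mem_nhdsGT hbr] with t ht
    exact h.levelValue_eq hW hpde hσ (hsub ⟨hb.1.trans ht.1.le, ht.2⟩) (hpos t ht)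
  rw [← hlim (-1) (by norm_num), ← hlim 1 (by norm_num)]
  simp [alongLevel, hlev]

/-- The bound `T̄ - T / r²` tends to `-∞` at the centre if `r g` and `r (g + c r²)` are bounded. -/
theorem exists_bound_nonpos (h : CharData I g g' c τ B)
    (h0 : ∀ r ∈ I, ∀ a, 0 < a → a ≤ r → a ∈ I) {δ M : ℝ} (hδ : 0 < δ)
    (hg : ∀ r ∈ I, r < δ → |r * g r| ≤ M)
    (hc : ∀ r ∈ I, r < δ → |r * (g r + c r * r ^ 2)| ≤ M) (C : ℝ) {r : ℝ} (hr : r ∈ I) :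
    ∃ a ∈ I, a ≤ r ∧ C + bound τ B a ≤ 0 := by
  have hr0 := h.pos r hr
  have hM : 0 ≤ M := by
    have hm : 0 < min r (δ / 2) := by positivity
    exact (abs_nonneg _).trans (hg _ (h0 r hr _ hm (min_le_left _ _))
      ((min_le_right _ _).trans_lt (by linarith)))
  -- The condition `4 d M ≤ 1` ensures `1 - 2 x² g ≥ 1 / 2` on `(0, d]`.
  obtain ⟨d, hd0, hdr, hdδ, hdM⟩ : ∃ d, 0 < d ∧ d ≤ r ∧ d < δ ∧ 4 * d * M ≤ 1 := by
    refine ⟨min r (min (δ / 2) (1 / (4 * (M + 1)))), by positivity, min_le_left _ _,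
      ((min_le_right _ _).trans (min_le_left _ _)).trans_lt (by linarith), ?_⟩
    have h1 : min r (min (δ / 2) (1 / (4 * (M + 1)))) ≤ 1 / (4 * (M + 1)) :=
      (min_le_right _ _).trans (min_le_right _ _)
    rw [le_div_iff₀ (by positivity)] at h1
    have : 0 < min r (min (δ / 2) (1 / (4 * (M + 1)))) := by positivity
    nlinarith
  have hsub : Ioc 0 d ⊆ I := fun a ha => h0 r hr a ha.1 (ha.2.trans hdr)
  have hd : d ∈ I := hsub ⟨hd0, le_rfl⟩
  -- lower bound for `τ`
  set m := τ d * Real.exp (-(2 * M * d)) with hm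
  have hmpos : 0 < m := mul_pos (h.τ_pos d hd) (Real.exp_pos _)
  have hτ : ∀ a ∈ Ioc 0 d, m ≤ τ a := by
    -- The logarithmic derivative of `τ` is at most `2 M` near the centre, so this product is
    -- nonincreasing on `(0, d]`.
    have hder : ∀ x ∈ I, HasDerivAt (fun x => τ x * Real.exp (-(2 * M * x)))
        (2 * (x * (g x + c x * x ^ 2) - M) * (τ x * Real.exp (-(2 * M * x)))) x := by
      intro x hx
      refine ((h.hτ x hx).mul (((hasDerivAt_id' x).const_mul (2 * M)).neg.exp)).congr_deriv ?_
      simp only [Pi.neg_apply]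
      ring
    intro a ha
    have hanti : AntitoneOn (fun x => τ x * Real.exp (-(2 * M * x))) (Icc a d) := by
      have hsub' : Icc a d ⊆ Ioc 0 d := fun x hx => ⟨ha.1.trans_le hx.1, hx.2⟩
      refine antitoneOn_of_deriv_nonpos (convex_Icc a d)
        (fun x hx => (hder x (hsub (hsub' hx))).continuousAt.continuousWithinAt)
        (fun x hx => (hder x (hsub (hsub' (interior_subset hx)))).differentiableAt
          |>.differentiableWithinAt) fun x hx => ?_
      have hx := hsub' (interior_subset hx)
      rw [(hder x (hsub hx)).deriv]
      have h1 := (abs_le.1 (hc x (hsub hx) (hx.2.trans_lt hdδ))).2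
      exact mul_nonpos_of_nonpos_of_nonneg (by linarith)
        (mul_nonneg (h.τ_pos x (hsub hx)).le (Real.exp_pos _).le)
    have h1 : m ≤ τ a * Real.exp (-(2 * M * a)) :=
      hanti (left_mem_Icc.2 ha.2) (right_mem_Icc.2 ha.2) ha.2
    have h2 : Real.exp (-(2 * M * a)) ≤ 1 := by
      rw [Real.exp_le_one_iff]
      have := ha.1
      have : 0 ≤ 2 * M * a := by positivity
      linarith
    exact h1.trans (mul_le_of_le_one_right (h.τ_pos a (hsub ha)).le h2)
  -- upper bound for `T̄ - T / r²`
  have hbd : ∀ a ∈ Ioc 0 d, bound τ B a ≤ bound τ B d + m ^ 2 / (2 * d ^ 2) - m ^ 2 / (2 * a ^ 2) := by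
    intro a ha
    -- Since `τ ≥ m` and `1 - 2 x² g ≥ 1 / 2`, the derivative of `bound` is at least `m² / x³`, the
    -- derivative of `-m² / (2 x²)`.
    have hder : ∀ x ∈ Ioc 0 d, HasDerivAt (fun x => bound τ B x + m ^ 2 / (2 * x ^ 2))
        ((2 * τ x ^ 2 * (1 - 2 * x ^ 2 * g x) - m ^ 2) / x ^ 3) x := by
      intro x hx
      have hx0 := hx.1.ne'
      have := (((hasDerivAt_id' x).pow 2).const_mul 2)
      refine ((h.hasDerivAt_bound (hsub hx)).add ((hasDerivAt_const x (m ^ 2)).div this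
        (by simp [hx0]))).congr_deriv ?_
      simp only [Pi.pow_apply]
      field_simp
      push_cast
      ring
    have hmono : MonotoneOn (fun x => bound τ B x + m ^ 2 / (2 * x ^ 2)) (Icc a d) := by
      have hsub' : Icc a d ⊆ Ioc 0 d := fun x hx => ⟨ha.1.trans_le hx.1, hx.2⟩
      refine monotoneOn_of_deriv_nonneg (convex_Icc a d)
        (fun x hx => (hder x (hsub' hx)).continuousAt.continuousWithinAt)
        (fun x hx => (hder x (hsub' (interior_subset hx))).differentiableAt
          |>.differentiableWithinAt) fun x hx => ?_
      have hx := hsub' (interior_subset hx)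
      rw [(hder x hx).deriv]
      have hx0 := hx.1
      have h1 := (abs_le.1 (hg x (hsub hx) (hx.2.trans_lt hdδ))).2
      have h2 : 2 * x ^ 2 * g x ≤ 1 / 2 := by
        have h3 : x * (x * g x) ≤ x * M := mul_le_mul_of_nonneg_left h1 hx0.le
        have h4 : x * M ≤ d * M := mul_le_mul_of_nonneg_right hx.2 hM
        nlinarith
      have h3 : m ^ 2 ≤ τ x ^ 2 := pow_le_pow_left₀ hmpos.le (hτ x hx) 2
      refine div_nonneg ?_ (by positivity)
      nlinarith [sq_nonneg (τ x)]
    have := hmono (left_mem_Icc.2 ha.2) (right_mem_Icc.2 ha.2) ha.2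
    simp only at this
    linarith
  -- choose a small radius
  set N := |C + (bound τ B d + m ^ 2 / (2 * d ^ 2))| + 1
  have hN : 0 < N := by positivity
  -- This is the radius at which `m² / (2 a²)` equals `N`.
  have ha0 : 0 < m / √(2 * N) := by positivity
  refine ⟨min d (m / √(2 * N)), hsub ⟨lt_min hd0 ha0, min_le_left _ _⟩,
    (min_le_left _ _).trans hdr, ?_⟩
  set a := min d (m / √(2 * N))
  have ha : 0 < a := lt_min hd0 ha0
  have h1 := hbd a ⟨ha, min_le_left _ _⟩
  have h2 : a ^ 2 ≤ m ^ 2 / (2 * N) := by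
    have := pow_le_pow_left₀ ha.le (min_le_right d (m / √(2 * N))) 2
    rwa [div_pow, Real.sq_sqrt (by positivity)] at this
  have h3 : N ≤ m ^ 2 / (2 * a ^ 2) := by
    rw [le_div_iff₀ (by positivity)] at h2 ⊢
    linarith
  have h4 := le_abs_self (C + (bound τ B d + m ^ 2 / (2 * d ^ 2)))
  have h5 : |C + (bound τ B d + m ^ 2 / (2 * d ^ 2))| < N := lt_add_one _
  linarith

/-- By `hgc`, `log |τ (1 - 2 r² g)|` has derivative `-2 r g / (1 - 2 r² g)`. The real logarithm
being that of the absolute value, one formula for `A` serves on both sides of the exceptional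
radius. -/
theorem isT (h : CharData I g g' c τ B) : IsT I g fun r => τ r ^ 2 := by
  refine ⟨fun r hr => ((h.hτ r hr).continuousAt.pow 2).continuousWithinAt,
    fun r => -(2 * Real.log (τ r * (1 - 2 * r ^ 2 * g r))), fun r hr hne => ?_⟩
  have hk : 1 - 2 * r ^ 2 * g r ≠ 0 := fun h => hne (by linarith)
  have ht := (h.τ_pos r hr).ne'
  have hne' : τ r * (1 - 2 * r ^ 2 * g r) ≠ 0 := mul_ne_zero ht hk
  constructor
  · refine ((((h.hτ r hr).mul (h.hasDerivAt_one_sub hr)).log hne').const_mul 2).neg.congr_deriv ?_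
    have := h.hgc r hr
    simp only [Pi.mul_apply]
    field_simp
    linear_combination (-(4 : ℝ) * r ^ 2) * this
  · rw [neg_neg, two_mul, Real.exp_add, Real.exp_log_eq_abs hne', abs_mul_abs_self]
    field_simp

theorem isTbar (h : CharData I g g' c τ B) : IsTbar I g (fun r => τ r ^ 2) B := by
  refine ⟨fun r hr => (h.hB r hr).continuousAt.continuousWithinAt, fun r hr hne => ?_⟩
  have hk : 1 - 2 * r ^ 2 * g r ≠ 0 := fun h => hne (by linarith)
  refine (h.hB r hr).congr_deriv ?_
  rw [(h.hg r hr).deriv]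
  have e : (g' r + 2 * r * g r ^ 2) / (1 - 2 * r ^ 2 * g r) = c r * r := by
    rw [div_eq_iff hk]
    linear_combination -h.hgc r hr
  rw [e]
  ring

end CharData

/-! ### Partial derivatives on the tangent bundle of functions of `|x|`, `|y|` and `s`. -/

section Calculus

variable {n : ℕ} {f f₁ f₂ : Rn n → Rn n → ℝ} {x y : Rn n} {A B : Fin n → ℝ}

/-- `f` has the partial derivatives `A i` in `xⁱ` at `(x, y)`. -/
def HasDx (f : Rn n → Rn n → ℝ) (x y : Rn n) (A : Fin n → ℝ) : Prop :=
  ∃ L : Rn n →L[ℝ] ℝ, HasFDerivAt (fun x' => f x' y) L x ∧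
    ∀ i, L (EuclideanSpace.single i 1) = A i

/-- `f` has the partial derivatives `A i` in `yⁱ` at `(x, y)`. -/
def HasDy (f : Rn n → Rn n → ℝ) (x y : Rn n) (A : Fin n → ℝ) : Prop :=
  ∃ L : Rn n →L[ℝ] ℝ, HasFDerivAt (fun y' => f x y') L y ∧
    ∀ i, L (EuclideanSpace.single i 1) = A i

theorem HasDx.eq (h : HasDx f x y A) (i : Fin n) : dx i f x y = A i := by
  obtain ⟨L, h1, h2⟩ := h
  rw [dx, h1.fderiv, h2]

theorem HasDy.eq (h : HasDy f x y A) (i : Fin n) : dy i f x y = A i := by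
  obtain ⟨L, h1, h2⟩ := h
  rw [dy, h1.fderiv, h2]

theorem HasDx.of_eq (h : HasDx f x y A) (hA : ∀ i, A i = B i) : HasDx f x y B := by
  rwa [← funext hA]

theorem HasDy.of_eq (h : HasDy f x y A) (hA : ∀ i, A i = B i) : HasDy f x y B := by
  rwa [← funext hA]

theorem HasDx.add (h₁ : HasDx f₁ x y A) (h₂ : HasDx f₂ x y B) :
    HasDx (fun x y => f₁ x y + f₂ x y) x y fun i => A i + B i := by
  obtain ⟨L, h1, h1'⟩ := h₁
  obtain ⟨L', h2, h2'⟩ := h₂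
  exact ⟨_, h1.add h2, fun i => by simp [h1', h2']⟩

theorem HasDy.add (h₁ : HasDy f₁ x y A) (h₂ : HasDy f₂ x y B) :
    HasDy (fun x y => f₁ x y + f₂ x y) x y fun i => A i + B i := by
  obtain ⟨L, h1, h1'⟩ := h₁
  obtain ⟨L', h2, h2'⟩ := h₂
  exact ⟨_, h1.add h2, fun i => by simp [h1', h2']⟩

theorem HasDy.sub (h₁ : HasDy f₁ x y A) (h₂ : HasDy f₂ x y B) :
    HasDy (fun x y => f₁ x y - f₂ x y) x y fun i => A i - B i := by
  obtain ⟨L, h1, h1'⟩ := h₁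
  obtain ⟨L', h2, h2'⟩ := h₂
  exact ⟨_, h1.sub h2, fun i => by simp [h1', h2']⟩

theorem HasDx.mul (h₁ : HasDx f₁ x y A) (h₂ : HasDx f₂ x y B) :
    HasDx (fun x y => f₁ x y * f₂ x y) x y fun i => A i * f₂ x y + f₁ x y * B i := by
  obtain ⟨L, h1, h1'⟩ := h₁
  obtain ⟨L', h2, h2'⟩ := h₂
  exact ⟨_, h1.mul h2, fun i => by simp [h1', h2']; ring⟩

theorem HasDy.mul (h₁ : HasDy f₁ x y A) (h₂ : HasDy f₂ x y B) :
    HasDy (fun x y => f₁ x y * f₂ x y) x y fun i => A i * f₂ x y + f₁ x y * B i := by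
  obtain ⟨L, h1, h1'⟩ := h₁
  obtain ⟨L', h2, h2'⟩ := h₂
  exact ⟨_, h1.mul h2, fun i => by simp [h1', h2']; ring⟩

theorem hasDx_of_snd (h : Rn n → ℝ) : HasDx (fun _ y => h y) x y fun _ => 0 :=
  ⟨0, hasFDerivAt_const _ _, fun _ => rfl⟩

theorem hasDy_of_fst (h : Rn n → ℝ) : HasDy (fun x _ => h x) x y fun _ => 0 :=
  ⟨0, hasFDerivAt_const _ _, fun _ => rfl⟩

theorem hasDx_coord (k : Fin n) : HasDx (fun x _ => x k) x y fun i => if k = i then 1 else 0 :=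
  ⟨EuclideanSpace.proj k, (EuclideanSpace.proj k : Rn n →L[ℝ] ℝ).hasFDerivAt, fun i => by simp⟩

theorem hasDy_coord (k : Fin n) : HasDy (fun _ y => y k) x y fun i => if k = i then 1 else 0 :=
  ⟨EuclideanSpace.proj k, (EuclideanSpace.proj k : Rn n →L[ℝ] ℝ).hasFDerivAt, fun i => by simp⟩

theorem hasFDerivAt_norm_of_ne {v : Rn n} (hv : v ≠ 0) :
    HasFDerivAt (fun v : Rn n => ‖v‖) (‖v‖⁻¹ • innerSL ℝ v) v := by
  have h0 : ‖v‖ ≠ 0 := norm_ne_zero_iff.2 hv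
  have h1 := (hasStrictFDerivAt_norm_sq v).hasFDerivAt.sqrt (pow_ne_zero 2 h0)
  simp only [Real.sqrt_sq (norm_nonneg _)] at h1
  refine h1.congr_fderiv ?_
  ext w
  simp only [smul_apply, smul_eq_mul, nsmul_eq_mul]
  push_cast
  field_simp

/-- The argument `s = ⟨x, y⟩ / |y|`. -/
def sArg (x y : Rn n) : ℝ := inner ℝ x y / ‖y‖

/-- The function `f(|x|, ⟨x, y⟩ / |y|)`. -/
def lift (f : ℝ → ℝ → ℝ) (x y : Rn n) : ℝ := f ‖x‖ (sArg x y)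

theorem inner_eq_sum (x y : Rn n) : inner ℝ x y = ∑ i, x i * y i := by
  simp [PiLp.inner_apply, mul_comm]

theorem hasDy_norm (hy : y ≠ 0) : HasDy (fun _ y => ‖y‖) x y fun i => y i / ‖y‖ :=
  ⟨_, hasFDerivAt_norm_of_ne hy, fun i => by
    simp [EuclideanSpace.inner_single_right, div_eq_inv_mul]⟩

theorem hasDx_lift {Ω : Set (ℝ × ℝ)} (hΩ : IsOpen Ω) {f : ℝ → ℝ → ℝ} (hf : SmoothOn Ω f)
    (hx : x ≠ 0) (hz : (‖x‖, sArg x y) ∈ Ω) :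
    HasDx (lift f) x y fun i =>
      pr f ‖x‖ (sArg x y) * (x i / ‖x‖) + ps f ‖x‖ (sArg x y) * (y i / ‖y‖) := by
  have h2 : HasFDerivAt (fun x' => sArg x' y) (‖y‖⁻¹ • innerSL ℝ y) x := by
    have : (fun x' => sArg x' y) = fun x' => (‖y‖⁻¹ • innerSL ℝ y) x' := by
      ext x'; simp [sArg, real_inner_comm, div_eq_inv_mul]
    rw [this]
    exact ContinuousLinearMap.hasFDerivAt _
  have h3 := HasFDerivAt.comp (f := fun x' => (‖x'‖, sArg x' y)) x (hf.hasFDerivAt hΩ hz)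
    ((hasFDerivAt_norm_of_ne hx).prodMk h2)
  refine ⟨_, h3, fun i => ?_⟩
  simp [EuclideanSpace.inner_single_right, div_eq_inv_mul]

theorem hasDy_lift {Ω : Set (ℝ × ℝ)} (hΩ : IsOpen Ω) {f : ℝ → ℝ → ℝ} (hf : SmoothOn Ω f)
    (hy : y ≠ 0) (hz : (‖x‖, sArg x y) ∈ Ω) :
    HasDy (lift f) x y fun i =>
      ps f ‖x‖ (sArg x y) * (x i / ‖y‖ - sArg x y * y i / ‖y‖ ^ 2) := by
  have h0 : ‖y‖ ≠ 0 := norm_ne_zero_iff.2 hy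
  have h1 := ((innerSL ℝ x).hasFDerivAt (x := y)).mul
    ((hasDerivAt_inv h0).comp_hasFDerivAt y (hasFDerivAt_norm_of_ne hy))
  have h2 : HasFDerivAt (fun y' => sArg x y') _ y := h1.congr_of_eventuallyEq
    (Filter.Eventually.of_forall fun y' => by simp [sArg, div_eq_mul_inv])
  have h3 := HasFDerivAt.comp (f := fun y' => (‖x‖, sArg x y')) y (hf.hasFDerivAt hΩ hz)
    ((hasFDerivAt_const ‖x‖ y).prodMk h2)
  refine ⟨_, h3, fun i => ?_⟩
  simp [EuclideanSpace.inner_single_right, sArg]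
  field_simp
  simp
  exact Or.inl (by ring)

theorem hasDy_sArg (hy : y ≠ 0) :
    HasDy sArg x y fun i => x i / ‖y‖ - sArg x y * y i / ‖y‖ ^ 2 := by
  have hs : SmoothOn univ fun _ s => s := contDiff_snd.contDiffOn
  refine (hasDy_lift isOpen_univ hs hy (mem_univ _)).of_eq fun i => ?_
  simp [ps]

theorem hasDy_const (a : ℝ) : HasDy (fun _ _ => a) x y fun _ => 0 := hasDy_of_fst fun _ => a

/-- The pairs `(x, y)` with `|x| ∈ I` that are linearly independent. -/
def Adm (I : Set ℝ) (x y : Rn n) : Prop := ‖x‖ ∈ I ∧ |inner ℝ x y| < ‖x‖ * ‖y‖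

namespace Adm

variable {I : Set ℝ}

theorem ne_left (h : Adm I x y) : x ≠ 0 := by
  rintro rfl
  simpa [Adm] using h.2

theorem ne_right (h : Adm I x y) : y ≠ 0 := by
  rintro rfl
  simpa [Adm] using h.2

theorem norm_left_pos (h : Adm I x y) : 0 < ‖x‖ := norm_pos_iff.2 h.ne_left

theorem norm_right_pos (h : Adm I x y) : 0 < ‖y‖ := norm_pos_iff.2 h.ne_right

theorem mem_region (h : Adm I x y) : (‖x‖, sArg x y) ∈ region I := by
  refine ⟨h.1, ?_⟩
  rw [sArg, abs_div, abs_norm, div_lt_iff₀ h.norm_right_pos]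
  exact h.2

theorem eventually_left (hI : IsOpen I) (h : Adm I x y) : ∀ᶠ x' in nhds x, Adm I x' y :=
  (((hI.preimage continuous_norm).inter (isOpen_lt (f := fun x' : Rn n => |inner ℝ x' y|)
    (g := fun x' => ‖x'‖ * ‖y‖) (by fun_prop) (by fun_prop))).mem_nhds h)

theorem eventually_right (h : Adm I x y) : ∀ᶠ y' in nhds y, Adm I x y' := by
  filter_upwards [(isOpen_lt (f := fun y' : Rn n => |inner ℝ x y'|)
    (g := fun y' => ‖x‖ * ‖y'‖) (by fun_prop) (by fun_prop)).mem_nhds h.2] with y' hy'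
  exact ⟨h.1, hy'⟩

end Adm

/-- Explicit formulas are available only at admissible pairs. As these form an open condition, a
formula for one derivative can be differentiated again. -/
theorem HasDx.congr {I : Set ℝ} (hI : IsOpen I) (h : HasDx f x y A)
    (he : ∀ x y, Adm I x y → f₁ x y = f x y) (hz : Adm I x y) : HasDx f₁ x y A := by
  obtain ⟨L, h1, h2⟩ := h
  refine ⟨L, h1.congr_of_eventuallyEq ?_, h2⟩
  filter_upwards [hz.eventually_left hI] with x' hx' using he _ _ hx'

theorem HasDy.congr {I : Set ℝ} (h : HasDy f x y A)
    (he : ∀ x y, Adm I x y → f₁ x y = f x y) (hz : Adm I x y) : HasDy f₁ x y A := by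
  obtain ⟨L, h1, h2⟩ := h
  refine ⟨L, h1.congr_of_eventuallyEq ?_, h2⟩
  filter_upwards [hz.eventually_right] with y' hy' using he _ _ hy'

end Calculus

/-! ### The fundamental tensor of a spherically symmetric metric. -/

section Tensor

variable {n : ℕ} {I : Set ℝ} {φ : ℝ → ℝ → ℝ} {x y : Rn n}

theorem hasDy_sq (hI : IsOpen I) (hφ : SmoothOn (region I) φ) (h : Adm I x y) :
    HasDy (sq (sphMetric φ)) x y fun i =>
      2 * (lift φ x y * lift φ x y * y i +
        lift φ x y * lift (ps φ) x y * (‖y‖ * x i - sArg x y * y i)) := by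
  have hΩ := isOpen_region hI
  have h1 := (hasDy_norm (x := x) h.ne_right).mul (hasDy_lift hΩ hφ h.ne_right h.mem_region)
  have h2 := h1.mul h1
  have e : sq (sphMetric φ) = fun x y : Rn n => (‖y‖ * lift φ x y) * (‖y‖ * lift φ x y) := by
    ext x y
    rw [sq, pow_two]
    rfl
  rw [e]
  refine h2.of_eq fun i => ?_
  have := h.norm_right_pos.ne'
  simp only [lift]
  field_simp
  ring

theorem hasDx_sq (hI : IsOpen I) (hφ : SmoothOn (region I) φ) (h : Adm I x y) :
    HasDx (sq (sphMetric φ)) x y fun i =>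
      2 * (lift φ x y * (‖y‖ * (‖y‖ * lift (pr φ) x y * (x i / ‖x‖) + lift (ps φ) x y * y i))) := by
  have hΩ := isOpen_region hI
  have h1 := (hasDx_of_snd (x := x) (y := y) fun y => ‖y‖).mul
    (hasDx_lift hΩ hφ h.ne_left h.mem_region)
  have h2 := h1.mul h1
  have e : sq (sphMetric φ) = fun x y : Rn n => (‖y‖ * lift φ x y) * (‖y‖ * lift φ x y) := by
    ext x y
    rw [sq, pow_two]
    rfl
  rw [e]
  refine h2.of_eq fun i => ?_
  have := h.norm_right_pos.ne'
  simp only [lift]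
  field_simp
  ring

/-- The coefficient `φ² - s φ φ_s` of `δ_{ij}` in the fundamental tensor. -/
def fundDiag (φ : ℝ → ℝ → ℝ) (r s : ℝ) : ℝ := φ r s ^ 2 - s * φ r s * ps φ r s

/-- The function `φ φ_s - s (φ_s² + φ φ_ss)`. -/
def fundMixed (φ : ℝ → ℝ → ℝ) (r s : ℝ) : ℝ :=
  φ r s * ps φ r s - s * (ps φ r s ^ 2 + φ r s * ps (ps φ) r s)

/-- The function `φ_s² + φ φ_ss`. -/
def fundRadial (φ : ℝ → ℝ → ℝ) (r s : ℝ) : ℝ := ps φ r s ^ 2 + φ r s * ps (ps φ) r s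

theorem fundamental_eq (hI : IsOpen I) (hφ : SmoothOn (region I) φ) (h : Adm I x y)
    (i j : Fin n) : fundamental (sphMetric φ) x y i j =
      lift (fundDiag φ) x y * (if i = j then 1 else 0) +
        lift (fundMixed φ) x y / ‖y‖ * (x i * y j + y i * x j) -
        sArg x y * lift (fundMixed φ) x y / ‖y‖ ^ 2 * (y i * y j) +
        lift (fundRadial φ) x y * (x i * x j) := by
  have hΩ := isOpen_region hI
  have hy := h.ne_right
  have h1 := hasDy_lift hΩ hφ hy h.mem_region
  have h2 := hasDy_lift hΩ (hφ.smoothOn_ps hΩ) hy h.mem_region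
  have h3 := (hasDy_norm (x := x) hy).mul (hasDy_of_fst (y := y) fun x => x i)
  have h4 := (hasDy_sArg (x := x) hy).mul (hasDy_coord (x := x) (y := y) i)
  have h5 := (hasDy_const (x := x) (y := y) 2).mul
    (((h1.mul h1).mul (hasDy_coord i)).add ((h1.mul h2).mul (h3.sub h4)))
  have h6 := (h5.congr (f₁ := dy i (sq (sphMetric φ)))
    (fun x y hz => (hasDy_sq hI hφ hz).eq i) h).eq j
  rw [fundamental, Matrix.of_apply, h6]
  have := h.norm_right_pos.ne'
  simp only [lift, fundDiag, fundMixed, fundRadial]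
  field_simp
  ring

theorem sum_sum_mul_mul (p q v w : Fin n → ℝ) :
    ∑ i, ∑ j, p i * q j * v i * w j = (∑ i, p i * v i) * ∑ j, q j * w j := by
  rw [Finset.sum_mul_sum]
  exact Finset.sum_congr rfl fun i _ => Finset.sum_congr rfl fun j _ => by ring

theorem gInner_eq (hI : IsOpen I) (hφ : SmoothOn (region I) φ) (h : Adm I x y) (v w : Rn n) :
    gInner (sphMetric φ) x y v w =
      lift (fundDiag φ) x y * inner ℝ v w +
        lift (fundMixed φ) x y / ‖y‖ * (inner ℝ x v * inner ℝ y w + inner ℝ y v * inner ℝ x w) -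
        sArg x y * lift (fundMixed φ) x y / ‖y‖ ^ 2 * (inner ℝ y v * inner ℝ y w) +
        lift (fundRadial φ) x y * (inner ℝ x v * inner ℝ x w) := by
  simp only [gInner, fundamental_eq hI hφ h]
  have e : ∀ a b c d : ℝ, ∀ i j : Fin n,
      (a * (if i = j then 1 else 0) + b * (x i * y j + y i * x j) - c * (y i * y j) +
        d * (x i * x j)) * v i * w j =
      a * ((if i = j then 1 else 0) * v i * w j) + b * (x i * y j * v i * w j) +
        b * (y i * x j * v i * w j) - c * (y i * y j * v i * w j) + d * (x i * x j * v i * w j) :=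
    fun a b c d i j => by ring
  simp only [e, Finset.sum_add_distrib, Finset.sum_sub_distrib, ← Finset.mul_sum, sum_sum_mul_mul,
    inner_eq_sum]
  have e2 : ∑ i, ∑ j, (if i = j then (1 : ℝ) else 0) * v i * w j = ∑ i, v i * w i := by
    simp
  rw [e2]
  ring

end Tensor

/-! ### The geodesic coefficients. -/

section Spray

variable {n : ℕ} {I : Set ℝ} {M : Set (Rn n)} {φ : ℝ → ℝ → ℝ} {x y : Rn n}

theorem Adm.inner_eq (h : Adm I x y) : inner ℝ x y = sArg x y * ‖y‖ := by
  rw [sArg, div_mul_cancel₀ _ h.norm_right_pos.ne']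

theorem gInner_left (hI : IsOpen I) (hφ : SmoothOn (region I) φ) (h : Adm I x y) (w : Rn n) :
    gInner (sphMetric φ) x y y w =
      lift φ x y ^ 2 * inner ℝ y w +
        lift φ x y * lift (ps φ) x y * (‖y‖ * inner ℝ x w - sArg x y * inner ℝ y w) := by
  rw [gInner_eq hI hφ h, real_inner_self_eq_norm_sq, h.inner_eq]
  have := h.norm_right_pos.ne'
  simp only [lift, fundDiag, fundMixed, fundRadial]
  field_simp
  ring

/-- A vector in the plane of `x`, `y` that is `g_y`-orthogonal to `y`. -/
theorem exists_gInner_self_eq (hI : IsOpen I) (hφ : SmoothOn (region I) φ) (h : Adm I x y)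
    (h0 : lift φ x y ≠ 0) : ∃ v : Rn n, v ≠ 0 ∧ gInner (sphMetric φ) x y v v =
      (‖x‖ ^ 2 - sArg x y ^ 2) * lift φ x y * lift (qDen φ) x y := by
  -- The coefficient of `y` is `g_y(y, x) / g_y(y, y)`, as in Gram–Schmidt.
  refine ⟨x - (sArg x y / ‖y‖ + (‖x‖ ^ 2 - sArg x y ^ 2) * lift (ps φ) x y /
    (lift φ x y * ‖y‖)) • y, ?_, ?_⟩
  · intro h1
    rw [sub_eq_zero] at h1
    have h2 := h.2
    generalize sArg x y / ‖y‖ + _ = t at h1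
    rw [h1, inner_smul_left, norm_smul, real_inner_self_eq_norm_sq] at h2
    simp [abs_mul] at h2
    nlinarith
  · rw [gInner_eq hI hφ h]
    simp only [inner_sub_left, inner_sub_right, inner_smul_left, inner_smul_right,
      real_inner_self_eq_norm_sq, real_inner_comm x y, h.inner_eq]
    have := h.norm_right_pos.ne'
    simp only [lift, fundDiag, fundMixed, fundRadial, qDen] at h0 ⊢
    simp only [conj_trivial]
    field_simp
    ring

/-- Positive definiteness on the vector of `exists_gInner_self_eq` controls the sign of the
denominator of `Q`; this is what makes `Q` and `P` smooth. -/
theorem qDen_pos_of_posDef (hI : IsOpen I) (hφ : SmoothOn (region I) φ) (h : Adm I x y)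
    (h0 : 0 < lift φ x y) (hpd : ∀ u, u ≠ 0 → 0 < gInner (sphMetric φ) x y u u) :
    0 < lift (qDen φ) x y := by
  obtain ⟨v, hv, hv'⟩ := exists_gInner_self_eq hI hφ h h0.ne'
  have h1 := hpd v hv
  rw [hv'] at h1
  have h2 : 0 < ‖x‖ ^ 2 - sArg x y ^ 2 := sub_pos.2 (sq_lt_of_mem_region h.mem_region)
  exact pos_of_mul_pos_right h1 (by positivity)

theorem exists_orthogonal (hn : 3 ≤ n) (x y : Rn n) :
    ∃ w : Rn n, w ≠ 0 ∧ inner ℝ x w = 0 ∧ inner ℝ y w = 0 := by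
  have h1 : Submodule.span ℝ {x, y} ≠ ⊤ := by
    intro h
    have h2 := (finrank_span_finset_le_card (R := ℝ) ({x, y} : Finset (Rn n))).trans
      Finset.card_le_two
    rw [Finset.coe_pair, Set.finrank, h, finrank_top, finrank_euclideanSpace_fin] at h2
    omega
  have h2 : (Submodule.span ℝ {x, y})ᗮ ≠ ⊥ := fun h => h1 (Submodule.orthogonal_eq_bot_iff.1 h)
  obtain ⟨w, hw, hw0⟩ := Submodule.exists_mem_ne_zero_of_ne_bot h2
  rw [Submodule.mem_orthogonal] at hw
  exact ⟨w, hw0, hw x (Submodule.subset_span (by simp)), hw y (Submodule.subset_span (by simp))⟩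

theorem gInner_eq_dotProduct (F : Rn n → Rn n → ℝ) (x y u v : Rn n) :
    gInner F x y u v = ∑ i, u i * (fundamental F x y).mulVec v.ofLp i := by
  simp only [gInner, Matrix.mulVec, dotProduct, Finset.mul_sum]
  exact Finset.sum_congr rfl fun i _ => Finset.sum_congr rfl fun j _ => by ring

theorem isUnit_det_of_posDef {F : Rn n → Rn n → ℝ}
    (hpd : ∀ u, u ≠ 0 → 0 < gInner F x y u u) : IsUnit (fundamental F x y).det := by
  rw [isUnit_iff_ne_zero]
  intro h
  obtain ⟨v, hv, hv'⟩ := Matrix.exists_mulVec_eq_zero_iff.2 h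
  have h1 := hpd (WithLp.toLp 2 v) (by simpa using hv)
  rw [gInner_eq_dotProduct] at h1
  simp [hv'] at h1

/-- It is enough to check a proposed spray against the lowered equations; the inverse of the
fundamental tensor need not be computed. -/
theorem spray_eq_of_mulVec {F : Rn n → Rn n → ℝ} (hdet : IsUnit (fundamental F x y).det)
    (G : Fin n → ℝ) (hG : ∀ l, ∑ j, fundamental F x y l j * G j =
      1 / 4 * ((∑ k, y k * dy l (dx k (sq F)) x y) - dx l (sq F) x y)) (i : Fin n) :
    spray F i x y = G i := by
  have h1 : (fundamental F x y)⁻¹.mulVec ((fundamental F x y).mulVec G) = G := by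
    rw [Matrix.mulVec_mulVec, Matrix.nonsing_inv_mul _ hdet, Matrix.one_mulVec]
  rw [spray, ← congrFun h1 i, Finset.mul_sum]
  refine Finset.sum_congr rfl fun l _ => ?_
  have : (fundamental F x y).mulVec G l = _ := hG l
  rw [this]
  ring

/-- Every tensor to be contracted below is, as a function of `j`, a combination of two fixed vectors
and two Kronecker deltas. -/
theorem sum_mul_lin (v a b : Fin n → ℝ) (A B C D : ℝ) (i k : Fin n) :
    ∑ j, v j * (A * a j + B * b j + C * (if i = j then 1 else 0) + D * (if j = k then 1 else 0)) =
      A * ∑ j, v j * a j + B * ∑ j, v j * b j + C * v i + D * v k := by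
  have h1 : ∑ j, v j * (if i = j then (1 : ℝ) else 0) = v i := by simp
  have h2 : ∑ j, v j * (if j = k then (1 : ℝ) else 0) = v k := by simp
  trans A * ∑ j, v j * a j + B * ∑ j, v j * b j + C * ∑ j, v j * (if i = j then (1 : ℝ) else 0) +
    D * ∑ j, v j * (if j = k then (1 : ℝ) else 0)
  swap
  · rw [h1, h2]
  simp only [Finset.mul_sum, ← Finset.sum_add_distrib]
  exact Finset.sum_congr rfl fun j _ => by ring

theorem sum_lin_mul_fst (a b : Fin n → ℝ) (p q : ℝ) :
    ∑ j, (p * b j + q * a j) * a j = p * ∑ j, a j * b j + q * ∑ j, a j * a j := by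
  simp only [Finset.mul_sum, ← Finset.sum_add_distrib]
  exact Finset.sum_congr rfl fun j _ => by ring

theorem sum_lin_mul_snd (a b : Fin n → ℝ) (p q : ℝ) :
    ∑ j, (p * b j + q * a j) * b j = p * ∑ j, b j * b j + q * ∑ j, a j * b j := by
  simp only [Finset.mul_sum, ← Finset.sum_add_distrib]
  exact Finset.sum_congr rfl fun j _ => by ring

/-- The geodesic coefficients of a spherically symmetric metric. -/
theorem spray_eq (hI : IsOpen I) (hφ : SmoothOn (region I) φ) (h : Adm I x y)
    (h0 : lift φ x y ≠ 0) (hd : lift (qDen φ) x y ≠ 0)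
    (hdet : IsUnit (fundamental (sphMetric φ) x y).det) (i : Fin n) :
    spray (sphMetric φ) i x y =
      ‖y‖ * lift (P φ) x y * y i + ‖y‖ * ‖y‖ * lift (Q φ) x y * x i := by
  refine spray_eq_of_mulVec hdet (fun i =>
    ‖y‖ * lift (P φ) x y * y i + ‖y‖ * ‖y‖ * lift (Q φ) x y * x i) (fun l => ?_) i
  have hΩ := isOpen_region hI
  have hx := h.ne_left
  have hy := h.ne_right
  have h1 := hasDy_lift hΩ hφ hy h.mem_region
  have h2 := hasDy_lift hΩ (hφ.smoothOn_ps hΩ) hy h.mem_region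
  have h3 := hasDy_lift hΩ (hφ.smoothOn_pr hΩ) hy h.mem_region
  have hu := hasDy_norm (x := x) hy
  have h4 : ∀ k, dy l (dx k (sq (sphMetric φ))) x y = _ := fun k =>
    (((hasDy_const (x := x) (y := y) 2).mul (h1.mul (hu.mul
      (((hu.mul h3).mul (hasDy_of_fst (y := y) fun x => x k / ‖x‖)).add
        (h2.mul (hasDy_coord (x := x) (y := y) k)))))).congr
    (f₁ := dx k (sq (sphMetric φ))) (fun x y hz => (hasDx_sq hI hφ hz).eq k) h).eq l
  have e1 : ∑ k, x k * x k = ‖x‖ ^ 2 := by rw [← inner_eq_sum, real_inner_self_eq_norm_sq]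
  have e2 : ∑ k, y k * y k = ‖y‖ ^ 2 := by rw [← inner_eq_sum, real_inner_self_eq_norm_sq]
  have e3 : ∑ k, x k * y k = sArg x y * ‖y‖ := by rw [← inner_eq_sum, h.inner_eq]
  simp only [h4, fundamental_eq hI hφ h, (hasDx_sq hI hφ h).eq l]
  have hL : ∀ a b c d p q : ℝ, ∑ k, (a * (if l = k then 1 else 0) + b * (x l * y k + y l * x k)
      - c * (y l * y k) + d * (x l * x k)) * (p * y k + q * x k) =
      a * (p * y l + q * x l) + b * (x l * (p * ‖y‖ ^ 2 + q * (sArg x y * ‖y‖)) +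
        y l * (p * (sArg x y * ‖y‖) + q * ‖x‖ ^ 2)) -
      c * (y l * (p * ‖y‖ ^ 2 + q * (sArg x y * ‖y‖))) +
      d * (x l * (p * (sArg x y * ‖y‖) + q * ‖x‖ ^ 2)) := by
    intro a b c d p q
    rw [← e1, ← e2, ← e3]
    have h1 := sum_mul_lin (fun k => p * y k + q * x k) x.ofLp y.ofLp (b * y l + d * x l)
      (b * x l - c * y l) a 0 l l
    rw [sum_lin_mul_fst, sum_lin_mul_snd] at h1
    refine (Finset.sum_congr rfl fun k _ => ?_).trans (h1.trans ?_) <;> ring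
  rw [hL]
  have hF : ∀ (E : Fin n → ℝ) (p q t : ℝ),
      (∀ k, E k = p * (x k / ‖x‖) + q * y k + t * (if k = l then 1 else 0)) →
      ∑ k, y k * E k = p * (sArg x y * ‖y‖) / ‖x‖ + q * ‖y‖ ^ 2 + t * y l := by
    intro E p q t hE
    simp only [hE]
    rw [← e2, ← e3]
    have h1 := sum_mul_lin y.ofLp x.ofLp y.ofLp (p / ‖x‖) q 0 t l l
    rw [show ∑ k, x k * y k = ∑ k, y k * x k from
      Finset.sum_congr rfl fun k _ => mul_comm _ _]
    refine (Finset.sum_congr rfl fun k _ => ?_).trans (h1.trans ?_) <;> ring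
  have hP := P_spec (φ := φ) (r := ‖x‖) (s := sArg x y) h.norm_left_pos.ne' h0
  have hQ := Q_spec (φ := φ) (r := ‖x‖) (s := sArg x y) h.norm_left_pos.ne' hd
  have hr := h.norm_left_pos.ne'
  have hu := h.norm_right_pos.ne'
  simp only [lift, fundDiag, fundMixed, fundRadial, qDen] at hQ hP ⊢
  generalize φ ‖x‖ (sArg x y) = f at *
  generalize ps φ ‖x‖ (sArg x y) = fs at *
  generalize pr φ ‖x‖ (sArg x y) = fr at *
  generalize ps (ps φ) ‖x‖ (sArg x y) = fss at *
  generalize ps (pr φ) ‖x‖ (sArg x y) = frs at *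
  generalize P φ ‖x‖ (sArg x y) = p at *
  generalize Q φ ‖x‖ (sArg x y) = q at *
  generalize sArg x y = s at *
  generalize ‖x‖ = r at *
  generalize ‖y‖ = u at *
  rw [hF _
    (2 * ((fs * (x l / u - s * y l / u ^ 2) * u + f * (y l / u)) * (u * fr) +
      f * u * ((y l / u) * fr + u * (frs * (x l / u - s * y l / u ^ 2)))))
    (2 * ((fs * (x l / u - s * y l / u ^ 2) * u + f * (y l / u)) * fs +
      f * u * (fss * (x l / u - s * y l / u ^ 2)))) (2 * f * u * fs) fun k => by ring]
  clear hF hL h4 h1 h2 h3 e1 e2 e3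
  field_simp
  -- The covector `u x - s y` annihilates `y`. Its coefficient is governed by `φ · hQ - φ_s · hP`,
  -- and the remaining multiple of `y` by `φ · hP`.
  linear_combination (2 * u * x l - 2 * s * y l) * (f * hQ - fs * hP) - 2 * y l * f * hP

end Spray

/-! ### The Riemann curvature of a spherically symmetric spray. -/

section Curvature

variable {n : ℕ} {I : Set ℝ} {p q : ℝ → ℝ → ℝ} {F : Rn n → Rn n → ℝ} {x y : Rn n}

/-- The geodesic coefficients of `F` are `|y| p yⁱ + |y|² q xⁱ`. -/
def IsSphSpray (I : Set ℝ) (p q : ℝ → ℝ → ℝ) (F : Rn n → Rn n → ℝ) : Prop :=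
  ∀ (i : Fin n) (x y : Rn n), Adm I x y → spray F i x y =
    ‖y‖ * lift p x y * y i + ‖y‖ * ‖y‖ * lift q x y * x i

theorem IsSphSpray.hasDx (hS : IsSphSpray I p q F) (hI : IsOpen I) (hp : SmoothOn (region I) p)
    (hq : SmoothOn (region I) q) (h : Adm I x y) (i : Fin n) :
    HasDx (spray F i) x y fun j =>
      (‖y‖ * y i) * (lift (pr p) x y * (x j / ‖x‖)) + lift (ps p) x y * (y i * y j) +
        (‖y‖ * ‖y‖) * (x i * (lift (pr q) x y * (x j / ‖x‖))) +
        ‖y‖ * (x i * (lift (ps q) x y * y j)) +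
        (‖y‖ * ‖y‖) * lift q x y * (if i = j then 1 else 0) := by
  have hΩ := isOpen_region hI
  have hu := hasDx_of_snd (x := x) (y := y) fun y => ‖y‖
  have h1 := hasDx_lift hΩ hp h.ne_left h.mem_region
  have h2 := hasDx_lift hΩ hq h.ne_left h.mem_region
  refine HasDx.congr hI (HasDx.of_eq (((hu.mul h1).mul (hasDx_of_snd fun y => y i)).add
    (((hu.mul hu).mul h2).mul (hasDx_coord i))) fun j => ?_) (hS i) h
  have := h.norm_right_pos.ne'
  simp only [lift]
  field_simp
  ring

theorem IsSphSpray.hasDy (hS : IsSphSpray I p q F) (hI : IsOpen I) (hp : SmoothOn (region I) p)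
    (hq : SmoothOn (region I) q) (h : Adm I x y) (i : Fin n) :
    HasDy (spray F i) x y fun j =>
      ‖y‖ * lift p x y * (if i = j then 1 else 0) +
        y i * ((lift p x y - sArg x y * lift (ps p) x y) * (y j * ‖y‖⁻¹) + lift (ps p) x y * x j) +
        x i * ((2 * lift q x y - sArg x y * lift (ps q) x y) * y j +
          ‖y‖ * (lift (ps q) x y * x j)) := by
  have hΩ := isOpen_region hI
  have hu := hasDy_norm (x := x) h.ne_right
  have h1 := hasDy_lift hΩ hp h.ne_right h.mem_region
  have h2 := hasDy_lift hΩ hq h.ne_right h.mem_region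
  refine HasDy.congr (HasDy.of_eq (((hu.mul h1).mul (hasDy_coord i)).add
    (((hu.mul hu).mul h2).mul (hasDy_of_fst fun x => x i))) fun j => ?_) (hS i) h
  have := h.norm_right_pos.ne'
  simp only [lift]
  field_simp
  ring

theorem hasDy_inv_norm (hy : y ≠ 0) :
    HasDy (fun _ y => ‖y‖⁻¹) x y fun i => -(y i) / ‖y‖ ^ 3 := by
  have h0 : ‖y‖ ≠ 0 := norm_ne_zero_iff.2 hy
  refine ⟨_, (hasDerivAt_inv h0).comp_hasFDerivAt y (hasFDerivAt_norm_of_ne hy), fun i => ?_⟩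
  simp [EuclideanSpace.inner_single_right]
  field_simp

theorem IsSphSpray.dy_dx (hS : IsSphSpray I p q F) (hI : IsOpen I) (hp : SmoothOn (region I) p)
    (hq : SmoothOn (region I) q) (h : Adm I x y) (i j k : Fin n) :
    dy k (dx j (spray F i)) x y =
      (‖y‖ * (if i = k then 1 else 0) * lift (pr p) x y / ‖x‖ +
        y i / ‖x‖ * (y k / ‖y‖ * lift (pr p) x y +
          lift (ps (pr p)) x y * (x k - sArg x y * y k / ‖y‖)) +
        x i / ‖x‖ * (2 * y k * lift (pr q) x y +
          lift (ps (pr q)) x y * (‖y‖ * x k - sArg x y * y k))) * x j +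
      ((if i = k then 1 else 0) * lift (ps p) x y +
        y i * lift (ps (ps p)) x y * (x k / ‖y‖ - sArg x y * y k / ‖y‖ ^ 2) +
        x i * (y k / ‖y‖ * lift (ps q) x y +
          lift (ps (ps q)) x y * (x k - sArg x y * y k / ‖y‖))) * y j +
      (2 * y k * lift q x y + lift (ps q) x y * (‖y‖ * x k - sArg x y * y k)) *
        (if i = j then 1 else 0) +
      (y i * lift (ps p) x y + ‖y‖ * x i * lift (ps q) x y) * (if j = k then 1 else 0) := by
  have hΩ := isOpen_region hI
  have hy := h.ne_right
  have hz := h.mem_region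
  have hu := hasDy_norm (x := x) hy
  have h1 := hasDy_lift hΩ (hp.smoothOn_pr hΩ) hy hz
  have h2 := hasDy_lift hΩ (hp.smoothOn_ps hΩ) hy hz
  have h3 := hasDy_lift hΩ (hq.smoothOn_pr hΩ) hy hz
  have h4 := hasDy_lift hΩ (hq.smoothOn_ps hΩ) hy hz
  have h5 := hasDy_lift hΩ hq hy hz
  have hyc := fun i => hasDy_coord (x := x) (y := y) i
  have hxj := hasDy_of_fst (x := x) (y := y) fun x => x j / ‖x‖
  have hxi := hasDy_of_fst (x := x) (y := y) fun x => x i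
  have := HasDy.congr (f₁ := dx j (spray F i)) (((((((hu.mul (hyc i)).mul (h1.mul hxj))).add
    (h2.mul ((hyc i).mul (hyc j)))).add ((hu.mul hu).mul (hxi.mul (h3.mul hxj)))).add
    (hu.mul (hxi.mul (h4.mul (hyc j))))).add (((hu.mul hu).mul h5).mul
      (hasDy_const (if i = j then 1 else 0))))
    (fun x y hz => (hS.hasDx hI hp hq hz i).eq j) h
  rw [this.eq k]
  have := h.norm_right_pos.ne'
  have := h.norm_left_pos.ne'
  simp only [lift]
  field_simp
  ring

theorem ps_sub_mul_ps {Ω : Set (ℝ × ℝ)} (hΩ : IsOpen Ω) (hp : SmoothOn Ω p) {r s : ℝ}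
    (hz : (r, s) ∈ Ω) : ps (fun r s => p r s - s * ps p r s) r s = -s * ps (ps p) r s := by
  have h1 := (hp.hasDerivAt_snd hΩ hz).sub
    ((hasDerivAt_id' s).mul ((hp.smoothOn_ps hΩ).hasDerivAt_snd hΩ hz))
  rw [ps, HasDerivAt.deriv (f := fun s => p r s - s * ps p r s) h1]
  ring

theorem IsSphSpray.dy_dy (hS : IsSphSpray I p q F) (hI : IsOpen I) (hp : SmoothOn (region I) p)
    (hq : SmoothOn (region I) q) (h : Adm I x y) (i j k : Fin n) :
    dy k (dy j (spray F i)) x y =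
      ((if i = k then 1 else 0) * lift (ps p) x y +
        y i * lift (ps (ps p)) x y * (x k / ‖y‖ - sArg x y * y k / ‖y‖ ^ 2) +
        x i * (y k / ‖y‖ * lift (ps q) x y +
          lift (ps (ps q)) x y * (x k - sArg x y * y k / ‖y‖))) * x j +
      ((if i = k then 1 else 0) * (lift p x y - sArg x y * lift (ps p) x y) / ‖y‖ -
        y i * ((lift p x y - sArg x y * lift (ps p) x y) * y k / ‖y‖ ^ 3 +
          sArg x y * lift (ps (ps p)) x y / ‖y‖ * (x k / ‖y‖ - sArg x y * y k / ‖y‖ ^ 2)) +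
        x i * ((lift (ps q) x y - sArg x y * lift (ps (ps q)) x y) *
          (x k / ‖y‖ - sArg x y * y k / ‖y‖ ^ 2))) * y j +
      (lift p x y * y k / ‖y‖ + lift (ps p) x y * (x k - sArg x y * y k / ‖y‖)) *
        (if i = j then 1 else 0) +
      (y i * (lift p x y - sArg x y * lift (ps p) x y) / ‖y‖ +
        x i * (2 * lift q x y - sArg x y * lift (ps q) x y)) * (if j = k then 1 else 0) := by
  have hΩ := isOpen_region hI
  have hy := h.ne_right
  have hz := h.mem_region
  have hu := hasDy_norm (x := x) hy
  have hv := hasDy_inv_norm (x := x) hy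
  have hs := hasDy_sArg (x := x) hy
  have h1 := hasDy_lift hΩ hp hy hz
  have h2 := hasDy_lift hΩ (hp.smoothOn_ps hΩ) hy hz
  have h4 := hasDy_lift hΩ (hq.smoothOn_ps hΩ) hy hz
  have h5 := hasDy_lift hΩ hq hy hz
  have hyc := fun i => hasDy_coord (x := x) (y := y) i
  have hxc := fun i => hasDy_of_fst (x := x) (y := y) fun x => x i
  have := HasDy.congr (f₁ := dy j (spray F i))
    ((((hu.mul h1).mul (hasDy_const (if i = j then 1 else 0))).add
      ((hyc i).mul (((h1.sub (hs.mul h2)).mul ((hyc j).mul hv)).add (h2.mul (hxc j))))).add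
      ((hxc i).mul (((((hasDy_const 2).mul h5).sub (hs.mul h4)).mul (hyc j)).add
        (hu.mul (h4.mul (hxc j))))))
    (fun x y hz => (hS.hasDy hI hp hq hz i).eq j) h
  rw [this.eq k]
  have := h.norm_right_pos.ne'
  simp only [lift]
  field_simp
  ring

theorem sum_mul_eq {v E a b : Fin n → ℝ} {i k : Fin n} (A B C D : ℝ)
    (hE : ∀ j, E j = A * a j + B * b j + C * (if i = j then 1 else 0) +
      D * (if j = k then 1 else 0)) :
    ∑ j, v j * E j = A * ∑ j, v j * a j + B * ∑ j, v j * b j + C * v i + D * v k := by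
  simp only [hE, sum_mul_lin]

theorem sum_mul_eq' {v E : Fin n → ℝ} {i k : Fin n} (A B C D a b : ℝ)
    (h1 : ∑ j, v j * x j = a) (h2 : ∑ j, v j * y j = b)
    (hE : ∀ j, E j = A * x j + B * y j + C * (if i = j then 1 else 0) +
      D * (if j = k then 1 else 0)) :
    ∑ j, v j * E j = A * a + B * b + C * v i + D * v k := by
  rw [sum_mul_eq A B C D hE, h1, h2]

/-- The coefficient of `δⁱₖ` in `Rⁱₖ / |y|²`. -/
def curvDiag (p q : ℝ → ℝ → ℝ) (r s : ℝ) : ℝ :=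
  p r s ^ 2 - 1 / r * (s * pr p r s + r * ps p r s) +
    2 * q r s * (1 + s * p r s + (r ^ 2 - s ^ 2) * ps p r s)

/-- The coefficient of `xⁱ xₖ` in `Rⁱₖ / |y|²`. -/
def curvRadial (q : ℝ → ℝ → ℝ) (r s : ℝ) : ℝ :=
  2 * q r s * (2 * q r s - s * ps q r s) +
    1 / r * (2 * pr q r s - s * ps (pr q) r s - r * ps (ps q) r s) +
    (r ^ 2 - s ^ 2) * (2 * q r s * ps (ps q) r s - ps q r s ^ 2)

/-- The Riemann curvature of a spherically symmetric spray. -/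
theorem IsSphSpray.riemann_eq (hS : IsSphSpray I p q F) (hI : IsOpen I)
    (hp : SmoothOn (region I) p) (hq : SmoothOn (region I) q) (h : Adm I x y) :
    ∃ a b : ℝ, ∀ i k, riemann F i k x y =
      ‖y‖ ^ 2 * lift (curvDiag p q) x y * (if i = k then 1 else 0) +
      ‖y‖ * lift (curvRadial q) x y * (‖y‖ * x k - sArg x y * y k) * x i +
      (a * x k + b * y k) * y i := by
  have hu0 := h.norm_right_pos.ne'
  have hr0 := h.norm_left_pos.ne'
  have e1 : ∑ k, x k * x k = ‖x‖ ^ 2 := by rw [← inner_eq_sum, real_inner_self_eq_norm_sq]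
  have e2 : ∑ k, y k * y k = ‖y‖ ^ 2 := by rw [← inner_eq_sum, real_inner_self_eq_norm_sq]
  have e3 : ∑ k, x k * y k = sArg x y * ‖y‖ := by rw [← inner_eq_sum, h.inner_eq]
  have e3' : ∑ k, y k * x k = sArg x y * ‖y‖ := by
    rw [← e3]; exact Finset.sum_congr rfl fun k _ => mul_comm _ _
  -- The coefficients of `yⁱ` are written out only to verify the identity; the flag curvature
  -- computations work for arbitrary `a` and `b`.
  obtain ⟨a, ha⟩ : ∃ a, a = ‖y‖ * (2 * lift (pr p) x y / ‖x‖ -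
    (sArg x y * lift (ps (pr p)) x y / ‖x‖ + lift (ps (ps p)) x y + lift (ps q) x y) +
    2 * (lift p x y * lift (ps p) x y + (lift p x y - sArg x y * lift (ps p) x y) * lift q x y +
      lift (ps (ps p)) x y * (‖x‖ ^ 2 - sArg x y ^ 2) * lift q x y) -
    3 * lift p x y * lift (ps p) x y - ((lift p x y - sArg x y * lift (ps p) x y) * sArg x y +
      lift (ps p) x y * ‖x‖ ^ 2) * lift (ps q) x y) := ⟨_, rfl⟩
  obtain ⟨b, hb⟩ : ∃ b, b = 2 * lift (ps p) x y -
    (sArg x y / ‖x‖ * (lift (pr p) x y - sArg x y * lift (ps (pr p)) x y) + lift (ps p) x y -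
      sArg x y * lift (ps (ps p)) x y + 2 * lift q x y - sArg x y * lift (ps q) x y) +
    2 * (lift p x y ^ 2 - sArg x y * lift p x y * lift (ps p) x y -
      sArg x y * lift q x y * ((lift p x y - sArg x y * lift (ps p) x y) +
        lift (ps (ps p)) x y * (‖x‖ ^ 2 - sArg x y ^ 2))) -
    3 * lift p x y * (lift p x y - sArg x y * lift (ps p) x y) -
    ((lift p x y - sArg x y * lift (ps p) x y) * sArg x y +
      lift (ps p) x y * ‖x‖ ^ 2) * (2 * lift q x y - sArg x y * lift (ps q) x y) := ⟨_, rfl⟩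
  refine ⟨a, b, fun i k => ?_⟩
  have hG : ∀ j, spray F j x y = _ := fun j => hS j x y h
  have hX : ∑ j, spray F j x y * x j = ‖y‖ ^ 2 *
      (sArg x y * lift p x y + ‖x‖ ^ 2 * lift q x y) := by
    simp only [hG]
    rw [sum_lin_mul_fst, e1, e3]
    ring
  have hY : ∑ j, spray F j x y * y j = ‖y‖ ^ 3 * (lift p x y + sArg x y * lift q x y) := by
    simp only [hG]
    rw [sum_lin_mul_snd, e2, e3]
    ring
  have h1 := (hS.hasDx hI hp hq h i).eq k
  have h2 : ∑ j, y j * dy k (dx j (spray F i)) x y = _ :=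
    sum_mul_eq' _ _ _ _ _ _ e3' e2 fun j => hS.dy_dx hI hp hq h i j k
  have h3 : ∑ j, spray F j x y * dy k (dy j (spray F i)) x y = _ :=
    sum_mul_eq' _ _ _ _ _ _ hX hY fun j => hS.dy_dy hI hp hq h i j k
  have hD : ∀ i j, dy j (spray F i) x y = _ := fun i j => (hS.hasDy hI hp hq h i).eq j
  have hV : ∀ v : Fin n → ℝ, ∀ a b : ℝ, ∑ j, v j * x j = a → ∑ j, v j * y j = b →
      ∑ j, dy j (spray F i) x y * v j =
      (y i * lift (ps p) x y + x i * (‖y‖ * lift (ps q) x y)) * a +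
        (y i * ((lift p x y - sArg x y * lift (ps p) x y) * ‖y‖⁻¹) +
          x i * (2 * lift q x y - sArg x y * lift (ps q) x y)) * b +
        (‖y‖ * lift p x y) * v i := by
    intro v a b ha hb
    have := sum_mul_eq' (k := i) (y i * lift (ps p) x y + x i * (‖y‖ * lift (ps q) x y))
      (y i * ((lift p x y - sArg x y * lift (ps p) x y) * ‖y‖⁻¹) +
          x i * (2 * lift q x y - sArg x y * lift (ps q) x y)) (‖y‖ * lift p x y) 0 _ _ ha hb
      (E := fun j => dy j (spray F i) x y) fun j => by rw [hD]; ring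
    rw [zero_mul, add_zero] at this
    rw [← this]
    exact Finset.sum_congr rfl fun j _ => mul_comm _ _
  have h4 : ∑ j, dy j (spray F i) x y * dy k (spray F j) x y = _ :=
    sum_mul_eq' (i := i) (k := k)
      ((2 * lift q x y - sArg x y * lift (ps q) x y) * y k + ‖y‖ * (lift (ps q) x y * x k))
      ((lift p x y - sArg x y * lift (ps p) x y) * (y k * ‖y‖⁻¹) + lift (ps p) x y * x k)
      0 (‖y‖ * lift p x y) _ _ (hV _ _ _ e1 e3) (hV _ _ _ e3' e2) fun j => by rw [hD]; ring
  rw [riemann, h1, h2, h3, h4, hD i k, hG i, hG k, ha, hb]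
  clear ha hb h1 h2 h3 h4 hD hG hX hY hV e1 e2 e3 e3'
  simp only [lift, curvDiag, curvRadial]
  generalize p ‖x‖ (sArg x y) = f at *
  generalize ps p ‖x‖ (sArg x y) = fs at *
  generalize pr p ‖x‖ (sArg x y) = fr at *
  generalize ps (ps p) ‖x‖ (sArg x y) = fss at *
  generalize ps (pr p) ‖x‖ (sArg x y) = frs at *
  generalize q ‖x‖ (sArg x y) = g at *
  generalize ps q ‖x‖ (sArg x y) = gs at *
  generalize pr q ‖x‖ (sArg x y) = gr at *
  generalize ps (ps q) ‖x‖ (sArg x y) = gss at *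
  generalize ps (pr q) ‖x‖ (sArg x y) = grs at *
  generalize sArg x y = s at *
  generalize ‖x‖ = r at *
  generalize ‖y‖ = u at *
  generalize (if i = k then (1 : ℝ) else 0) = d
  generalize x i = xi, x k = xk, y i = yi, y k = yk
  field_simp
  ring

end Curvature

/-! ### Constant flag curvature read on two kinds of flags. -/

section Flag

variable {n : ℕ} {I : Set ℝ} {p q φ : ℝ → ℝ → ℝ} {F : Rn n → Rn n → ℝ} {x y : Rn n}

theorem Adm.ne_smul (h : Adm I x y) (t : ℝ) : x ≠ t • y := by
  intro h1
  have h2 := h.2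
  rw [h1, inner_smul_left, norm_smul, real_inner_self_eq_norm_sq] at h2
  simp [abs_mul] at h2
  nlinarith

theorem Adm.linearIndependent (h : Adm I x y) (t : ℝ) : LinearIndependent ℝ ![y, x + t • y] := by
  rw [LinearIndependent.pair_iff]
  intro a b hab
  have hb : b = 0 := by
    by_contra hb
    refine h.ne_smul (-(a / b + t)) ?_
    have h1 : b • x = b • (-(a / b + t)) • y := by
      have h2 : b • (-(a / b + t)) • y = -(a • y + (b * t) • y) := by
        rw [smul_smul, ← add_smul, ← neg_smul]
        congr 1
        field_simp
      rw [h2]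
      rw [smul_add, smul_smul] at hab
      rw [eq_neg_iff_add_eq_zero, ← hab]
      abel
    exact smul_right_injective _ hb h1
  subst hb
  simpa [h.ne_right] using hab

theorem gInner_add_smul_left (F : Rn n → Rn n → ℝ) (x y u v w : Rn n) (a b : ℝ) :
    gInner F x y (a • u + b • v) w = a * gInner F x y u w + b * gInner F x y v w := by
  simp only [gInner, Finset.mul_sum, ← Finset.sum_add_distrib]
  refine Finset.sum_congr rfl fun i _ => Finset.sum_congr rfl fun j _ => ?_
  simp
  ring

theorem gInner_add_smul_right (F : Rn n → Rn n → ℝ) (x y u v w : Rn n) (a b : ℝ) :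
    gInner F x y w (a • u + b • v) = a * gInner F x y w u + b * gInner F x y w v := by
  simp only [gInner, Finset.mul_sum, ← Finset.sum_add_distrib]
  refine Finset.sum_congr rfl fun i _ => Finset.sum_congr rfl fun j _ => ?_
  simp
  ring

theorem gInner_comm (hI : IsOpen I) (hφ : SmoothOn (region I) φ) (h : Adm I x y) (v w : Rn n) :
    gInner (sphMetric φ) x y v w = gInner (sphMetric φ) x y w v := by
  rw [gInner_eq hI hφ h, gInner_eq hI hφ h, real_inner_comm]
  ring

theorem riemannMap_eq {A B C a b : ℝ}
    (hR : ∀ i k, riemann F i k x y = A * (if i = k then 1 else 0) +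
      (B * x k + C * y k) * x i + (a * x k + b * y k) * y i) (v : Rn n) :
    riemannMap F x y v = A • v + (B * inner ℝ x v + C * inner ℝ y v) • x +
      (a * inner ℝ x v + b * inner ℝ y v) • y := by
  ext i
  simp only [riemannMap, hR, inner_eq_sum]
  have h1 : ∑ k, (if i = k then (1 : ℝ) else 0) * v k = v i := by simp
  simp only [PiLp.add_apply, PiLp.smul_apply, smul_eq_mul]
  rw [← h1]
  simp only [add_mul, mul_assoc, Finset.sum_add_distrib, ← Finset.mul_sum, Finset.sum_mul]
  simp only [Finset.mul_sum, ← Finset.sum_add_distrib]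
  exact Finset.sum_congr rfl fun j _ => by ring

/-- Constant flag curvature of the flags with edge orthogonal to `x` and `y`. -/
theorem curvDiag_eq (hn : 3 ≤ n) (hI : IsOpen I) (hφ : SmoothOn (region I) φ) (h : Adm I x y)
    {A B C a b : ℝ}
    (hR : ∀ i k, riemann (sphMetric φ) i k x y = A * (if i = k then 1 else 0) +
      (B * x k + C * y k) * x i + (a * x k + b * y k) * y i) {K : ℝ} (hK : K ≠ 0)
    (hc : ∀ u, LinearIndependent ℝ ![y, u] → flagCurvature (sphMetric φ) x y u = K) :
    A = K * (‖y‖ ^ 2 * lift φ x y ^ 2) := by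
  obtain ⟨w, hw, hxw, hyw⟩ := exists_orthogonal hn x y
  have hli : LinearIndependent ℝ ![y, w] := by
    refine linearIndependent_of_ne_zero_of_inner_eq_zero ?_ ?_
    · intro i; fin_cases i
      · exact h.ne_right
      · exact hw
    · intro i j hij; fin_cases i <;> fin_cases j <;> simp_all [real_inner_comm]
  have h1 := hc w hli
  have h2 : riemannMap (sphMetric φ) x y w = A • w + (0 : ℝ) • x := by
    rw [riemannMap_eq hR, hxw, hyw]
    simp
  rw [flagCurvature, h2, gInner_add_smul_left, gInner_left hI hφ h y, gInner_left hI hφ h w,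
    hxw, hyw, real_inner_self_eq_norm_sq, h.inner_eq] at h1
  -- A vanishing denominator would make the quotient `0` by convention, so `K ≠ 0` shows that the
  -- flag is nondegenerate.
  have h3 := fun h0 => hK (h1.symm.trans (div_eq_zero_iff.2 (Or.inr h0)))
  rw [div_eq_iff h3] at h1
  have h4 : gInner (sphMetric φ) x y w w ≠ 0 := fun h0 => h3 (by rw [h0]; ring)
  apply mul_right_cancel₀ h4
  linear_combination h1

/-- Constant flag curvature of the flags in the plane of `x` and `y`. -/
theorem curvRadial_eq (hI : IsOpen I) (hφ : SmoothOn (region I) φ) (h : Adm I x y)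
    (h0 : lift φ x y ≠ 0)
    {A B C a b : ℝ}
    (hR : ∀ i k, riemann (sphMetric φ) i k x y = A * (if i = k then 1 else 0) +
      (B * x k + C * y k) * x i + (a * x k + b * y k) * y i)
    (hBC : B * (sArg x y * ‖y‖) + C * ‖y‖ ^ 2 = 0) {K : ℝ} (hK : K ≠ 0)
    (hc : ∀ u, LinearIndependent ℝ ![y, u] → flagCurvature (sphMetric φ) x y u = K) :
    A + (B * ‖x‖ ^ 2 + C * (sArg x y * ‖y‖)) = K * (‖y‖ ^ 2 * lift φ x y ^ 2) := by
  obtain ⟨X, hX⟩ : ∃ X, X = gInner (sphMetric φ) x y x x := ⟨_, rfl⟩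
  obtain ⟨Y, hY⟩ : ∃ Y, Y = gInner (sphMetric φ) x y y y := ⟨_, rfl⟩
  obtain ⟨Z, hZ⟩ : ∃ Z, Z = gInner (sphMetric φ) x y x y := ⟨_, rfl⟩
  have hZ' : Z = gInner (sphMetric φ) x y y x := hZ.trans (gInner_comm hI hφ h x y)
  have hYv : Y = ‖y‖ ^ 2 * lift φ x y ^ 2 := by
    rw [hY, gInner_left hI hφ h y, real_inner_self_eq_norm_sq, h.inner_eq]
    ring
  obtain ⟨L, hL⟩ : ∃ L, L = A + (B * ‖x‖ ^ 2 + C * (sArg x y * ‖y‖)) := ⟨_, rfl⟩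
  obtain ⟨m, hm⟩ : ∃ m, m = A + (a * (sArg x y * ‖y‖) + b * ‖y‖ ^ 2) := ⟨_, rfl⟩
  obtain ⟨μ, hμ⟩ : ∃ μ, μ = a * ‖x‖ ^ 2 + b * (sArg x y * ‖y‖) := ⟨_, rfl⟩
  -- All edges `x + t y` span the same flag with `y`, so the identity holds as a polynomial in `t`.
  -- By `hBC`, `R_y(y) = m y`.
  have key : ∀ t : ℝ, X * Y - Z ^ 2 ≠ 0 ∧
      L * X + L * t * Z + (μ + t * m) * Z + (μ + t * m) * t * Y = K * (X * Y - Z ^ 2) := by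
    intro t
    have h1 := hc _ (h.linearIndependent t)
    have h2 : riemannMap (sphMetric φ) x y (x + t • y) = L • x + (μ + t * m) • y := by
      rw [riemannMap_eq hR]
      simp only [inner_add_right, inner_smul_right, real_inner_self_eq_norm_sq,
        real_inner_comm x y, h.inner_eq]
      have e : B * (‖x‖ ^ 2 + t * (sArg x y * ‖y‖)) + C * (sArg x y * ‖y‖ + t * ‖y‖ ^ 2) =
          L - A := by rw [hL]; linear_combination t * hBC
      rw [e, hm, hμ]
      module
    have h3 : x + t • y = (1 : ℝ) • x + t • y := by simp
    rw [flagCurvature, h2, h3] at h1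
    simp only [gInner_add_smul_left, gInner_add_smul_right, ← hX, ← hY, ← hZ, ← hZ'] at h1
    have h4 := fun h0 => hK (h1.symm.trans (div_eq_zero_iff.2 (Or.inr h0)))
    rw [div_eq_iff h4] at h1
    refine ⟨fun h0 => h4 (by linear_combination h0), by linear_combination h1⟩
  obtain ⟨hΔ, k0⟩ := key 0
  have k1 := (key 1).2
  have k2 := (key (-1)).2
  have hY0 : Y ≠ 0 := by
    rw [hYv]
    exact mul_ne_zero (pow_ne_zero 2 h.norm_right_pos.ne') (pow_ne_zero 2 h0)
  -- The coefficient of `t²` is `m Y`. Once `m = 0`, the coefficient of `t` gives `L Z + μ Y = 0`,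
  -- which eliminates `μ` from the constant term.
  have hm0 : m = 0 := by
    apply mul_right_cancel₀ hY0
    linear_combination (1 / 2) * k1 + (1 / 2) * k2 - k0
  subst hm0
  rw [← hL, ← hYv]
  apply mul_right_cancel₀ hΔ
  linear_combination Y * k0 - (1 / 2) * Z * (k1 - k2)

end Flag

/-! ### Vanishing Douglas curvature and the quadratic form of `Q`. -/

section Douglas

variable {n : ℕ} {I : Set ℝ} {p q φ : ℝ → ℝ → ℝ} {F : Rn n → Rn n → ℝ} {x y : Rn n}

theorem HasDy.congr_of_left {f f₁ : Rn n → Rn n → ℝ} {A : Fin n → ℝ} (h : HasDy f x y A)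
    (he : ∀ y, Adm I x y → f₁ x y = f x y) (hz : Adm I x y) : HasDy f₁ x y A := by
  obtain ⟨L, h1, h2⟩ := h
  refine ⟨L, h1.congr_of_eventuallyEq ?_, h2⟩
  filter_upwards [hz.eventually_right] with y' hy' using he _ hy'

namespace SmoothOn

variable {Ω : Set (ℝ × ℝ)} {f f₁ f₂ : ℝ → ℝ → ℝ}

theorem add (h₁ : SmoothOn Ω f₁) (h₂ : SmoothOn Ω f₂) : SmoothOn Ω fun r s => f₁ r s + f₂ r s :=
  ContDiffOn.add h₁ h₂

theorem sub (h₁ : SmoothOn Ω f₁) (h₂ : SmoothOn Ω f₂) : SmoothOn Ω fun r s => f₁ r s - f₂ r s :=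
  ContDiffOn.sub h₁ h₂

theorem mul (h₁ : SmoothOn Ω f₁) (h₂ : SmoothOn Ω f₂) : SmoothOn Ω fun r s => f₁ r s * f₂ r s :=
  ContDiffOn.mul h₁ h₂

theorem const (a : ℝ) : SmoothOn Ω fun _ _ => a := contDiffOn_const

theorem arg : SmoothOn Ω fun _ s => s := contDiffOn_snd

theorem weight : SmoothOn Ω fun r s => r ^ 2 - s ^ 2 :=
  (contDiff_fst.pow 2).sub (contDiff_snd.pow 2) |>.contDiffOn

end SmoothOn

/-- The third derivative in direction `i` of a multiple of `yⁱ`, at a point with `xⁱ = yⁱ = 0`. -/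
theorem dy_dy_dy_eq {f : Rn n → Rn n → ℝ} {κ : ℝ → ℝ → ℝ} (hI : IsOpen I)
    (hκ : SmoothOn (region I) κ) {i : Fin n} (hx : x i = 0)
    (hf : ∀ y, Adm I x y → f x y = ‖y‖ * lift κ x y * y i) (h : Adm I x y) (hy : y i = 0) :
    dy i (dy i (dy i f)) x y =
      3 * (lift κ x y - sArg x y * lift (ps κ) x y) / ‖y‖ := by
  have hΩ := isOpen_region hI
  have hm : SmoothOn (region I) fun r s => κ r s - s * ps κ r s :=
    hκ.sub (SmoothOn.arg.mul (hκ.smoothOn_ps hΩ))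
  have hm2 : SmoothOn (region I) fun r s =>
      κ r s - s * ps κ r s + s * ps (fun r s => κ r s - s * ps κ r s) r s :=
    hm.add (SmoothOn.arg.mul (hm.smoothOn_ps hΩ))
  have h1 : ∀ y, Adm I x y → dy i f x y =
      lift (fun r s => κ r s - s * ps κ r s) x y * (y i * (y i * ‖y‖⁻¹)) + ‖y‖ * lift κ x y := by
    intro y h
    have := HasDy.congr_of_left (((hasDy_norm h.ne_right).mul
      (hasDy_lift hΩ hκ h.ne_right h.mem_region)).mul (hasDy_coord i)) hf h
    rw [this.eq i, hx]
    have := h.norm_right_pos.ne'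
    simp only [lift, if_true]
    field_simp
    ring
  have h2 : ∀ y, Adm I x y → dy i (dy i f) x y =
      3 * (lift (fun r s => κ r s - s * ps κ r s) x y * (y i * ‖y‖⁻¹)) -
      lift (fun r s => κ r s - s * ps κ r s + s * ps (fun r s => κ r s - s * ps κ r s) r s) x y *
        (y i * (y i * (y i * (‖y‖⁻¹ * (‖y‖⁻¹ * ‖y‖⁻¹))))) := by
    intro y h
    have hv := hasDy_inv_norm (x := x) h.ne_right
    have := HasDy.congr_of_left (((hasDy_lift hΩ hm h.ne_right h.mem_region).mul
      ((hasDy_coord i).mul ((hasDy_coord i).mul hv))).add ((hasDy_norm h.ne_right).mul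
      (hasDy_lift hΩ hκ h.ne_right h.mem_region))) h1 h
    rw [this.eq i, hx]
    have := h.norm_right_pos.ne'
    simp only [lift, if_true]
    field_simp
    ring
  have hv := hasDy_inv_norm (x := x) h.ne_right
  have := HasDy.congr_of_left (((hasDy_const 3).mul
    ((hasDy_lift hΩ hm h.ne_right h.mem_region).mul ((hasDy_coord i).mul hv))).sub
    ((hasDy_lift hΩ hm2 h.ne_right h.mem_region).mul ((hasDy_coord i).mul ((hasDy_coord i).mul
      ((hasDy_coord i).mul (hv.mul (hv.mul hv))))))) h2 h
  rw [this.eq i, hy]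
  simp [lift]
  ring

theorem IsSphSpray.sum_dy (hS : IsSphSpray I p q F) (hI : IsOpen I) (hp : SmoothOn (region I) p)
    (hq : SmoothOn (region I) q) (h : Adm I x y) :
    ∑ m, dy m (spray F m) x y = ‖y‖ * ((n + 1) * lift p x y + 2 * sArg x y * lift q x y +
      (‖x‖ ^ 2 - sArg x y ^ 2) * lift (ps q) x y) := by
  have e1 : ∑ k, x k * x k = ‖x‖ ^ 2 := by rw [← inner_eq_sum, real_inner_self_eq_norm_sq]
  have e2 : ∑ k, y k * y k = ‖y‖ ^ 2 := by rw [← inner_eq_sum, real_inner_self_eq_norm_sq]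
  have e3 : ∑ k, x k * y k = sArg x y * ‖y‖ := by rw [← inner_eq_sum, h.inner_eq]
  have h1 : ∀ m, dy m (spray F m) x y = ‖y‖ * lift p x y +
      (lift p x y - sArg x y * lift (ps p) x y) * ‖y‖⁻¹ * (y m * y m) +
      (lift (ps p) x y + (2 * lift q x y - sArg x y * lift (ps q) x y)) * (x m * y m) +
      ‖y‖ * lift (ps q) x y * (x m * x m) := by
    intro m
    rw [(hS.hasDy hI hp hq h m).eq m, if_pos rfl]
    ring
  simp only [h1, Finset.sum_add_distrib, ← Finset.mul_sum, e1, e2, e3]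
  have := h.norm_right_pos.ne'
  simp
  field_simp
  ring

/-- The vanishing of a component of the Douglas curvature. -/
theorem IsSphSpray.ps_eq_of_douglas (hS : IsSphSpray I p q F) (hI : IsOpen I)
    (hp : SmoothOn (region I) p) (hq : SmoothOn (region I) q) (h : Adm I x y) {i : Fin n}
    (hx : x i = 0) (hy : y i = 0) (hD : douglas F i i i i x y = 0) :
    lift (ps q) x y = sArg x y * lift (ps (ps q)) x y := by
  have hΩ := isOpen_region hI
  -- Subtracting the trace cancels `p`, and `xⁱ = 0` removes the term with `xⁱ`. What remains of the
  -- `i`-th component is `|y| κ yⁱ` for this `κ`.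
  have hκ : SmoothOn (region I) fun r s => -(1 / ((n : ℝ) + 1)) *
      (2 * (s * q r s) + (r ^ 2 - s ^ 2) * ps q r s) :=
    (SmoothOn.const _).mul (((SmoothOn.const _).mul (SmoothOn.arg.mul hq)).add
      (SmoothOn.weight.mul (hq.smoothOn_ps hΩ)))
  have hn : (n : ℝ) + 1 ≠ 0 := by positivity
  rw [douglas, dy_dy_dy_eq hI hκ hx (fun y h => ?_) h hy] at hD
  · have hz := h.mem_region
    have d1 := ((((hasDerivAt_id' (sArg x y)).mul (hq.hasDerivAt_snd hΩ hz)).const_mul 2).add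
      ((((hasDerivAt_id' (sArg x y)).pow 2).const_sub (‖x‖ ^ 2)).mul
        ((hq.smoothOn_ps hΩ).hasDerivAt_snd hΩ hz))).const_mul (-(1 / ((n : ℝ) + 1)))
    have d2 := (hκ.hasDerivAt_snd hΩ hz).unique d1
    simp only [lift] at hD ⊢
    rw [d2] at hD
    have hw := (sub_pos.2 (sq_lt_of_mem_region hz)).ne'
    have hy0 := h.norm_right_pos.ne'
    rw [div_eq_zero_iff, or_iff_left hy0] at hD
    simp only [Pi.pow_apply] at hD
    push_cast at hD
    -- Up to a constant factor, `κ - s κ_s` equals `(r² - s²) (q_s - s q_ss)`.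
    apply mul_left_cancel₀ hw
    field_simp at hD
    linear_combination (-1 / 3) * hD
  · rw [hS i x y h, hS.sum_dy hI hp hq h, hx]
    simp only [lift]
    field_simp
    ring

end Douglas

/-- Differentiating `q_s = s q_ss` gives `s q_sss = 0`. So `q_sss` vanishes for `s ≠ 0`, and by
continuity at `s = 0`; the equation itself excludes a linear term. -/
theorem SmoothOn.eq_quadratic {I : Set ℝ} (hI : IsOpen I) {q : ℝ → ℝ → ℝ}
    (hq : SmoothOn (region I) q)
    (h : ∀ r s, (r, s) ∈ region I → ps q r s = s * ps (ps q) r s) {r s : ℝ}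
    (hz : (r, s) ∈ region I) : q r s = q r 0 + ps (ps q) r 0 / 2 * s ^ 2 := by
  have hΩ := isOpen_region hI
  have hr := pos_of_mem_region hz
  have hq1 := hq.smoothOn_ps hΩ
  have hq2 := hq1.smoothOn_ps hΩ
  have hq3 := hq2.smoothOn_ps hΩ
  have hmem : ∀ t ∈ Ioo (-r) r, (r, t) ∈ region I := fun t ht => ⟨hz.1, abs_lt.2 ht⟩
  have h3 : ∀ t ∈ Ioo (-r) r, t ≠ 0 → ps (ps (ps q)) r t = 0 := by
    intro t ht ht0
    have hev : ∀ᶠ t' in nhds t, (r, t') ∈ region I :=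
      (Continuous.prodMk_right r).continuousAt.eventually (hΩ.mem_nhds (hmem t ht))
    have d1 := ((hasDerivAt_id' t).mul (hq2.hasDerivAt_snd hΩ (hmem t ht))).congr_of_eventuallyEq
      (f₁ := fun t => ps q r t) (by filter_upwards [hev] with t' ht' using h _ _ ht')
    have d2 := d1.unique (hq1.hasDerivAt_snd hΩ (hmem t ht))
    apply mul_left_cancel₀ ht0
    linear_combination d2
  have h0 : (0 : ℝ) ∈ Ioo (-r) r := ⟨by linarith, hr⟩
  have h3' : ∀ t ∈ Ioo (-r) r, ps (ps (ps q)) r t = 0 := by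
    intro t ht
    by_cases ht0 : t = 0
    · subst ht0
      have hc := (hq3.hasDerivAt_snd hΩ (hmem 0 h0)).continuousAt.tendsto
      refine tendsto_nhds_unique (hc.mono_left (nhdsWithin_le_nhds (s := {0}ᶜ)))
        (tendsto_const_nhds.congr' ?_)
      filter_upwards [self_mem_nhdsWithin, nhdsWithin_le_nhds (Ioo_mem_nhds h0.1 h0.2)] with t ht ht'
      exact (h3 t ht' ht).symm
    · exact h3 t ht ht0
  have hconst : ∀ f : ℝ → ℝ, (∀ t ∈ Ioo (-r) r, HasDerivAt f 0 t) →
      ∀ t ∈ Ioo (-r) r, f t = f 0 := fun f hf t ht =>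
    isOpen_Ioo.is_const_of_deriv_eq_zero isPreconnected_Ioo
      (fun t ht => (hf t ht).differentiableAt.differentiableWithinAt)
      (fun t ht => (hf t ht).deriv) ht h0
  have h2 : ∀ t ∈ Ioo (-r) r, ps (ps q) r t = ps (ps q) r 0 :=
    hconst _ fun t ht => h3' t ht ▸ hq2.hasDerivAt_snd hΩ (hmem t ht)
  have h4 := hconst (fun t => q r t - ps (ps q) r 0 / 2 * t ^ 2) (fun t ht => by
    have d := (hq.hasDerivAt_snd hΩ (hmem t ht)).sub
      (((hasDerivAt_id' t).pow 2).const_mul (ps (ps q) r 0 / 2))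
    refine d.congr_deriv ?_
    rw [h _ _ (hmem t ht), h2 t ht]
    push_cast
    ring) s (abs_lt.1 hz.2)
  linear_combination h4

/-! ### Test vectors in coordinate planes, and the passage from `F` to `φ`. -/

section Domain

variable {n : ℕ} {M : Set (Rn n)} {φ : ℝ → ℝ → ℝ} {x y : Rn n}

theorem IsSymmetricDomain.exists_norm_mem (hM : IsSymmetricDomain M) :
    ∃ J : Set ℝ, IsOpen J ∧ J.OrdConnected ∧ M = {x | ‖x‖ ∈ J} := by
  rcases hM with rfl | ⟨ν, -, rfl⟩ | ⟨ν₂, ν₁, -, -, rfl⟩ | ⟨ν₂, -, rfl⟩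
  · exact ⟨univ, isOpen_univ, ordConnected_univ, by simp⟩
  · exact ⟨Iio ν, isOpen_Iio, ordConnected_Iio, by ext; simp⟩
  · exact ⟨Ioo ν₂ ν₁, isOpen_Ioo, ordConnected_Ioo, by ext; simp [and_comm]⟩
  · exact ⟨Ioi ν₂, isOpen_Ioi, ordConnected_Ioi, by ext; simp⟩

/-- The vector `a e_i + b e_j`. -/
def planeVec (i j : Fin n) (a b : ℝ) : Rn n :=
  a • EuclideanSpace.single i (1 : ℝ) + b • EuclideanSpace.single j (1 : ℝ)

theorem planeVec_apply_fst {i j : Fin n} (hij : i ≠ j) (a b : ℝ) : planeVec i j a b i = a := by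
  simp [planeVec, hij]

theorem planeVec_apply_snd {i j : Fin n} (hij : i ≠ j) (a b : ℝ) : planeVec i j a b j = b := by
  simp [planeVec, hij.symm]

theorem planeVec_apply_of_ne {i j k : Fin n} (hi : k ≠ i) (hj : k ≠ j) (a b : ℝ) :
    planeVec i j a b k = 0 := by
  simp [planeVec, hi, hj]

theorem inner_planeVec {i j : Fin n} (hij : i ≠ j) (a b c d : ℝ) :
    inner ℝ (planeVec i j a b) (planeVec i j c d) = a * c + b * d := by
  simp [planeVec, inner_add_left, inner_add_right, inner_smul_left, inner_smul_right,
    EuclideanSpace.inner_single_left, hij, hij.symm]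
  ring

theorem norm_planeVec {i j : Fin n} (hij : i ≠ j) (a b : ℝ) :
    ‖planeVec i j a b‖ = √(a ^ 2 + b ^ 2) := by
  rw [norm_eq_sqrt_real_inner, inner_planeVec hij]
  ring_nf

theorem norm_planeVec_zero {i j : Fin n} (hij : i ≠ j) {a : ℝ} (ha : 0 ≤ a) :
    ‖planeVec i j a 0‖ = a := by
  rw [norm_planeVec hij, zero_pow two_ne_zero, add_zero, Real.sqrt_sq ha]

theorem contDiff_planeVec (i j : Fin n) :
    ContDiff ℝ ∞ fun z : ℝ × ℝ => planeVec i j z.1 z.2 := by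
  unfold planeVec
  fun_prop

theorem adm_planeVec {I : Set ℝ} {i j : Fin n} (hij : i ≠ j) {r a b : ℝ} (hr : r ∈ I)
    (hr0 : 0 < r) (hb : b ≠ 0) : Adm I (planeVec i j r 0) (planeVec i j a b) := by
  refine ⟨by rwa [norm_planeVec_zero hij hr0.le], ?_⟩
  rw [inner_planeVec hij, norm_planeVec_zero hij hr0.le, norm_planeVec hij, zero_mul, add_zero,
    abs_mul, abs_of_pos hr0]
  refine mul_lt_mul_of_pos_left ?_ hr0
  rw [← Real.sqrt_sq_eq_abs]
  have : 0 < b ^ 2 := by positivity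
  exact Real.sqrt_lt_sqrt (sq_nonneg a) (by linarith)

theorem exists_three_ne (hn : 3 ≤ n) : ∃ i j k : Fin n, i ≠ j ∧ k ≠ i ∧ k ≠ j :=
  ⟨⟨0, by omega⟩, ⟨1, by omega⟩, ⟨2, by omega⟩, by simp, by simp, by simp⟩

theorem mem_radii_iff (hn : 3 ≤ n) {J : Set ℝ} (hM : M = {x : Rn n | ‖x‖ ∈ J}) {r : ℝ} :
    r ∈ radii M ↔ 0 < r ∧ r ∈ J := by
  obtain ⟨i, j, -, hij, -, -⟩ := exists_three_ne hn
  subst hM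
  constructor
  · rintro ⟨h0, x, hx, rfl⟩
    exact ⟨h0, hx⟩
  · rintro ⟨h0, h1⟩
    have := norm_planeVec_zero hij h0.le
    exact ⟨h0, planeVec i j r 0, by simpa [this] using h1, this⟩

/-- Every point of the region comes from a pair `(x, y)` with a common vanishing coordinate. -/
theorem exists_adm (hn : 3 ≤ n) {I : Set ℝ} {r s : ℝ} (hz : (r, s) ∈ region I) :
    ∃ (x y : Rn n) (k : Fin n), Adm I x y ∧ ‖x‖ = r ∧ sArg x y = s ∧ x k = 0 ∧ y k = 0 := by
  obtain ⟨i, j, k, hij, hki, hkj⟩ := exists_three_ne hn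
  have hr := pos_of_mem_region hz
  have hw := sub_pos.2 (sq_lt_of_mem_region hz)
  have h2 : ‖planeVec i j s √(r ^ 2 - s ^ 2)‖ = r := by
    rw [norm_planeVec hij, Real.sq_sqrt hw.le]
    simp [Real.sqrt_sq hr.le]
  refine ⟨planeVec i j r 0, planeVec i j s √(r ^ 2 - s ^ 2), k,
    adm_planeVec hij hz.1 hr (Real.sqrt_pos.2 hw).ne', norm_planeVec_zero hij hr.le, ?_,
    planeVec_apply_of_ne hki hkj _ _, planeVec_apply_of_ne hki hkj _ _⟩
  rw [sArg, inner_planeVec hij, h2]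
  field_simp
  simp

/-- The function `φ` is smooth on the region `|s| < r`. -/
theorem smoothOn_of_isFinslerMetric (hn : 3 ≤ n) {I : Set ℝ} (hI : ∀ x : Rn n, ‖x‖ ∈ I → x ∈ M)
    (hF : IsFinslerMetric M (sphMetric φ)) : SmoothOn (region I) φ := by
  obtain ⟨i, j, -, hij, -, -⟩ := exists_three_ne hn
  have h1 : ∀ z ∈ region I, 0 < z.1 := fun z hz => (abs_nonneg _).trans_lt hz.2
  have h2 : ∀ z ∈ region I, 0 < z.1 ^ 2 - z.2 ^ 2 := fun z hz =>
    sub_pos.2 (sq_lt_of_mem_region hz)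
  -- For `x = r e_i` and `y = s e_i + √(r² - s²) e_j` one has `|y| = r` and `⟨x, y⟩ / |y| = s`, so
  -- `F(x, y) = r φ(r, s)`.
  have h3 : ∀ z ∈ region I, ‖planeVec i j z.2 √(z.1 ^ 2 - z.2 ^ 2)‖ = z.1 := fun z hz => by
    rw [norm_planeVec hij, Real.sq_sqrt (h2 z hz).le]
    simp [Real.sqrt_sq (h1 z hz).le]
  have d1 : ContDiffOn ℝ ∞ (fun z : ℝ × ℝ => planeVec i j z.1 0) (region I) :=
    ((contDiff_planeVec i j).comp (contDiff_fst.prodMk contDiff_const)).contDiffOn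
  have d2 : ContDiffOn ℝ ∞ (fun z : ℝ × ℝ => planeVec i j z.2 √(z.1 ^ 2 - z.2 ^ 2)) (region I) :=
    (contDiff_planeVec i j).comp_contDiffOn (contDiffOn_snd.prodMk
      (((contDiffOn_fst.pow 2).sub (contDiffOn_snd.pow 2)).sqrt fun z hz => (h2 z hz).ne'))
  have d3 := hF.smooth.comp (d1.prodMk d2) fun z hz => by
    refine ⟨hI _ ?_, ?_⟩
    · simpa [norm_planeVec_zero hij (h1 z hz).le] using hz.1
    · simp only [mem_compl_iff, mem_singleton_iff]
      rw [← norm_eq_zero, h3 z hz]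
      exact (h1 z hz).ne'
  refine (d3.div contDiffOn_fst fun z hz => (h1 z hz).ne').congr fun z hz => ?_
  have e : Function.uncurry (sphMetric φ) (planeVec i j z.1 0, planeVec i j z.2 √(z.1 ^ 2 - z.2 ^ 2))
      = z.1 * φ z.1 z.2 := by
    have := (h1 z hz).ne'
    simp only [Function.uncurry, sphMetric, h3 z hz, norm_planeVec_zero hij (h1 z hz).le,
      inner_planeVec hij]
    rw [zero_mul, add_zero, mul_div_cancel_left₀ _ this]
  change φ z.1 z.2 = Function.uncurry (sphMetric φ) _ / z.1
  rw [e, mul_div_cancel_left₀ _ (h1 z hz).ne']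

theorem pos_of_isFinslerMetric (hF : IsFinslerMetric M (sphMetric φ)) (hx : x ∈ M) (hy : y ≠ 0) :
    0 < lift φ x y :=
  pos_of_mul_pos_right (hF.pos x hx y hy) (norm_nonneg y)

end Domain

/-! ### Regularity of the tensors on all of `M`, for use at `|s| = r` and at `x = 0`, which the
explicit formulas do not reach. -/

section Smoothness

variable {n : ℕ} {M : Set (Rn n)} {f : Rn n → Rn n → ℝ}

theorem contDiffOn_dx (hM : IsOpen M) (i : Fin n)
    (h : ContDiffOn ℝ ∞ (Function.uncurry f) (M ×ˢ {0}ᶜ)) :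
    ContDiffOn ℝ ∞ (Function.uncurry (dx i f)) (M ×ˢ {0}ᶜ) := by
  have hO : IsOpen (M ×ˢ ({0}ᶜ : Set (Rn n))) := hM.prod isOpen_compl_singleton
  refine ((h.fderiv_of_isOpen (m := ∞) hO (by simp)).clm_apply
    (contDiffOn_const (c := (EuclideanSpace.single i (1 : ℝ), (0 : Rn n))))).congr ?_
  rintro ⟨x, y⟩ hz
  have hd : DifferentiableAt ℝ (Function.uncurry f) (x, y) :=
    (h.contDiffAt (hO.mem_nhds hz)).differentiableAt (by simp)
  have := HasFDerivAt.comp (f := fun x' => (x', y)) x hd.hasFDerivAt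
    ((hasFDerivAt_id x).prodMk (hasFDerivAt_const y x))
  have e : fderiv ℝ (fun x' => f x' y) x = _ := this.fderiv
  simp [Function.uncurry, dx, e]

theorem contDiffOn_dy (hM : IsOpen M) (i : Fin n)
    (h : ContDiffOn ℝ ∞ (Function.uncurry f) (M ×ˢ {0}ᶜ)) :
    ContDiffOn ℝ ∞ (Function.uncurry (dy i f)) (M ×ˢ {0}ᶜ) := by
  have hO : IsOpen (M ×ˢ ({0}ᶜ : Set (Rn n))) := hM.prod isOpen_compl_singleton
  refine ((h.fderiv_of_isOpen (m := ∞) hO (by simp)).clm_apply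
    (contDiffOn_const (c := ((0 : Rn n), EuclideanSpace.single i (1 : ℝ))))).congr ?_
  rintro ⟨x, y⟩ hz
  have hd : DifferentiableAt ℝ (Function.uncurry f) (x, y) :=
    (h.contDiffAt (hO.mem_nhds hz)).differentiableAt (by simp)
  have := HasFDerivAt.comp (f := fun y' => (x, y')) y hd.hasFDerivAt
    ((hasFDerivAt_const x y).prodMk (hasFDerivAt_id y))
  have e : fderiv ℝ (fun y' => f x y') y = _ := this.fderiv
  simp [Function.uncurry, dy, e]

variable {F : Rn n → Rn n → ℝ}

theorem IsFinslerMetric.contDiffOn_sq (hF : IsFinslerMetric M F) :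
    ContDiffOn ℝ ∞ (Function.uncurry (sq F)) (M ×ˢ {0}ᶜ) := hF.smooth.pow 2

theorem IsFinslerMetric.continuousOn_fundamental (hM : IsOpen M) (hF : IsFinslerMetric M F) :
    ContinuousOn (fun z : Rn n × Rn n => fundamental F z.1 z.2) (M ×ˢ {0}ᶜ) := by
  refine continuousOn_pi.2 fun i => continuousOn_pi.2 fun j => ?_
  exact continuousOn_const.mul
    (contDiffOn_dy hM j (contDiffOn_dy hM i hF.contDiffOn_sq)).continuousOn

theorem IsFinslerMetric.continuousOn_spray (hM : IsOpen M) (hF : IsFinslerMetric M F)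
    (i : Fin n) : ContinuousOn (Function.uncurry (spray F i)) (M ×ˢ {0}ᶜ) := by
  have h1 := hF.continuousOn_fundamental hM
  have h2 : ContinuousOn (fun z : Rn n × Rn n => (fundamental F z.1 z.2)⁻¹) (M ×ˢ {0}ᶜ) := by
    have hdet : ContinuousOn (fun z : Rn n × Rn n => (fundamental F z.1 z.2).det) (M ×ˢ {0}ᶜ) :=
      (continuous_id.matrix_det).comp_continuousOn h1
    have hadj : ContinuousOn (fun z : Rn n × Rn n => (fundamental F z.1 z.2).adjugate)
        (M ×ˢ {0}ᶜ) := (continuous_id.matrix_adjugate).comp_continuousOn h1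
    simp only [Matrix.inv_def, Ring.inverse_eq_inv']
    exact (hdet.inv₀ fun z hz => (isUnit_det_of_posDef (hF.posDef z.1 hz.1 z.2 hz.2)).ne_zero).smul
      hadj
  have h3 : ∀ l, ContinuousOn (fun z : Rn n × Rn n => (fundamental F z.1 z.2)⁻¹ i l) (M ×ˢ {0}ᶜ) :=
    fun l => continuousOn_pi.1 (continuousOn_pi.1 h2 i) l
  refine continuousOn_const.mul (continuousOn_finsetSum _ fun l _ => (h3 l).mul
    ((continuousOn_finsetSum _ fun k _ => ?_).sub
      (contDiffOn_dx hM l hF.contDiffOn_sq).continuousOn))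
  have hyk : Continuous fun z : Rn n × Rn n => z.2 k := by fun_prop
  exact hyk.continuousOn.mul
    (contDiffOn_dy hM l (contDiffOn_dx hM k hF.contDiffOn_sq)).continuousOn

end Smoothness

/-! ### Consequences of the hypotheses for `φ`, `P` and `Q`. -/

section Main

variable {n : ℕ} {M : Set (Rn n)} {I : Set ℝ} {φ : ℝ → ℝ → ℝ} {x y : Rn n} {r s : ℝ}

theorem pos_on_region (hn : 3 ≤ n) (hI : ∀ x : Rn n, ‖x‖ ∈ I → x ∈ M)
    (hF : IsFinslerMetric M (sphMetric φ)) (hz : (r, s) ∈ region I) : 0 < φ r s := by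
  obtain ⟨x, y, -, h, rfl, rfl, -, -⟩ := exists_adm hn hz
  exact pos_of_isFinslerMetric hF (hI x h.1) h.ne_right

theorem qDen_pos_on_region (hn : 3 ≤ n) (hIo : IsOpen I) (hI : ∀ x : Rn n, ‖x‖ ∈ I → x ∈ M)
    (hF : IsFinslerMetric M (sphMetric φ)) (hz : (r, s) ∈ region I) : 0 < qDen φ r s := by
  obtain ⟨x, y, -, h, rfl, rfl, -, -⟩ := exists_adm hn hz
  exact qDen_pos_of_posDef hIo (smoothOn_of_isFinslerMetric hn hI hF) h
    (pos_of_isFinslerMetric hF (hI x h.1) h.ne_right) (hF.posDef x (hI x h.1) y h.ne_right)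

theorem smoothOn_P (hn : 3 ≤ n) (hIo : IsOpen I) (hI : ∀ x : Rn n, ‖x‖ ∈ I → x ∈ M)
    (hF : IsFinslerMetric M (sphMetric φ)) : SmoothOn (region I) (P φ) := fun _ hz =>
  (contDiffAt_P ((smoothOn_of_isFinslerMetric hn hI hF).contDiffAt (isOpen_region hIo) hz)
    (pos_of_mem_region hz).ne' (pos_on_region hn hI hF hz).ne'
    (qDen_pos_on_region hn hIo hI hF hz).ne').contDiffWithinAt

theorem smoothOn_Q (hn : 3 ≤ n) (hIo : IsOpen I) (hI : ∀ x : Rn n, ‖x‖ ∈ I → x ∈ M)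
    (hF : IsFinslerMetric M (sphMetric φ)) : SmoothOn (region I) (Q φ) := fun _ hz =>
  (contDiffAt_Q ((smoothOn_of_isFinslerMetric hn hI hF).contDiffAt (isOpen_region hIo) hz)
    (pos_of_mem_region hz).ne' (qDen_pos_on_region hn hIo hI hF hz).ne').contDiffWithinAt

theorem isSphSpray (hn : 3 ≤ n) (hIo : IsOpen I) (hI : ∀ x : Rn n, ‖x‖ ∈ I → x ∈ M)
    (hF : IsFinslerMetric M (sphMetric φ)) : IsSphSpray I (P φ) (Q φ) (sphMetric (n := n) φ) :=
  fun i x y h => spray_eq hIo (smoothOn_of_isFinslerMetric hn hI hF) h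
    (pos_on_region hn hI hF h.mem_region).ne' (qDen_pos_on_region hn hIo hI hF h.mem_region).ne'
    (isUnit_det_of_posDef (hF.posDef x (hI x h.1) y h.ne_right)) i

/-- The consequences of constant flag curvature. -/
theorem curvature_eqs (hn : 3 ≤ n) (hIo : IsOpen I) (hI : ∀ x : Rn n, ‖x‖ ∈ I → x ∈ M)
    (hF : IsFinslerMetric M (sphMetric φ)) {K : ℝ} (hK : K ≠ 0)
    (hc : HasConstantFlagCurvature M (sphMetric φ) K) (hz : (r, s) ∈ region I) :
    K * φ r s ^ 2 = R₁ φ r s ∧ curvRadial (Q φ) r s = 0 := by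
  obtain ⟨x, y, -, h, rfl, rfl, -, -⟩ := exists_adm hn hz
  have hφ := smoothOn_of_isFinslerMetric hn hI hF
  obtain ⟨a, b, hR⟩ := (isSphSpray hn hIo hI hF).riemann_eq hIo (smoothOn_P hn hIo hI hF)
    (smoothOn_Q hn hIo hI hF) h
  have hR' : ∀ i k, riemann (sphMetric φ) i k x y =
      ‖y‖ ^ 2 * lift (curvDiag (P φ) (Q φ)) x y * (if i = k then 1 else 0) +
      ((‖y‖ ^ 2 * lift (curvRadial (Q φ)) x y) * x k +
        (-(‖y‖ * lift (curvRadial (Q φ)) x y * sArg x y)) * y k) * x i +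
      (a * x k + b * y k) * y i := fun i k => by rw [hR]; ring
  have hy := h.norm_right_pos.ne'
  have h1 := curvDiag_eq hn hIo hφ h hR' hK (hc x (hI x h.1) y)
  have h2 := curvRadial_eq hIo hφ h (pos_on_region hn hI hF h.mem_region).ne' hR' (by ring) hK
    (hc x (hI x h.1) y)
  constructor
  · apply mul_left_cancel₀ (pow_ne_zero 2 hy)
    have : R₁ φ ‖x‖ (sArg x y) = lift (curvDiag (P φ) (Q φ)) x y := rfl
    rw [this, h1]
    simp only [lift]
    ring
  · have hw := (sub_pos.2 (sq_lt_of_mem_region h.mem_region)).ne'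
    have h3 : (‖y‖ ^ 2 * (‖x‖ ^ 2 - sArg x y ^ 2)) * curvRadial (Q φ) ‖x‖ (sArg x y) = 0 := by
      rw [← h1] at h2
      simp only [lift] at h2
      linear_combination h2
    exact (mul_eq_zero.1 h3).resolve_left (mul_ne_zero (pow_ne_zero 2 hy) hw)

/-- The form of `Q` for a Douglas metric. -/
theorem Q_eq_of_isDouglas (hn : 3 ≤ n) (hIo : IsOpen I) (hI : ∀ x : Rn n, ‖x‖ ∈ I → x ∈ M)
    (hF : IsFinslerMetric M (sphMetric φ)) (hD : IsDouglas M (sphMetric φ))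
    (hz : (r, s) ∈ region I) :
    Q φ r s = Q φ r 0 + ps (ps (Q φ)) r 0 / 2 * s ^ 2 := by
  refine (smoothOn_Q hn hIo hI hF).eq_quadratic hIo (fun r s hz => ?_) hz
  obtain ⟨x, y, k, h, rfl, rfl, hx, hy⟩ := exists_adm hn hz
  exact (isSphSpray hn hIo hI hF).ps_eq_of_douglas hIo (smoothOn_P hn hIo hI hF)
    (smoothOn_Q hn hIo hI hF) h hx hy (hD x (hI x h.1) y h.ne_right k k k k)

theorem mem_region_zero (hr : r ∈ I) (hr0 : 0 < r) : (r, (0 : ℝ)) ∈ region I :=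
  ⟨hr, by simpa using hr0⟩

theorem SmoothOn.contDiffOn_zero {f : ℝ → ℝ → ℝ} (hf : SmoothOn (region I) f)
    (hpos : ∀ r ∈ I, 0 < r) : ContDiffOn ℝ ∞ (fun r => f r 0) I :=
  ContDiffOn.comp (g := Function.uncurry f) hf (contDiffOn_id.prodMk contDiffOn_const)
    fun r hr => mem_region_zero hr (hpos r hr)

/-- The relation between the coefficients of `Q = g + c s²`, if its radial curvature vanishes. -/
theorem coeff_relation {q : ℝ → ℝ → ℝ} (hIo : IsOpen I) (hpos : ∀ r ∈ I, 0 < r)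
    {g c : ℝ → ℝ}
    (hQ : ∀ r s, (r, s) ∈ region I → q r s = g r + c r * s ^ 2)
    (h0 : ∀ r s, (r, s) ∈ region I → curvRadial q r s = 0) (hr : r ∈ I) :
    c r * (r * (1 - 2 * r ^ 2 * g r)) = deriv g r + 2 * r * g r ^ 2 := by
  have hΩ := isOpen_region hIo
  have hz := mem_region_zero hr (hpos r hr)
  -- The value at `s = 0` already contains the whole relation: `4 g² + 2 g' / r - 2 c + 4 r² g c =
  -- 0`.
  have h1 := h0 r 0 hz
  have e1 : ∀ r s, (r, s) ∈ region I → ps q r s = 2 * c r * s := fun r s h => by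
    rw [ps_congr hΩ hQ h]
    have : HasDerivAt (fun s => g r + c r * s ^ 2) (c r * (2 * s)) s := by
      simpa using ((hasDerivAt_id s).pow 2).const_mul (c r) |>.const_add (g r)
    rw [ps, this.deriv]; ring
  have e2 : ps (ps q) r 0 = 2 * c r := by
    rw [ps_congr hΩ e1 hz]
    simp [ps]
  have e3 : pr q r 0 = deriv g r := by
    rw [pr_congr hΩ hQ hz]
    simp [pr]
  have e4 := hQ r 0 hz
  rw [curvRadial, e1 r 0 hz, e2, e3, e4] at h1
  have := (hpos r hr).ne'
  field_simp at h1
  linear_combination (-1 / 2) * h1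

/-- At the boundary `|s| = r` of the region, the denominator of `Q` is positive. -/
theorem qDen_pos_of_abs_eq (hn : 3 ≤ n) (hIo : IsOpen I) (hI : ∀ x : Rn n, ‖x‖ ∈ I → x ∈ M)
    (hMo : IsOpen M) (hF : IsFinslerMetric M (sphMetric φ)) (hr : r ∈ I) (hr0 : 0 < r)
    (hs : |s| = r) (hφ : ContDiffAt ℝ ∞ (Function.uncurry φ) (r, s)) :
    0 < φ r s ∧ 0 < qDen φ r s := by
  obtain ⟨i, j, k, hij, hki, hkj⟩ := exists_three_ne hn
  have hs2 : s ^ 2 = r ^ 2 := by rw [← hs, sq_abs]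
  set x : Rn n := planeVec i j r 0
  -- As `w` is orthogonal to `x` and `y`, `g_y(w, w)` should be the diagonal coefficient `fundDiag`.
  -- For `|s| = r` the `φ_ss` term of `qDen` drops out, and `fundDiag = φ · qDen`.
  set w : Rn n := EuclideanSpace.single k (1 : ℝ)
  have hxn : ‖x‖ = r := norm_planeVec_zero hij hr0.le
  have hxM : x ∈ M := hI x (by rwa [hxn])
  have hyn : ∀ t, ‖planeVec i j s t‖ = √(r ^ 2 + t ^ 2) := fun t => by
    rw [norm_planeVec hij, hs2]
  have hy0 : planeVec i j s 0 ≠ (0 : Rn n) := by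
    rw [← norm_ne_zero_iff, hyn]
    simpa [Real.sqrt_sq hr0.le] using hr0.ne'
  have harg : ∀ t, sArg x (planeVec i j s t) = r * s / √(r ^ 2 + t ^ 2) := fun t => by
    rw [sArg, hyn, inner_planeVec hij, zero_mul, add_zero]
  have harg0 : r * s / √(r ^ 2 + 0 ^ 2) = s := by
    rw [zero_pow two_ne_zero, add_zero, Real.sqrt_sq hr0.le]
    field_simp
  have hφ0 : 0 < φ r s := by
    have := pos_of_isFinslerMetric hF hxM hy0
    rwa [lift, hxn, harg, harg0] at this
  refine ⟨hφ0, ?_⟩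
  have hw : w ≠ 0 := by simp [w]
  have hpos := hF.posDef x hxM _ hy0 w hw
  -- the value of the fundamental tensor as a limit
  have hg : ∀ y, gInner (sphMetric φ) x y w w = fundamental (sphMetric φ) x y k k := fun y => by
    simp [gInner, w]
  have hyc : Continuous fun t => planeVec (n := n) i j s t :=
    (contDiff_planeVec i j).continuous.comp (by fun_prop : Continuous fun t : ℝ => (s, t))
  have hlim1 : Filter.Tendsto (fun t => fundamental (sphMetric φ) x (planeVec i j s t) k k)
      (nhds 0) (nhds (fundamental (sphMetric φ) x (planeVec i j s 0) k k)) := by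
    have h1 : ContinuousOn (fun z : Rn n × Rn n => fundamental (sphMetric φ) z.1 z.2 k k)
        (M ×ˢ {0}ᶜ) :=
      continuousOn_pi.1 (continuousOn_pi.1 (hF.continuousOn_fundamental hMo) k) k
    have h2 := h1.continuousAt ((hMo.prod isOpen_compl_singleton).mem_nhds
      (show (x, planeVec i j s 0) ∈ _ from ⟨hxM, hy0⟩))
    exact ContinuousAt.comp (f := fun t => (x, planeVec (n := n) i j s t)) h2
      (continuous_const.prodMk hyc).continuousAt
  have hlim2 : Filter.Tendsto (fun t => fundDiag φ r (r * s / √(r ^ 2 + t ^ 2)))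
      (nhds 0) (nhds (fundDiag φ r s)) := by
    have h1 : ContinuousAt (Function.uncurry (fundDiag φ)) (r, r * s / √(r ^ 2 + 0 ^ 2)) := by
      rw [harg0]
      have c1 := hφ.continuousAt
      have c2 := (contDiffAt_ps hφ).continuousAt
      exact (c1.pow 2).sub ((continuousAt_snd.mul c1).mul c2)
    have h2 : ContinuousAt (fun t : ℝ => (r, r * s / √(r ^ 2 + t ^ 2))) 0 := by
      refine continuousAt_const.prodMk (continuousAt_const.div (by fun_prop) ?_)
      simpa [Real.sqrt_sq hr0.le] using hr0.ne'
    have := (ContinuousAt.comp (f := fun t : ℝ => (r, r * s / √(r ^ 2 + t ^ 2))) h1 h2).tendsto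
    simp only [Function.comp_def, Function.uncurry, harg0] at this
    exact this
  -- At `t = 0` the vectors are parallel and the formula for the tensor is unavailable; it is
  -- reached as a limit through `t ≠ 0`.
  have heq : fundDiag φ r s = fundamental (sphMetric φ) x (planeVec i j s 0) k k := by
    refine tendsto_nhds_unique (hlim2.mono_left (nhdsWithin_le_nhds (s := {0}ᶜ)))
      ((hlim1.mono_left nhdsWithin_le_nhds).congr' ?_)
    filter_upwards [self_mem_nhdsWithin] with t ht
    have hadm : Adm I x (planeVec i j s t) := adm_planeVec hij hr hr0 ht
    rw [fundamental_eq hIo (smoothOn_of_isFinslerMetric hn hI hF) hadm,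
      planeVec_apply_of_ne hki hkj, planeVec_apply_of_ne hki hkj, lift, hxn, harg]
    simp
  rw [hg, ← heq] at hpos
  have e : fundDiag φ r s = φ r s * qDen φ r s := by
    rw [fundDiag, qDen, hs2]
    ring
  rw [e] at hpos
  exact pos_of_mul_pos_right hpos hφ0.le

/-- Both sides are continuous in `s` at the endpoint, since `φ` and `qDen` are still positive there;
so the identity extends from `|s| < r`. -/
theorem R₁_eq_of_abs_eq (hn : 3 ≤ n) (hIo : IsOpen I) (hI : ∀ x : Rn n, ‖x‖ ∈ I → x ∈ M)
    (hMo : IsOpen M) (hF : IsFinslerMetric M (sphMetric φ)) (hr : r ∈ I) (hr0 : 0 < r)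
    (hs : |s| = r) (hφ : ContDiffAt ℝ ∞ (Function.uncurry φ) (r, s)) {K : ℝ}
    (hK : ∀ s, |s| < r → K * φ r s ^ 2 = R₁ φ r s) : K * φ r s ^ 2 = R₁ φ r s := by
  obtain ⟨h1, h2⟩ := qDen_pos_of_abs_eq hn hIo hI hMo hF hr hr0 hs hφ
  have hc : ContinuousAt (fun t : ℝ => (r, t)) s := by fun_prop
  have c1 : ContinuousAt (fun t => φ r t) s :=
    ContinuousAt.comp (g := Function.uncurry φ) (f := fun t : ℝ => (r, t)) hφ.continuousAt hc
  have c2 : ContinuousAt (fun t => R₁ φ r t) s :=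
    ContinuousAt.comp (g := Function.uncurry (R₁ φ)) (f := fun t : ℝ => (r, t))
      (contDiffAt_R₁ hφ hr0.ne' h1.ne' h2.ne').continuousAt hc
  have hmem : s ∈ closure (Ioo (-r) r) := by
    rw [closure_Ioo (by linarith : -r ≠ r)]
    exact abs_le.1 hs.le
  have : (nhdsWithin s (Ioo (-r) r)).NeBot := mem_closure_iff_nhdsWithin_neBot.1 hmem
  refine tendsto_nhds_unique (((c1.tendsto.pow 2).const_mul K).mono_left
    (nhdsWithin_le_nhds (s := Ioo (-r) r)))
    ((c2.tendsto.mono_left nhdsWithin_le_nhds).congr' ?_)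
  filter_upwards [self_mem_nhdsWithin] with t ht
  exact (hK t (abs_lt.2 ht)).symm

/-- If `0 ∈ M`, the coefficients of `Q = g + c s²` are bounded by a multiple of `1 / r`. -/
theorem exists_bounds (hn : 3 ≤ n) (hIo : IsOpen I) (hI : ∀ x : Rn n, ‖x‖ ∈ I → x ∈ M)
    (hpos : ∀ r ∈ I, 0 < r)
    (hMo : IsOpen M) (hF : IsFinslerMetric M (sphMetric φ)) (h0 : (0 : Rn n) ∈ M) {g c : ℝ → ℝ}
    (hQ : ∀ r s, (r, s) ∈ region I → Q φ r s = g r + c r * s ^ 2) :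
    ∃ δ B : ℝ, 0 < δ ∧ (∀ r ∈ I, r < δ → |r * g r| ≤ B) ∧
      ∀ r ∈ I, r < δ → |r * (g r + c r * r ^ 2)| ≤ B := by
  obtain ⟨i, j, -, hij, -, -⟩ := exists_three_ne hn
  have hS := isSphSpray hn hIo hI hF
  -- The spray is continuous at `(0, y)` with `y = a e_i + e_j`, hence bounded there for `x = r e_i`
  -- with small `r`.
  have key : ∀ (l : Fin n) (a : ℝ), ∃ δ B : ℝ, 0 < δ ∧ ∀ r, |r| < δ →
      |spray (sphMetric φ) l (planeVec i j r 0) (planeVec i j a 1)| ≤ B := by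
    intro l a
    have hy : planeVec i j a 1 ≠ (0 : Rn n) := fun h => by
      have := planeVec_apply_snd hij a 1
      simp [h] at this
    have hx : planeVec i j 0 0 = (0 : Rn n) := by simp [planeVec]
    have h1 := (hF.continuousOn_spray hMo l).continuousAt
      ((hMo.prod isOpen_compl_singleton).mem_nhds (show (planeVec i j 0 0, planeVec i j a 1) ∈ _ from
        ⟨by rwa [hx], hy⟩))
    have h2 : Continuous fun r => (planeVec (n := n) i j r 0, planeVec (n := n) i j a 1) :=
      ((contDiff_planeVec i j).continuous.comp
        (by fun_prop : Continuous fun t : ℝ => (t, (0 : ℝ)))).prodMk continuous_const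
    have h3 := (ContinuousAt.comp
      (f := fun r => (planeVec (n := n) i j r 0, planeVec (n := n) i j a 1)) (x := 0) h1
      h2.continuousAt).abs
    obtain ⟨δ, hδ, h4⟩ := Metric.eventually_nhds_iff.1
      (h3.eventually (gt_mem_nhds (lt_add_one _)))
    exact ⟨δ, _, hδ, fun r hr => (h4 (by simpa using hr)).le⟩
  have hval : ∀ (l : Fin n) (a r : ℝ), r ∈ I →
      spray (sphMetric φ) l (planeVec i j r 0) (planeVec i j a 1) =
        √(a ^ 2 + 1) * lift (P φ) (planeVec (n := n) i j r 0) (planeVec i j a 1) *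
          planeVec i j a 1 l + (a ^ 2 + 1) *
          (g r + c r * (r * a / √(a ^ 2 + 1)) ^ 2) * planeVec i j r 0 l := by
    intro l a r hr
    have hadm : Adm I (planeVec i j r 0) (planeVec (n := n) i j a 1) :=
      adm_planeVec hij hr (hpos r hr) one_ne_zero
    have hn1 : ‖planeVec (n := n) i j a 1‖ = √(a ^ 2 + 1) := by simp [norm_planeVec hij]
    have hs : sArg (planeVec i j r 0) (planeVec (n := n) i j a 1) = r * a / √(a ^ 2 + 1) := by
      rw [sArg, hn1, inner_planeVec hij]
      simp
    rw [hS l _ _ hadm, hn1, Real.mul_self_sqrt (by positivity)]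
    have : lift (Q φ) (planeVec i j r 0) (planeVec (n := n) i j a 1) =
        g r + c r * (r * a / √(a ^ 2 + 1)) ^ 2 := by
      have hz := hadm.mem_region
      rw [lift, hQ _ _ hz, hs, norm_planeVec_zero hij (hpos r hr).le]
    rw [this]
  -- For `y = e_j` the `i`-th coefficient is `r g`. For `y = e_i + e_j` the `P` terms of the `i`-th
  -- and `j`-th coefficients agree, and their difference is `2 r g + c r³`; subtracting `r g` leaves
  -- `r (g + c r²)`.
  obtain ⟨δ₁, B₁, hδ₁, h1⟩ := key i 0
  obtain ⟨δ₂, B₂, hδ₂, h2⟩ := key i 1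
  obtain ⟨δ₃, B₃, hδ₃, h3⟩ := key j 1
  have hB : ∀ r ∈ I, r < min δ₁ (min δ₂ δ₃) → |r * g r| ≤ B₁ ∧
      |r * (g r + c r * r ^ 2)| ≤ B₁ + B₂ + B₃ := by
    intro r hr hlt
    have hr' : |r| = r := abs_of_pos (hpos r hr)
    have k1 := h1 r (by rw [hr']; exact hlt.trans_le (min_le_left _ _))
    have k2 := h2 r (by rw [hr']; exact hlt.trans_le ((min_le_right _ _).trans (min_le_left _ _)))
    have k3 := h3 r (by rw [hr']; exact hlt.trans_le ((min_le_right _ _).trans (min_le_right _ _)))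
    rw [hval _ _ _ hr] at k1 k2 k3
    simp only [planeVec_apply_fst hij, planeVec_apply_snd hij] at k1 k2 k3
    have e2 : (r * 1 / √((1 : ℝ) ^ 2 + 1)) ^ 2 = r ^ 2 / 2 := by
      rw [div_pow, Real.sq_sqrt (by positivity)]
      norm_num
    rw [e2] at k2
    generalize √((1 : ℝ) ^ 2 + 1) * _ = A at k2 k3
    simp only [mul_zero, zero_pow two_ne_zero, zero_div, zero_add, one_mul, add_zero, mul_one] at k1 k2 k3
    rw [abs_le] at k1 k2 k3
    refine ⟨abs_le.2 ⟨by linarith, by linarith⟩, abs_le.2 ⟨by nlinarith, by nlinarith⟩⟩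
  have hB₁ : 0 ≤ B₁ := (abs_nonneg _).trans (h1 0 (by simpa using hδ₁))
  have hB₂ : 0 ≤ B₂ := (abs_nonneg _).trans (h2 0 (by simpa using hδ₂))
  have hB₃ : 0 ≤ B₃ := (abs_nonneg _).trans (h3 0 (by simpa using hδ₃))
  exact ⟨_, B₁ + B₂ + B₃, by positivity, fun r hr h => (hB r hr h).1.trans (by linarith),
    fun r hr h => (hB r hr h).2⟩

end Main

/-- The equation for `P` is the equation for `W = P - s P_s` written out, because `W_s = -s P_ss`.
-/
theorem charEq_of_P_pde {I : Set ℝ} (hI : IsOpen I) {p : ℝ → ℝ → ℝ} (hp : SmoothOn (region I) p)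
    {g c : ℝ → ℝ} (h : ∀ r s, (r, s) ∈ region I →
      s * (pr p r s - s * pr (ps p) r s) +
      r * (1 - 2 * (r ^ 2 - s ^ 2) * (g r + c r * s ^ 2)) * (-s * ps (ps p) r s) +
      2 * r * s * (g r + c r * s ^ 2) * (p r s - s * ps p r s) = 0) :
    CharData.CharEq I g c fun r s => p r s - s * ps p r s := by
  intro r s hz
  have hΩ := isOpen_region hI
  have d : HasDerivAt (fun r => p r s - s * ps p r s) (pr p r s - s * pr (ps p) r s) r :=
    (hp.hasDerivAt_fst hΩ hz).sub (((hp.smoothOn_ps hΩ).hasDerivAt_fst hΩ hz).const_mul s)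
  have e : pr (fun r s => p r s - s * ps p r s) r s = _ := d.deriv
  rw [e, ps_sub_mul_ps hΩ hp hz]
  exact h r s hz

end SphFinsler

end

theorem mainTheorem5 (n : ℕ) (hn : 3 ≤ n) (M : Set (SphFinsler.Rn n))
    (hM : SphFinsler.IsSymmetricDomain M) (φ : ℝ → ℝ → ℝ)
    (hF : SphFinsler.IsFinslerMetric M (SphFinsler.sphMetric φ))
    (hD : SphFinsler.IsDouglas M (SphFinsler.sphMetric φ))
    (K : ℝ) (hK : K ≠ 0)
    (hc : SphFinsler.HasConstantFlagCurvature M (SphFinsler.sphMetric φ) K) :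
    (∀ r ∈ SphFinsler.radii M, ∀ s : ℝ,
      (|s| < r ∨ (|s| = r ∧ ContDiffAt ℝ ∞ (Function.uncurry φ) (r, s))) →
        K * φ r s ^ 2 = SphFinsler.R₁ φ r s ∧ φ r s = √(SphFinsler.R₁ φ r s / K)) ∧
    ∃ g T Tbar : ℝ → ℝ,
      ContDiffOn ℝ ∞ g (SphFinsler.radii M) ∧
      {r ∈ SphFinsler.radii M | 2 * r ^ 2 * g r = 1}.Subsingleton ∧
      SphFinsler.IsT (SphFinsler.radii M) g T ∧
      SphFinsler.IsTbar (SphFinsler.radii M) g T Tbar ∧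
      (∀ r ∈ SphFinsler.radii M, 2 * r ^ 2 * g r ≠ 1 → ∀ s : ℝ, |s| < r →
        SphFinsler.Q φ r s =
          g r + (deriv g r + 2 * r * g r ^ 2) / (r - 2 * r ^ 3 * g r) * s ^ 2) ∧
      ∃ h₁ η₁ h₂ η₂ : ℝ → ℝ,
        (0 ∈ M → η₁ = η₂) ∧
        SphFinsler.HasIntegralForm (SphFinsler.radii M) T Tbar 1 (SphFinsler.P φ) h₁ η₁ ∧
        SphFinsler.HasIntegralForm (SphFinsler.radii M) T Tbar (-1) (SphFinsler.P φ) h₂ η₂ := by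
  obtain ⟨J, hJo, hJc, hMJ⟩ := hM.exists_norm_mem
  have hmem : ∀ r, r ∈ SphFinsler.radii M ↔ 0 < r ∧ r ∈ J := fun r =>
    SphFinsler.mem_radii_iff hn hMJ
  have hIJ : SphFinsler.radii M = Ioi 0 ∩ J := by ext r; exact hmem r
  have hMo : IsOpen M := hMJ ▸ hJo.preimage continuous_norm
  have hIo : IsOpen (SphFinsler.radii M) := hIJ ▸ isOpen_Ioi.inter hJo
  have hIc : (SphFinsler.radii M).OrdConnected := hIJ ▸ ordConnected_Ioi.inter hJc
  have hpos : ∀ r ∈ SphFinsler.radii M, 0 < r := fun r hr => hr.1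
  have hI : ∀ x : SphFinsler.Rn n, ‖x‖ ∈ SphFinsler.radii M → x ∈ M := fun x hx => by
    rw [hMJ]
    exact ((hmem _).1 hx).2
  have hφ := SphFinsler.smoothOn_of_isFinslerMetric hn hI hF
  have hφ0 := fun r s hz => SphFinsler.pos_on_region (r := r) (s := s) hn hI hF hz
  have hcurv := fun r s hz => SphFinsler.curvature_eqs (r := r) (s := s) hn hIo hI hF hK hc hz
  refine ⟨fun r hr s hs => ?_, ?_⟩
  · have hr0 := hpos r hr
    obtain ⟨h1, h2⟩ : 0 < φ r s ∧ K * φ r s ^ 2 = SphFinsler.R₁ φ r s := by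
      rcases hs with hs | ⟨hs, hsm⟩
      · exact ⟨hφ0 r s ⟨hr, hs⟩, (hcurv r s ⟨hr, hs⟩).1⟩
      · exact ⟨(SphFinsler.qDen_pos_of_abs_eq hn hIo hI hMo hF hr hr0 hs hsm).1,
          SphFinsler.R₁_eq_of_abs_eq hn hIo hI hMo hF hr hr0 hs hsm
            fun t ht => (hcurv r t ⟨hr, ht⟩).1⟩
    refine ⟨h2, ?_⟩
    rw [← h2, mul_div_cancel_left₀ _ hK, Real.sqrt_sq h1.le]
  have hQs := SphFinsler.smoothOn_Q hn hIo hI hF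
  have hPs := SphFinsler.smoothOn_P hn hIo hI hF
  have hΩ := SphFinsler.isOpen_region hIo
  -- Read off from `Q` at `s = 0`, both `g` and `c` are smooth on the whole of `I`. The quotient
  -- form of `c` enters only where `2 r² g ≠ 1`.
  obtain ⟨g, hg⟩ : ∃ g : ℝ → ℝ, g = fun r => SphFinsler.Q φ r 0 := ⟨_, rfl⟩
  obtain ⟨c, hcdef⟩ : ∃ c : ℝ → ℝ,
    c = fun r => SphFinsler.ps (SphFinsler.ps (SphFinsler.Q φ)) r 0 / 2 := ⟨_, rfl⟩
  have hgs : ContDiffOn ℝ ∞ g (SphFinsler.radii M) := hg ▸ hQs.contDiffOn_zero hpos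
  have hcs : ContDiffOn ℝ ∞ c (SphFinsler.radii M) := hcdef ▸
    (((hQs.smoothOn_ps hΩ).smoothOn_ps hΩ).contDiffOn_zero hpos).div_const 2
  have hder : ∀ f : ℝ → ℝ, ContDiffOn ℝ ∞ f (SphFinsler.radii M) →
      ∀ r ∈ SphFinsler.radii M, HasDerivAt f (deriv f r) r := fun f hf r hr =>
    ((hf.contDiffAt (hIo.mem_nhds hr)).differentiableAt (by simp)).hasDerivAt
  have hQ : ∀ r s, (r, s) ∈ SphFinsler.region (SphFinsler.radii M) →
      SphFinsler.Q φ r s = g r + c r * s ^ 2 := fun r s hz => by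
    rw [hg, hcdef]
    exact SphFinsler.Q_eq_of_isDouglas hn hIo hI hF hD hz
  have hgc : ∀ r ∈ SphFinsler.radii M,
      c r * (r * (1 - 2 * r ^ 2 * g r)) = deriv g r + 2 * r * g r ^ 2 := fun r hr =>
    SphFinsler.coeff_relation hIo hpos hQ (fun r s hz => (hcurv r s hz).2) hr
  obtain ⟨τ, B, hdata⟩ := SphFinsler.exists_charData hIo hIc hpos (hder g hgs) hcs.continuousOn hgc
  have hpde := SphFinsler.charEq_of_P_pde hIo hPs fun r s hz =>
    SphFinsler.P_pde hIo hφ hφ0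
      (fun r s hz => (SphFinsler.qDen_pos_on_region hn hIo hI hF hz).ne') (hder g hgs)
      (hder c hcs) hQ hgc (fun r s hz => (hcurv r s hz).1) hz
  refine ⟨g, fun r => τ r ^ 2, B, hgs, hdata.subsingleton, hdata.isT, hdata.isTbar, ?_, _, _, _, _,
    fun h0 => ?_, hdata.hasIntegralForm hPs hpde (Or.inl rfl),
    hdata.hasIntegralForm hPs hpde (Or.inr rfl)⟩
  · intro r hr hne s hs
    have hk : 1 - 2 * r ^ 2 * g r ≠ 0 := fun h => hne (by linarith)
    have e : r - 2 * r ^ 3 * g r = r * (1 - 2 * r ^ 2 * g r) := by ring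
    rw [hQ r s ⟨hr, hs⟩, ← hgc r hr, e,
      mul_div_cancel_right₀ _ (mul_ne_zero (hpos r hr).ne' hk)]
  -- With `0 ∈ M` all smaller positive radii belong to `I`, and the bounds near the centre let every
  -- level curve be followed inwards to `s = 0`.
  · obtain ⟨δ, b, hδ, hb1, hb2⟩ := SphFinsler.exists_bounds hn hIo hI hpos hMo hF h0 hQ
    have hsub : ∀ r ∈ SphFinsler.radii M, ∀ a, 0 < a → a ≤ r → a ∈ SphFinsler.radii M := by
      intro r hr a ha har
      have h0J : (0 : ℝ) ∈ J := by
        rw [hMJ] at h0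
        simpa using h0
      exact (hmem a).2 ⟨ha, hJc.out h0J ((hmem r).1 hr).2 ⟨ha.le, har⟩⟩
    have hW : SphFinsler.SmoothOn (SphFinsler.region (SphFinsler.radii M))
        fun r s => SphFinsler.P φ r s - s * SphFinsler.ps (SphFinsler.P φ) r s :=
      hPs.sub (SphFinsler.SmoothOn.arg.mul (hPs.smoothOn_ps hΩ))
    have := hdata.levelValue_neg hW hpde fun C r hr _ =>
      hdata.exists_bound_nonpos hsub hδ hb1 hb2 C hr
    funext z
    rw [SphFinsler.CharData.eta, SphFinsler.CharData.eta, this]
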